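/- **Setting.** $G$ is a weighted graph on $n\ge 1$ vertices without self-loops and without isolated vertices, in which every edge has weight $w_{jk}=w_{kj}\ge 1$ (e.g. an unweighted multigraph). Let $d_j=\sum_k w_{jk}$, $m=\sum_j d_j$, and let $\Delta\ge\max_j d_j$. A *random vertex* is a vertex $i$ chosen with probability $d_i/m$. $\mathrm{maxcut}(G)$ is the largest fraction of the total edge weight that is cut by a partition of the vertices into two sets. For disjoint vertex sets $A,B$, let $\mathrm{good}(A,B)$ be the weight of the edges between $A$ and $B$, $\mathrm{cross}(A,B)$ the weight of the edges with exactly one endpoint in $A\cup B$, $\mathrm{inc}(A,B)$ the weight of the edges with at least one endpoint in $A\cup B$, and $\mathrm{cut}(A,B)=\mathrm{good}(A,B)+\mathrm{cross}(A,B)/2$. A step of the lazy random walk stays put with probability $1/2$ and otherwise hops along an incident edge chosen with probability proportional to its weight; a walk is even or odd according to its number of hops. Let $p^{\ell}_{ij}$ be the probability that the lazy walk with $\ell$ steps from $i$ ends at $j$. **Parameters.** $0\le\epsilon<1$, $\mu>0$, $\eta>0$ are constants, and $\delta,\gamma,\kappa,c>0$, $\gamma<1$, are further constants. Let $\ell=\lceil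 \mu\ln(4m/\delta^2)/(2(\delta+\epsilon'))\rceil$ (read as $0$ if this is negative) with $\epsilon'=-\ln(1-\epsilon)$, let $\sigma=1-(1-\epsilon)^{1+1/\mu}+\eta$, and let $$f(\sigma)=\begin{cases}\frac1{1+2\sqrt{\sigma(1-\sigma)}} & \sigma\le\sigma_0,\\[2pt] \frac{-1+\sqrt{4\sigma^2-8\sigma+5}}{2(1-\sigma)} & \sigma_0<\sigma\le\frac13,\\[2pt] \frac12 & \sigma>\frac13,\end{cases}$$ where $\sigma_0=0.22815\ldots$ is the point of $[0,\frac13]$ at which the first two expressions agree. For a start vertex $i$, let $\alpha=\alpha_i$ be any number with $\alpha_i\ge\max_j p^\ell_{ij}/d_j$. Let $w(t)=\lceil\kappa\ln(n)\max\{\alpha,t\}/t^2\rceil$. **Procedure Find$(i)$.** Start with $Even=Odd=\emptyset$. For $r=0,1,2,\dots$, as long as $t_r=(1-\gamma)^r\ge\gamma/m^{1+\mu/2}$: perform $w(t_r)$ lazy walks of length $\ell$ from $i$; for every vertex $j$ not yet in $Even\cup Odd$ let $\bar q(j)=\frac{1}{d_j w(t_r)}(\#\{\text{even walks ending at }j\}-\#\{\text{odd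 walks ending at }j\})$, and put $j$ into $Even$ if $\bar q(j)>t_r$ and into $Odd$ if $\bar q(j)<-t_r$; then, if $\mathrm{cut}(Even,Odd)\ge f(\sigma)\,\mathrm{inc}(Even,Odd)$ and $|Even\cup Odd|\ge c\,(\Delta t_r^2m^{1+\mu}\ln n)^{-1}$, stop and output $Even$ and $Odd$ (the procedure *succeeds*). If no round succeeds, output FAIL. Time is counted on a unit-cost random access machine that has access to the graph and the parameters (one step for each random draw, memory access, operation on a stored vertex set, arithmetic operation or comparison; only vertices at which a walk ended are examined in a round, and $\mathrm{cut}$ and $\mathrm{inc}$ are maintained incrementally). If Find takes time $T$ and outputs $Even,Odd$, its work-to-output ratio is $T/|Even\cup Odd|$. Below, $\tilde O(X)$ means at most $K(\ln m)^C X$ with constants $K,C$ independent of the graph, of $\Delta$, of $i$ and of $\alpha$. **Statement.** 1. Suppose $\sigma\le\frac13$. For all sufficiently small $\delta>0$ (depending on $\epsilon,\mu,\eta$) there is a constant $p>0$ such that, for all sufficiently small $\gamma>0$, every $A\in\mathbb N$, all sufficiently large $\kappa$ and all sufficiently small $c>0$, the following holds for every graph with $m\le n^A$ and $\mathrm{maxcut}(G)\ge1-\epsilon$.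 With probability at least $p$ over the choice of a random vertex $i$ and the randomness of Find$(i)$, Find$(i)$ succeeds; its output is a pair of disjoint sets, not both empty, with $\mathrm{cut}(Even,Odd)\ge f(\sigma)\,\mathrm{inc}(Even,Odd)$; and its work-to-output ratio is $\tilde O(\alpha\Delta m^{1+\mu}+1/\alpha)$. Here $p$ depends only on $\epsilon,\mu,\eta,\delta$, and $K,C$ only on $\epsilon,\mu,\eta,\delta,\gamma,A,\kappa,c$. 2. For all $\delta,\kappa,c>0$ and $0<\gamma<1$, for every graph, regardless of the value of $\mathrm{maxcut}(G)$, and for every start vertex $i$, the worst-case running time of Find$(i)$ is $\tilde O(\alpha\Delta m^{2+\mu})$, where $K,C$ depend only on $\epsilon,\mu,\eta,\delta,\gamma,\kappa,c$. -/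

import Mathlib

noncomputable section

namespace FindCut

/-- A finite weighted graph on the vertices `0, …, n - 1`: symmetric edge weights, no self-loops,
weight `0` means "no edge", every edge has weight at least `1` (the normalization satisfied by
unweighted multigraphs, where the weight is the multiplicity), and no vertex is isolated. -/
structure WeightedGraph (n : ℕ) where
  w : Fin n → Fin n → ℝ
  symm : ∀ j k, w j k = w k j
  loopless : ∀ j, w j j = 0
  one_le_of_ne_zero : ∀ j k, w j k ≠ 0 → 1 ≤ w j k
  no_isolated : ∀ j, ∃ k, w j k ≠ 0

namespace WeightedGraph

variable {n : ℕ} (G : WeightedGraph n)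

/-- The weighted degree `d_j`. -/
def deg (j : Fin n) : ℝ := ∑ k, G.w j k

/-- The sum `m` of the weighted degrees. -/
def vol : ℝ := ∑ j, G.deg j

theorem w_nonneg (j k : Fin n) : 0 ≤ G.w j k := by
  by_cases h : G.w j k = 0
  · exact h.ge
  · exact zero_le_one.trans (G.one_le_of_ne_zero j k h)

theorem one_le_deg (j : Fin n) : 1 ≤ G.deg j := by
  obtain ⟨k, hk⟩ := G.no_isolated j
  exact (G.one_le_of_ne_zero j k hk).trans
    (Finset.single_le_sum (f := fun k => G.w j k) (fun k _ => G.w_nonneg j k) (Finset.mem_univ k))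

theorem deg_pos (j : Fin n) : 0 < G.deg j := zero_lt_one.trans_le (G.one_le_deg j)

theorem vol_pos (hn : 0 < n) : 0 < G.vol :=
  Finset.sum_pos (fun j _ => G.deg_pos j) ⟨⟨0, hn⟩, Finset.mem_univ _⟩

open Classical in
/-- The total weight of the (unordered) edges `{j, k}` satisfying the symmetric predicate `P`. -/
def edgeWeight (P : Fin n → Fin n → Prop) : ℝ :=
  (∑ j, ∑ k, if P j k then G.w j k else 0) / 2

/-- Total weight of the edges with one endpoint in `A` and the other in `B`. -/
def good (A B : Finset (Fin n)) : ℝ :=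
  G.edgeWeight fun j k => (j ∈ A ∧ k ∈ B) ∨ (j ∈ B ∧ k ∈ A)

/-- Total weight of the edges with exactly one endpoint in `A ∪ B`. -/
def cross (A B : Finset (Fin n)) : ℝ :=
  G.edgeWeight fun j k => Xor (j ∈ A ∪ B) (k ∈ A ∪ B)

/-- Total weight of the edges incident on `A ∪ B`. -/
def inc (A B : Finset (Fin n)) : ℝ :=
  G.edgeWeight fun j k => j ∈ A ∪ B ∨ k ∈ A ∪ B

def cut (A B : Finset (Fin n)) : ℝ := G.good A B + G.cross A B / 2

/-- The fraction of the total edge weight that is cut by the partition `(S, Sᶜ)`. -/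
def cutValue (S : Finset (Fin n)) : ℝ :=
  G.edgeWeight (fun j k => Xor (j ∈ S) (k ∈ S)) / G.edgeWeight (fun _ _ => True)

/-- The largest cut value (a maximum over finitely many sets). -/
def maxcut : ℝ := ⨆ S : Finset (Fin n), G.cutValue S

/-- Transition matrix of the lazy random walk: stay with probability `1/2`, otherwise move along
an incident edge chosen with probability proportional to its weight. -/
def lazyWalk : Matrix (Fin n) (Fin n) ℝ :=
  Matrix.of fun j k => (if j = k then 1 / 2 else 0) + G.w j k / (2 * G.deg j)

/-- The probability that the lazy random walk of length `l` from `i` ends at `j`. -/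
def walkProb (l : ℕ) (i j : Fin n) : ℝ := (G.lazyWalk ^ l) i j

/-- A random vertex, chosen with probability proportional to its degree. -/
def startVertex (hn : 0 < n) : PMF (Fin n) :=
  PMF.ofFintype (fun j => ENNReal.ofReal (G.deg j / G.vol)) (by
    rw [← ENNReal.ofReal_sum_of_nonneg
      (fun j _ => div_nonneg (G.deg_pos j).le (G.vol_pos hn).le), ← Finset.sum_div]
    change ENNReal.ofReal (G.vol / G.vol) = 1
    rw [div_self (G.vol_pos hn).ne', ENNReal.ofReal_one])

/-- A random neighbour of `j`, chosen with probability proportional to the weight of the edge. -/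
def randomNeighbor (j : Fin n) : PMF (Fin n) :=
  PMF.ofFintype (fun k => ENNReal.ofReal (G.w j k / G.deg j)) (by
    rw [← ENNReal.ofReal_sum_of_nonneg
      (fun k _ => div_nonneg (G.w_nonneg j k) (G.deg_pos j).le), ← Finset.sum_div]
    change ENNReal.ofReal (G.deg j / G.deg j) = 1
    rw [div_self (G.deg_pos j).ne', ENNReal.ofReal_one])

open Classical in
/-- The adjacency list of `j`. -/
def neighbors (j : Fin n) : List (Fin n) :=
  (List.finRange n).filter fun k => decide (G.w j k ≠ 0)

end WeightedGraph

/-! ### The function `f(σ)` -/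

def sotoLow (σ : ℝ) : ℝ := 1 / (1 + 2 * √(σ * (1 - σ)))

def sotoMid (σ : ℝ) : ℝ := (-1 + √(4 * σ ^ 2 - 8 * σ + 5)) / (2 * (1 - σ))

/-- The constant `σ₀ = 0.22815…`: the point of `[0, 1/3]` where the two branches agree
(there is exactly one). -/
def sigma0 : ℝ := sInf {σ : ℝ | 0 ≤ σ ∧ σ ≤ 1 / 3 ∧ sotoLow σ = sotoMid σ}

open Classical in
def soto (σ : ℝ) : ℝ :=
  if 1 / 3 < σ then 1 / 2 else if sigma0 < σ then sotoMid σ else sotoLow σ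

/-! ### Parameters -/

/-- The parameters of the search procedure. -/
structure Params where
  /-- the max-cut parameter -/
  ε : ℝ
  /-- the running time parameter -/
  μ : ℝ
  /-- the slack allowed in `σ` -/
  η : ℝ
  /-- the small constant in the walk length -/
  δ : ℝ
  /-- the ratio of successive thresholds is `1 - γ` -/
  γ : ℝ
  /-- the large constant in the number of walks -/
  κ : ℝ
  /-- the small constant in the size test -/
  c : ℝ
  /-- the bound on the degrees -/
  Δ : ℝ
  /-- the bound on `max_j (p_j / d_j)` -/
  α : ℝ

/-- `σ = 1 - (1 - ε)^(1 + 1/μ) + η`, where `η` is the small slack. -/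
def sigma (ε μ η : ℝ) : ℝ := 1 - (1 - ε) ^ (1 + 1 / μ) + η

/-- The walk length `ℓ = μ ln(4m/δ²) / (2 (δ + ε'))` with `ε' = - ln (1 - ε)`, rounded up. -/
def walkLength (ε μ δ m : ℝ) : ℕ :=
  ⌈μ * Real.log (4 * m / δ ^ 2) / (2 * (δ + -Real.log (1 - ε)))⌉₊

/-- The number of walks `w(t) = κ ln(n) max{α, t} / t²`, rounded up. -/
def numWalks (n : ℕ) (P : Params) (t : ℝ) : ℕ :=
  ⌈P.κ * Real.log n * max P.α t / t ^ 2⌉₊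

/-- The smallest `r` with `(1 - γ)^r < γ / m^(1 + μ/2)`: the procedure uses the thresholds
`(1 - γ)^r` for exactly the `r` below this number. -/
def numRounds (m : ℝ) (P : Params) : ℕ :=
  sInf {r : ℕ | (1 - P.γ) ^ r < P.γ / m ^ (1 + P.μ / 2)}

/-! ### Randomized programs with a step count

The cost model is a unit-cost random access machine which has the graph (adjacency lists, a table of
degrees, a sampler for a random incident edge) and the numbers `n`, `m`, `Δ`, `ln n`, `ℓ`, `f(σ)`
and the other parameters at its disposal. One step is paid for each random draw, memory access, set
operation (membership, insertion, cardinality of a set of vertices that is kept as an array),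
arithmetic operation, rounding and comparison. `tick k` pays `k` steps. -/

/-- The memory of the machine. -/
structure Memory (n : ℕ) where
  /-- the vertices classified as even -/
  even : Finset (Fin n)
  /-- the vertices classified as odd -/
  odd : Finset (Fin n)
  /-- number of even walks minus number of odd walks that ended at a vertex in this round -/
  count : Fin n → ℤ
  /-- the vertices at which a walk ended in this round -/
  touched : List (Fin n)
  /-- running value of `good(even, odd)` -/
  good : ℝ
  /-- running value of `cross(even, odd)` -/
  cross : ℝ
  /-- running value of `inc(even, odd)` -/
  inc : ℝ
  /-- the number of steps made so far -/
  steps : ℕ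

def Memory.init (n : ℕ) : Memory n where
  even := ∅
  odd := ∅
  count := fun _ => 0
  touched := []
  good := 0
  cross := 0
  inc := 0
  steps := 0

/-- Randomized programs acting on the memory. -/
abbrev Prog (n : ℕ) := StateT (Memory n) PMF

section Programs

variable {n : ℕ}

def tick (k : ℕ) : Prog n Unit := modify fun s => { s with steps := s.steps + k }

/-- A fair coin flip. -/
def coin : Prog n Bool := do
  tick 1
  StateT.lift (PMF.uniformOfFintype Bool)

/-- Follow a random incident edge. -/
def hop (G : WeightedGraph n) (v : Fin n) : Prog n (Fin n) := do
  tick 1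
  StateT.lift (G.randomNeighbor v)

/-- The lazy random walk of the given length. The Boolean says whether the number of hops so far is
even; the end point and this parity are returned. -/
def walk (G : WeightedGraph n) : ℕ → Fin n → Bool → Prog n (Fin n × Bool)
  | 0, v, b => pure (v, b)
  | l + 1, v, b => do
    tick 1
    let move ← coin
    if move then do
      let u ← hop G v
      tick 1
      walk G l u (!b)
    else
      walk G l v b

/-- Count a walk that ended at `v`. -/
def record (v : Fin n) (isEven : Bool) : Prog n Unit := do
  tick 4
  modify fun s =>
    { s with
      count := Function.update s.count v (if isEven then s.count v + 1 else s.count v - 1)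
      touched := v :: s.touched }

/-- Perform and count the given number of walks of length `l` from `i`. -/
def performWalks (G : WeightedGraph n) (i : Fin n) (l : ℕ) : ℕ → Prog n Unit
  | 0 => pure ()
  | k + 1 => do
    tick 1
    let e ← walk G l i true
    record e.1 e.2
    performWalks G i l k

/-- Update the running values for the edge `{v, u}` when `v` is about to be classified. -/
def updateEdge (G : WeightedGraph n) (toEven : Bool) (v u : Fin n) : Prog n Unit := do
  tick 8
  modify fun s =>
    if u ∈ (if toEven then s.odd else s.even) then
      { s with good := s.good + G.w v u, cross := s.cross - G.w v u }
    else if u ∈ (if toEven then s.even else s.odd) then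
      { s with cross := s.cross - G.w v u }
    else
      { s with cross := s.cross + G.w v u, inc := s.inc + G.w v u }

/-- Put the unclassified vertex `v` into the even set or into the odd set. -/
def classify (G : WeightedGraph n) (toEven : Bool) (v : Fin n) : Prog n Unit := do
  (G.neighbors v).forM (updateEdge G toEven v)
  tick 1
  modify fun s =>
    if toEven then { s with even := insert v s.even } else { s with odd := insert v s.odd }

open Classical in
/-- If `v` is not classified, compare its estimate `(#even - #odd) / (d_v w)` with `± t`. -/
def examine (G : WeightedGraph n) (w : ℕ) (t : ℝ) (v : Fin n) : Prog n Unit := do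
  tick 10
  let s ← get
  if v ∈ s.even ∨ v ∈ s.odd then
    pure ()
  else if t < (s.count v : ℝ) / (G.deg v * w) then
    classify G true v
  else if (s.count v : ℝ) / (G.deg v * w) < -t then
    classify G false v
  else
    pure ()

/-- Reset the counters of this round. -/
def clearCounts : Prog n Unit := do
  let s ← get
  s.touched.forM fun v => do
    tick 2
    modify fun s => { s with count := Function.update s.count v 0 }
  tick 1
  modify fun s => { s with touched := [] }

/-- The procedure Threshold. Only the vertices at which a walk ended have to be
examined: the estimate of every other vertex is `0`, so that it is not classified. -/
def threshold (G : WeightedGraph n) (P : Params) (i : Fin n) (t : ℝ) : Prog n Unit := do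
  tick 6
  performWalks G i (walkLength P.ε P.μ P.δ G.vol) (numWalks n P t)
  let s ← get
  s.touched.forM (examine G (numWalks n P t) t)
  clearCounts

/-- The test of the current even and odd sets after the round with threshold `t`. -/
def Accepts (G : WeightedGraph n) (P : Params) (t : ℝ) (s : Memory n) : Prop :=
  soto (sigma P.ε P.μ P.η) * s.inc ≤ s.good + s.cross / 2 ∧
    P.c / (P.Δ * t ^ 2 * G.vol ^ (1 + P.μ) * Real.log n) ≤ ((s.even.card + s.odd.card : ℕ) : ℝ)

open Classical in
/-- The remaining rounds, starting with threshold `t`; `none` stands for FAIL. -/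
def findLoop (G : WeightedGraph n) (P : Params) (i : Fin n) :
    ℕ → ℝ → Prog n (Option (Finset (Fin n) × Finset (Fin n)))
  | 0, _ => do
    tick 2
    pure none
  | k + 1, t => do
    tick 2
    threshold G P i t
    tick 16
    let s ← get
    if Accepts G P t s then do
      tick (s.even.card + s.odd.card)
      pure (some (s.even, s.odd))
    else do
      tick 2
      findLoop G P i k (t * (1 - P.γ))

/-- The procedure Find, started at the vertex `i`: the output (`none` for FAIL, otherwise the even
set and the odd set) together with the running time. -/
def find (G : WeightedGraph n) (P : Params) (i : Fin n) :
    PMF (Option (Finset (Fin n) × Finset (Fin n)) × ℕ) :=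
  ((findLoop G P i (numRounds G.vol P) 1).run (Memory.init n)).map
    fun x => (x.1, x.2.steps)

/-- The procedure Find, started at a random vertex `i`, with parameters `P i`: the vertex `i`
together with the result of Find. -/
def findFromRandomVertex (G : WeightedGraph n) (hn : 0 < n) (P : Fin n → Params) :
    PMF (Fin n × Option (Finset (Fin n) × Finset (Fin n)) × ℕ) :=
  (G.startVertex hn).bind fun i => (find G (P i) i).map fun o => (i, o)

end Programs

/-- `Δ` is an upper bound on the degrees. -/
def DegreeBound {n : ℕ} (G : WeightedGraph n) (Δ : ℝ) : Prop := ∀ j, G.deg j ≤ Δ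

/-- `α` is an upper bound on `max_j (p_j / d_j)`, where `p_j` is the probability that the lazy
walk of length `l` from `i` ends at `j`. -/
def ProbBound {n : ℕ} (G : WeightedGraph n) (l : ℕ) (i : Fin n) (α : ℝ) : Prop :=
  ∀ j, G.walkProb l i j / G.deg j ≤ α

end FindCut

end

/-! Let `M` be half the normalized Laplacian, a symmetric conjugate of the lazy walk in which every
hop carries a sign. Its eigenvalues lie in `[0, 1]`. For a start vertex `i` let `v j` be the
probability of an even walk to `j` minus that of an odd one, divided by `d_j`. Then `energy v =
(M^(2ℓ))_ii / d_i`, and the signless Dirichlet form of `v` is `2 (M^(2ℓ) - M^(2ℓ+1))_ii / d_i`, so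
the walk acts as a power method towards a cut.

A large cut gives a sign vector whose image has Rayleigh quotient at least `1 - ε` for `M`, hence a
noticeable projection onto the eigenvectors with eigenvalue at least `(1 - ε) e^(-δ)`. A
degree-random coordinate vector then inherits, with constant probability, a projection of squared
norm at least of order `d_i / m` (`mass_le_of_projection`). Jensen's inequality for the spectral
moments (`moment_rpow_le`) and the choice of `ℓ` turn this into a Dirichlet form at most `2 (σ -
η/2) energy v`, with `energy v` at least of order `m^(-(1+μ))`. This is `exists_good_starts`.

The thresholds round `v` to a vector `u` whose entries are, up to sign, essentially the threshold at
which the vertex is first classified. Weight round `r` by `t_r² - t_(r+1)²` and sum `cut - f inc`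
over the rounds. By a layer-cake computation each edge contributes a quadratic expression in its two
rounded values, and `f(σ)` makes this at least `C (2σ (x² + y²) - (x + y)²)` for some `C > 0`
(`exists_edgeBound_soto`). Summed over the edges, this is `C (2σ energy u - sumForm u)`, which is at
least a constant times `energy v`, because `u` is close to `v`. If no round passed the test, then
every round of good cut quality would have few vertices, hence small `inc`, and the weighted sum
would be too small (`exists_accepting_round`).

The sampled estimates are all within `γ t` of `v` by a Chernoff bound. The moment generating
function of one walk is computed exactly, and a union bound covers vertices, signs and rounds
(`expect_not_goodEstimates`, `expect_findLoop`). The rest of a round is deterministic and is handled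
by invariants that also carry the step count.

For the ratio, a classified vertex certifies `t ≤ 2 α`, so a round costs about `α / t²` up to
logarithms, while the size test gives an output of order at least `1 / (Δ t² m^(1+μ) ln n)`. The
worst case only needs the smallest threshold and `α m ≥ 1`. -/

noncomputable section

namespace FindCut

/-! ### The rounding function -/

/-- The cubic whose root in `[0, 1/3]` separates the two branches of `soto`. -/
def branchCubic (σ : ℝ) : ℝ := 1 - 6 * σ + 8 * σ ^ 2 - 4 * σ ^ 3

theorem branchCubic_lt {x y : ℝ} (h : x < y) : branchCubic y < branchCubic x := by
  have : branchCubic x - branchCubic y =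
      (y - x) * (6 - 8 * (x + y) + 4 * (x ^ 2 + x * y + y ^ 2)) := by
    unfold branchCubic; ring
  have h2 : 0 < 6 - 8 * (x + y) + 4 * (x ^ 2 + x * y + y ^ 2) := by
    nlinarith [sq_nonneg (x - y), sq_nonneg (x + y - 4 / 3)]
  have := mul_pos (sub_pos.2 h) h2
  linarith

/-- The radical is used only through this quadratic equation, in the comparison of the two branches
and in the edge inequality alike. -/
theorem sotoMid_root {σ : ℝ} (h1 : σ ≤ 1 / 3) :
    sotoMid σ ^ 2 * (1 - σ) + sotoMid σ = 1 - σ ∧ 0 < sotoMid σ := by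
  have hs : 0 < 1 - σ := by linarith
  have hr : 4 * σ ^ 2 - 8 * σ + 5 = 1 + 4 * (1 - σ) ^ 2 := by ring
  have hq : √(4 * σ ^ 2 - 8 * σ + 5) ^ 2 = 1 + 4 * (1 - σ) ^ 2 := by
    rw [hr]; exact Real.sq_sqrt (by positivity)
  have hq1 : 1 < √(4 * σ ^ 2 - 8 * σ + 5) := by
    rw [hr, Real.lt_sqrt zero_le_one]; nlinarith [sq_pos_of_pos hs]
  constructor
  · unfold sotoMid
    set r := √(4 * σ ^ 2 - 8 * σ + 5)
    field_simp
    linear_combination hq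
  · unfold sotoMid
    exact div_pos (by linarith) (by linarith)

/-- Inserting `sotoLow` into the quadratic equation of `sotoMid` leaves, up to a positive factor,
the square of `(1 - 2σ) √(1 - σ) - √σ`. That difference vanishes exactly when the squares of its two
terms agree, which is the cubic equation. -/
theorem sotoLow_eq_sotoMid_iff {σ : ℝ} (h0 : 0 ≤ σ) (h1 : σ ≤ 1 / 3) :
    sotoLow σ = sotoMid σ ↔ branchCubic σ = 0 := by
  obtain ⟨hm, hm0⟩ := sotoMid_root h1
  set s := √σ with hs
  set q := √(1 - σ) with hq
  have hs0 : 0 ≤ s := Real.sqrt_nonneg _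
  have hs2 : s ^ 2 = σ := Real.sq_sqrt h0
  have hq2 : q ^ 2 = 1 - σ := Real.sq_sqrt (by linarith)
  have hq0 : 0 < q := Real.sqrt_pos.2 (by linarith)
  have hg : √(σ * (1 - σ)) = s * q := Real.sqrt_mul h0 _
  have hsq : s ^ 2 + q ^ 2 = 1 := by linarith
  have hl : sotoLow σ * (1 + 2 * (s * q)) = 1 := by
    unfold sotoLow; rw [hg]; field_simp
  have hl0 : 0 < sotoLow σ := by unfold sotoLow; rw [hg]; positivity
  have key : (1 - σ) * (1 + 2 * (s * q)) ^ 2 - (1 - σ) - (1 + 2 * (s * q)) =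
      -((1 - 2 * s ^ 2) * q - s) ^ 2 := by
    have hσ : 1 - σ = q ^ 2 := hq2.symm
    have h2 : s ^ 2 = 1 - q ^ 2 := by linarith
    rw [hσ]
    have e1 : ((1 - 2 * s ^ 2) * q - s) ^ 2 =
      (1 - 2 * s ^ 2) ^ 2 * q ^ 2 - 2 * (1 - 2 * s ^ 2) * (s * q) + s ^ 2 := by ring
    have e2 : (1 + 2 * (s * q)) ^ 2 = 1 + 4 * (s * q) + 4 * s ^ 2 * q ^ 2 := by ring
    rw [e1, e2, h2]; ring
  have key2 : (1 - 2 * s ^ 2) * q - s = 0 ↔ branchCubic σ = 0 := by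
    have e : ((1 - 2 * s ^ 2) * q) ^ 2 - s ^ 2 = branchCubic σ := by
      rw [mul_pow, hq2, hs2]; unfold branchCubic; ring
    have h3 : 0 ≤ (1 - 2 * s ^ 2) * q := mul_nonneg (by rw [hs2]; linarith) hq0.le
    rw [← e, sub_eq_zero, sub_eq_zero]
    constructor
    · intro h; rw [h]
    · intro h; exact (sq_eq_sq₀ h3 hs0).1 h
  have key3 : (sotoLow σ ^ 2 * (1 - σ) + sotoLow σ - (1 - σ)) * (1 + 2 * (s * q)) ^ 2 =
      ((1 - 2 * s ^ 2) * q - s) ^ 2 := by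
    have : (sotoLow σ ^ 2 * (1 - σ) + sotoLow σ - (1 - σ)) * (1 + 2 * (s * q)) ^ 2 =
        (sotoLow σ * (1 + 2 * (s * q))) ^ 2 * (1 - σ) +
          (sotoLow σ * (1 + 2 * (s * q))) * (1 + 2 * (s * q)) -
          (1 - σ) * (1 + 2 * (s * q)) ^ 2 := by ring
    rw [this, hl]; linarith
  rw [← key2]
  have hpos : 0 < (1 + 2 * (s * q)) ^ 2 := by positivity
  constructor
  · intro h
    rw [h, hm, sub_self, zero_mul] at key3
    exact pow_eq_zero_iff (two_ne_zero) |>.1 key3.symm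
  · intro h
    rw [h, zero_pow two_ne_zero] at key3
    have h4 : sotoLow σ ^ 2 * (1 - σ) + sotoLow σ - (1 - σ) = 0 :=
      (mul_eq_zero.1 key3).resolve_right hpos.ne'
    have h5 : (sotoLow σ - sotoMid σ) * ((sotoLow σ + sotoMid σ) * (1 - σ) + 1) = 0 := by
      linear_combination h4 - hm
    rcases mul_eq_zero.1 h5 with h6 | h6
    · linarith
    · have : 0 < (sotoLow σ + sotoMid σ) * (1 - σ) + 1 := by
        have : 0 < 1 - σ := by linarith
        positivity
      linarith

/-- The cubic is strictly decreasing and changes sign on `[0, 1/3]`, so the set in the definition of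
`sigma0` is a singleton and its infimum is the root. -/
theorem branchCubic_sigma0 : branchCubic sigma0 = 0 := by
  have hc : ContinuousOn branchCubic (Set.Icc 0 (1 / 3)) := by
    unfold branchCubic; fun_prop
  have h := intermediate_value_Icc' (by norm_num : (0 : ℝ) ≤ 1 / 3) hc
  obtain ⟨ρ, ⟨h0, h1⟩, hρ⟩ : (0 : ℝ) ∈ branchCubic '' Set.Icc 0 (1 / 3) :=
    h ⟨by unfold branchCubic; norm_num, by unfold branchCubic; norm_num⟩
  have : {σ : ℝ | 0 ≤ σ ∧ σ ≤ 1 / 3 ∧ sotoLow σ = sotoMid σ} = {ρ} := by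
    ext x
    simp only [Set.mem_ofPred_eq, Set.mem_singleton_iff]
    constructor
    · rintro ⟨a, b, e⟩
      rw [sotoLow_eq_sotoMid_iff a b] at e
      rcases lt_trichotomy x ρ with h | h | h
      · have := branchCubic_lt h; linarith
      · exact h
      · have := branchCubic_lt h; linarith
    · rintro rfl
      exact ⟨h0, h1, (sotoLow_eq_sotoMid_iff h0 h1).2 hρ⟩
  rw [sigma0, this, csInf_singleton, hρ]

/-- The inequality for one edge whose end points have the values `x` and `y`, `|y| ≤ |x|`. -/
def EdgeBound (f σ C x y : ℝ) : Prop :=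
  (x * y ≤ 0 → C * (2 * σ * (x ^ 2 + y ^ 2) - (x + y) ^ 2) ≤
      (x ^ 2 - y ^ 2) / 2 - f * x ^ 2 + y ^ 2) ∧
    (0 ≤ x * y → C * (2 * σ * (x ^ 2 + y ^ 2) - (x + y) ^ 2) ≤ (x ^ 2 - y ^ 2) / 2 - f * x ^ 2)

/-- With `a = C (1 - 2σ)`, the case of opposite signs asks for a quadratic form in `(x, y)` to be
nonnegative; `h1` is its discriminant condition. For equal signs `x y ≥ y²`, so `x = y` is the
critical case and gives `h2`. -/
theorem edgeBound_of {f σ C : ℝ} (hC : 0 < C) (hσ : σ ≤ 1 / 3)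
    (h1 : C ^ 2 ≤ (1 / 2 + C * (1 - 2 * σ)) * (1 / 2 - f + C * (1 - 2 * σ)))
    (h2 : f ≤ 4 * C * (1 - σ)) {x y : ℝ} (hxy : y ^ 2 ≤ x ^ 2) : EdgeBound f σ C x y := by
  set a := C * (1 - 2 * σ) with ha
  have ha0 : 0 < a := mul_pos hC (by linarith)
  have hb : 0 ≤ 1 / 2 - f + a := by
    by_contra! h
    nlinarith [sq_pos_of_pos hC]
  constructor
  · intro h
    have e : (x ^ 2 - y ^ 2) / 2 - f * x ^ 2 + y ^ 2 -
        C * (2 * σ * (x ^ 2 + y ^ 2) - (x + y) ^ 2) =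
        (1 / 2 - f + a) * x ^ 2 + 2 * C * (x * y) + (1 / 2 + a) * y ^ 2 := by
      rw [ha]; ring
    have h3 : 0 ≤ (1 / 2 + a) *
        ((1 / 2 - f + a) * x ^ 2 + 2 * C * (x * y) + (1 / 2 + a) * y ^ 2) := by
      nlinarith [sq_nonneg ((1 / 2 + a) * y + C * x), sq_nonneg x]
    have h4 := (mul_nonneg_iff_of_pos_left (by linarith : 0 < 1 / 2 + a)).1 h3
    linarith
  · intro h
    have e : (x ^ 2 - y ^ 2) / 2 - f * x ^ 2 -
        C * (2 * σ * (x ^ 2 + y ^ 2) - (x + y) ^ 2) =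
        (1 / 2 - f + a) * (x ^ 2 - y ^ 2) + 2 * C * (x * y - y ^ 2) +
          (2 * a + 2 * C - f) * y ^ 2 := by
      rw [ha]; ring
    have h3 : 0 ≤ x * y - y ^ 2 := by
      have h5 : (y ^ 2) ^ 2 ≤ (x * y) ^ 2 := by
        rw [mul_pow, sq (y ^ 2)]
        exact mul_le_mul_of_nonneg_right hxy (sq_nonneg y)
      linarith [(sq_le_sq₀ (sq_nonneg y) h).1 h5]
    have h6 : 0 ≤ 2 * a + 2 * C - f := by rw [ha]; nlinarith
    have := mul_nonneg hb (sub_nonneg.2 hxy)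
    have := mul_nonneg hC.le h3
    have := mul_nonneg h6 (sq_nonneg y)
    nlinarith

/-- Here the discriminant condition of `edgeBound_of` holds with equality. The condition at `x = y`
reduces to `g ≤ (1 - 2σ)(1 - σ)`, which after squaring is nonnegativity of the cubic; this is why
the branch ends at `sigma0`. -/
theorem exists_edgeBound_sotoLow {σ : ℝ} (h0 : 0 < σ) (h1 : σ ≤ 1 / 3) (hb : 0 ≤ branchCubic σ) :
    ∃ C > 0, ∀ x y : ℝ, y ^ 2 ≤ x ^ 2 → EdgeBound (sotoLow σ) σ C x y := by
  set g := √(σ * (1 - σ)) with hg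
  have hs : 0 < 1 - σ := by linarith
  have hs2 : 0 < 1 - 2 * σ := by linarith
  have hg0 : 0 < g := Real.sqrt_pos.2 (mul_pos h0 hs)
  have hg2 : g ^ 2 = σ * (1 - σ) := Real.sq_sqrt (mul_pos h0 hs).le
  have h4 : (1 - 2 * g) * (1 + 2 * g) = (1 - 2 * σ) ^ 2 := by linear_combination -4 * hg2
  have h5 : 0 < 1 - 2 * g := by
    have : 0 < (1 - 2 * g) * (1 + 2 * g) := by rw [h4]; positivity
    exact pos_of_mul_pos_left this (by positivity)
  have hgle : g ≤ (1 - 2 * σ) * (1 - σ) := by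
    have h6 : g ^ 2 ≤ ((1 - 2 * σ) * (1 - σ)) ^ 2 := by
      have : ((1 - 2 * σ) * (1 - σ)) ^ 2 - g ^ 2 = (1 - σ) * branchCubic σ := by
        rw [hg2]; unfold branchCubic; ring
      nlinarith [mul_nonneg hs.le hb]
    exact (sq_le_sq₀ hg0.le (by positivity)).1 h6
  have hC : 0 < (1 - 2 * g) / (4 * g * (1 - 2 * σ)) := by positivity
  refine ⟨(1 - 2 * g) / (4 * g * (1 - 2 * σ)), hC, fun x y hxy => edgeBound_of hC h1 ?_ ?_ hxy⟩
  · have ea : (1 - 2 * g) / (4 * g * (1 - 2 * σ)) * (1 - 2 * σ) = (1 - 2 * g) / (4 * g) := by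
      field_simp
    have eC : ((1 - 2 * g) / (4 * g * (1 - 2 * σ))) ^ 2 =
        (1 - 2 * g) / ((4 * g) ^ 2 * (1 + 2 * g)) := by
      rw [div_pow, mul_pow, ← h4]; field_simp
    rw [ea, eC]
    apply le_of_eq
    unfold sotoLow
    rw [← hg]
    field_simp
    ring
  · have : 1 / (1 + 2 * g) ≤ (1 - 2 * g) * (1 - σ) / (g * (1 - 2 * σ)) := by
      rw [div_le_div_iff₀ (by positivity) (by positivity)]
      have : (1 - 2 * g) * (1 - σ) * (1 + 2 * g) = (1 - 2 * σ) ^ 2 * (1 - σ) := by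
        rw [← h4]; ring
      rw [this]
      nlinarith
    unfold sotoLow
    rw [← hg]
    refine this.trans (le_of_eq ?_)
    field_simp

/-- Here `C` makes the condition at `x = y` tight, and the discriminant condition becomes the
quadratic equation of `sotoMid`, again with equality. -/
theorem exists_edgeBound_sotoMid {σ : ℝ} (h1 : σ ≤ 1 / 3) (h0 : 0 < σ) :
    ∃ C > 0, ∀ x y : ℝ, y ^ 2 ≤ x ^ 2 → EdgeBound (sotoMid σ) σ C x y := by
  obtain ⟨hm, hm0⟩ := sotoMid_root h1
  set f := sotoMid σ
  have hs : 0 < 1 - σ := by linarith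
  have hC : 0 < f / (4 * (1 - σ)) := by positivity
  refine ⟨f / (4 * (1 - σ)), hC, fun x y hxy => edgeBound_of hC h1 (le_of_eq ?_) ?_ hxy⟩
  · field_simp
    linear_combination (16 * (1 - σ)) * hm
  · apply le_of_eq; field_simp

theorem soto_nonneg {σ : ℝ} (h1 : σ ≤ 1 / 3) : 0 ≤ soto σ := by
  unfold soto
  rw [if_neg (not_lt.2 h1)]
  split_ifs
  · exact (sotoMid_root h1).2.le
  · unfold sotoLow; positivity

theorem exists_edgeBound_soto {σ : ℝ} (h0 : 0 < σ) (h1 : σ ≤ 1 / 3) :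
    ∃ C > 0, ∀ x y : ℝ, y ^ 2 ≤ x ^ 2 → EdgeBound (soto σ) σ C x y := by
  unfold soto
  rw [if_neg (not_lt.2 h1)]
  split_ifs with h
  · exact exists_edgeBound_sotoMid h1 h0
  · refine exists_edgeBound_sotoLow h0 h1 ?_
    rw [← branchCubic_sigma0]
    rcases (not_lt.1 h).lt_or_eq with h | h
    · exact (branchCubic_lt h).le
    · rw [h]


/-! ### Spectral analysis of the signed lazy walk -/

open Matrix in
theorem exists_orthogonal_diagonalization {ι : Type*} [Fintype ι] [DecidableEq ι]
    {M : Matrix ι ι ℝ} (hM : M.IsHermitian) :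
    ∃ (U : Matrix ι ι ℝ) (lam : ι → ℝ), Uᵀ * U = 1 ∧ U * Uᵀ = 1 ∧
      M = U * diagonal lam * Uᵀ := by
  refine ⟨hM.eigenvectorUnitary, hM.eigenvalues, ?_, ?_, ?_⟩
  · have := Unitary.coe_star_mul_self hM.eigenvectorUnitary
    simpa [Matrix.star_eq_conjTranspose] using this
  · have := Unitary.coe_mul_star_self hM.eigenvectorUnitary
    simpa [Matrix.star_eq_conjTranspose] using this
  · have := hM.spectral_theorem
    rw [Unitary.conjStarAlgAut_apply] at this
    simpa [Matrix.star_eq_conjTranspose, Function.comp_def] using this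

open Matrix in
theorem orthogonal_conj_pow {ι : Type*} [Fintype ι] [DecidableEq ι]
    {U : Matrix ι ι ℝ} {lam : ι → ℝ} (h : Uᵀ * U = 1) (h' : U * Uᵀ = 1) (p : ℕ) :
    (U * diagonal lam * Uᵀ) ^ p = U * diagonal (fun k => lam k ^ p) * Uᵀ := by
  induction p with
  | zero => simp [h']
  | succ p ih =>
    rw [pow_succ, ih]
    calc U * diagonal (fun k => lam k ^ p) * Uᵀ * (U * diagonal lam * Uᵀ)
        = U * diagonal (fun k => lam k ^ p) * (Uᵀ * U) * diagonal lam * Uᵀ := by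
          simp only [Matrix.mul_assoc]
      _ = _ := by
          rw [h, Matrix.mul_one, Matrix.mul_assoc U, diagonal_mul_diagonal]
          simp only [pow_succ]

open Matrix in
theorem orthogonal_conj_diag {ι : Type*} [Fintype ι] [DecidableEq ι]
    (U : Matrix ι ι ℝ) (lam : ι → ℝ) (i : ι) :
    (U * diagonal lam * Uᵀ) i i = ∑ k, U i k ^ 2 * lam k := by
  rw [Matrix.mul_apply]
  refine Finset.sum_congr rfl fun k _ => ?_
  rw [Matrix.mul_diagonal, Matrix.transpose_apply]; ring

/-! ### Quadratic forms of the symmetrized signed walk. -/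

namespace WeightedGraph

variable {n : ℕ} (G : WeightedGraph n)

/-- One step of the lazy walk, with a sign for every hop. -/
def signedWalk : Matrix (Fin n) (Fin n) ℝ :=
  Matrix.of fun j k => (if j = k then 1 / 2 else 0) - G.w j k / (2 * G.deg j)

/-- The probability of an even walk from `i` to `j` minus that of an odd walk. -/
def signedProb (l : ℕ) (i j : Fin n) : ℝ := (G.signedWalk ^ l) i j

/-- Half the normalized Laplacian. -/
def halfLaplacian : Matrix (Fin n) (Fin n) ℝ :=
  Matrix.of fun j k => (if j = k then 1 / 2 else 0) - G.w j k / (2 * (√(G.deg j) * √(G.deg k)))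

/-- The degree-weighted sum of squares. -/
def energy (x : Fin n → ℝ) : ℝ := ∑ j, G.deg j * x j ^ 2

/-- The signless Dirichlet form. -/
def sumForm (x : Fin n → ℝ) : ℝ := (∑ j, ∑ k, G.w j k * (x j + x k) ^ 2) / 2

theorem sum_w_mul_sq (x : Fin n → ℝ) : ∑ j, ∑ k, G.w j k * x j ^ 2 = G.energy x := by
  simp only [energy, deg, Finset.sum_mul]

theorem sum_w_mul_sq' (x : Fin n → ℝ) : ∑ j, ∑ k, G.w j k * x k ^ 2 = G.energy x := by
  rw [Finset.sum_comm, ← sum_w_mul_sq]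
  exact Finset.sum_congr rfl fun j _ => Finset.sum_congr rfl fun k _ => by rw [G.symm]

theorem energy_nonneg (x : Fin n → ℝ) : 0 ≤ G.energy x :=
  Finset.sum_nonneg fun j _ => mul_nonneg (G.deg_pos j).le (sq_nonneg _)

theorem sumForm_nonneg (x : Fin n → ℝ) : 0 ≤ G.sumForm x :=
  div_nonneg (Finset.sum_nonneg fun j _ => Finset.sum_nonneg fun k _ =>
    mul_nonneg (G.w_nonneg j k) (sq_nonneg _)) zero_le_two

theorem sumForm_eq (x : Fin n → ℝ) :
    G.sumForm x = G.energy x + ∑ j, ∑ k, G.w j k * (x j * x k) := by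
  have : ∑ j, ∑ k, G.w j k * (x j + x k) ^ 2 =
      ∑ j, ∑ k, G.w j k * x j ^ 2 + ∑ j, ∑ k, G.w j k * x k ^ 2 +
        2 * ∑ j, ∑ k, G.w j k * (x j * x k) := by
    rw [Finset.mul_sum, ← Finset.sum_add_distrib, ← Finset.sum_add_distrib]
    refine Finset.sum_congr rfl fun j _ => ?_
    rw [Finset.mul_sum, ← Finset.sum_add_distrib, ← Finset.sum_add_distrib]
    exact Finset.sum_congr rfl fun k _ => by ring
  rw [sumForm, this, sum_w_mul_sq, sum_w_mul_sq']; ring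

theorem sum_w_mul_sub_sq (x : Fin n → ℝ) :
    (∑ j, ∑ k, G.w j k * (x j - x k) ^ 2) / 2 = 2 * G.energy x - G.sumForm x := by
  have : ∑ j, ∑ k, G.w j k * (x j - x k) ^ 2 =
      ∑ j, ∑ k, G.w j k * x j ^ 2 + ∑ j, ∑ k, G.w j k * x k ^ 2 -
        2 * ∑ j, ∑ k, G.w j k * (x j * x k) := by
    rw [Finset.mul_sum, ← Finset.sum_add_distrib, ← Finset.sum_sub_distrib]
    refine Finset.sum_congr rfl fun j _ => ?_
    rw [Finset.mul_sum, ← Finset.sum_add_distrib, ← Finset.sum_sub_distrib]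
    exact Finset.sum_congr rfl fun k _ => by ring
  rw [this, sumForm_eq, sum_w_mul_sq, sum_w_mul_sq']; ring

theorem sumForm_le (x : Fin n → ℝ) : G.sumForm x ≤ 2 * G.energy x := by
  have := G.sum_w_mul_sub_sq x
  have : 0 ≤ (∑ j, ∑ k, G.w j k * (x j - x k) ^ 2) / 2 :=
    div_nonneg (Finset.sum_nonneg fun j _ => Finset.sum_nonneg fun k _ =>
      mul_nonneg (G.w_nonneg j k) (sq_nonneg _)) zero_le_two
  linarith

theorem sqrt_deg_pos (j : Fin n) : 0 < √(G.deg j) := Real.sqrt_pos.2 (G.deg_pos j)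

theorem sq_sqrt_deg (j : Fin n) : √(G.deg j) ^ 2 = G.deg j := Real.sq_sqrt (G.deg_pos j).le

-- Translates between spectral statements about `halfLaplacian` and the edge sum `sumForm`; the
-- range of the eigenvalues and the effect of the maximum cut are both read off from it.
open Matrix in
theorem dotProduct_halfLaplacian (x : Fin n → ℝ) :
    2 * (x ⬝ᵥ x) - 2 * (x ⬝ᵥ G.halfLaplacian *ᵥ x) =
      G.sumForm fun j => x j / √(G.deg j) := by
  have he : G.energy (fun j => x j / √(G.deg j)) = x ⬝ᵥ x := by
    unfold energy
    refine Finset.sum_congr rfl fun j _ => ?_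
    rw [div_pow, G.sq_sqrt_deg, mul_div_cancel₀ _ (G.deg_pos j).ne', sq]
  have hl : x ⬝ᵥ G.halfLaplacian *ᵥ x =
      (x ⬝ᵥ x) / 2 - (∑ j, ∑ k, G.w j k * (x j / √(G.deg j) * (x k / √(G.deg k)))) / 2 := by
    rw [dotProduct, dotProduct, Finset.sum_div, Finset.sum_div, ← Finset.sum_sub_distrib]
    refine Finset.sum_congr rfl fun j _ => ?_
    rw [mulVec, dotProduct, Finset.mul_sum, Finset.sum_div]
    have : x j * x j / 2 = ∑ k, if j = k then x j * x k / 2 else 0 := by simp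
    rw [this, ← Finset.sum_sub_distrib]
    refine Finset.sum_congr rfl fun k _ => ?_
    have := (G.sqrt_deg_pos j).ne'
    have := (G.sqrt_deg_pos k).ne'
    simp only [halfLaplacian, Matrix.of_apply]
    split_ifs
    · field_simp
    · field_simp; ring
  rw [sumForm_eq, he, hl]; ring

theorem energy_div_sqrt_deg (x : Fin n → ℝ) :
    G.energy (fun j => x j / √(G.deg j)) = ∑ j, x j ^ 2 := by
  unfold energy
  refine Finset.sum_congr rfl fun j _ => ?_
  rw [div_pow, G.sq_sqrt_deg, mul_div_cancel₀ _ (G.deg_pos j).ne']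

theorem halfLaplacian_isHermitian : G.halfLaplacian.IsHermitian := by
  ext j k
  simp only [halfLaplacian, Matrix.conjTranspose_apply, Matrix.of_apply, star_trivial]
  rw [G.symm k j, mul_comm (√(G.deg k))]
  simp only [eq_comm]

/-- The signed walk matrix is conjugate to `halfLaplacian` by the diagonal matrix of the `√(deg j)`,
and conjugation commutes with powers. -/
theorem halfLaplacian_pow_apply (l : ℕ) (i j : Fin n) :
    (G.halfLaplacian ^ l) i j = √(G.deg i) * G.signedProb l i j / √(G.deg j) := by
  unfold signedProb
  induction l generalizing j with
  | zero =>
    have := (G.sqrt_deg_pos i).ne'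
    rcases eq_or_ne i j with rfl | h
    · simp [this]
    · simp [Matrix.one_apply_ne h]
  | succ l ih =>
    rw [pow_succ, pow_succ, Matrix.mul_apply, Matrix.mul_apply, Finset.mul_sum, Finset.sum_div]
    refine Finset.sum_congr rfl fun k _ => ?_
    rw [ih]
    have h1 := (G.sqrt_deg_pos j).ne'
    have h2 := (G.sqrt_deg_pos k).ne'
    have h3 := (G.sq_sqrt_deg k).symm
    have e1 : G.halfLaplacian k j =
        (if k = j then 1 / 2 else 0) - G.w k j / (2 * (√(G.deg k) * √(G.deg j))) := rfl
    have e2 : G.signedWalk k j = (if k = j then 1 / 2 else 0) - G.w k j / (2 * G.deg k) := rfl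
    rw [e1, e2]
    generalize (G.signedWalk ^ l) i k = s
    rcases eq_or_ne k j with rfl | h
    · rw [if_pos rfl]
      generalize √(G.deg k) = r at *
      rw [h3]; field_simp
    · rw [if_neg h]
      generalize √(G.deg k) = r at *
      rw [h3]; field_simp; ring

/-- The vector of signed probabilities, divided by the degrees. -/
def signedDensity (l : ℕ) (i j : Fin n) : ℝ := G.signedProb l i j / G.deg j

theorem signedDensity_eq (l : ℕ) (i : Fin n) :
    G.signedDensity l i =
      fun j => ((G.halfLaplacian ^ l) i j / √(G.deg i)) / √(G.deg j) := by
  ext j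
  rw [halfLaplacian_pow_apply, signedDensity]
  have h1 := (G.sqrt_deg_pos j).ne'
  have h2 := (G.sqrt_deg_pos i).ne'
  have h3 := (G.sq_sqrt_deg j).symm
  generalize √(G.deg j) = r at *
  rw [h3]; field_simp

-- The energy is a squared norm of row `i` of a symmetric power, hence a diagonal entry of the
-- doubled power.
open Matrix in
theorem energy_signedDensity (l : ℕ) (i : Fin n) :
    G.energy (G.signedDensity l i) = (G.halfLaplacian ^ (2 * l)) i i / G.deg i := by
  rw [signedDensity_eq, energy_div_sqrt_deg, two_mul, pow_add, Matrix.mul_apply, Finset.sum_div]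
  refine Finset.sum_congr rfl fun j _ => ?_
  have hs : (G.halfLaplacian ^ l) j i = (G.halfLaplacian ^ l) i j := by
    have := G.halfLaplacian_isHermitian.pow l
    simpa using congrFun₂ this i j
  rw [hs, div_pow, G.sq_sqrt_deg, sq]

-- Together with `energy_signedDensity`, this expresses the signless Rayleigh quotient of the walk
-- vector through the ratio of two consecutive spectral moments at `i`.
open Matrix in
theorem sumForm_signedDensity (l : ℕ) (i : Fin n) :
    G.sumForm (G.signedDensity l i) = 2 * G.energy (G.signedDensity l i) -
      2 * ((G.halfLaplacian ^ (2 * l + 1)) i i / G.deg i) := by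
  have hs : ∀ j, (G.halfLaplacian ^ l) j i = (G.halfLaplacian ^ l) i j := fun j => by
    have := G.halfLaplacian_isHermitian.pow l
    simpa using congrFun₂ this i j
  rw [signedDensity_eq, ← dotProduct_halfLaplacian, energy_div_sqrt_deg]
  congr 2
  · simp [dotProduct, sq]
  · have : 2 * l + 1 = l + (1 + l) := by ring
    rw [this, pow_add, pow_add, pow_one, Matrix.mul_apply, dotProduct, Finset.sum_div]
    refine Finset.sum_congr rfl fun j _ => ?_
    have hd : (fun j => (G.halfLaplacian ^ l) i j / √(G.deg i)) =
        (1 / √(G.deg i)) • fun j => (G.halfLaplacian ^ l) j i := by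
      ext j; simp [hs]; ring
    rw [hd, mulVec_smul]
    have : (G.halfLaplacian * G.halfLaplacian ^ l) j i =
      (G.halfLaplacian *ᵥ fun j => (G.halfLaplacian ^ l) j i) j := rfl
    rw [this]
    have h2 := (G.sqrt_deg_pos i).ne'
    have h3 := (G.sq_sqrt_deg i).symm
    simp only [Pi.smul_apply, smul_eq_mul, hs]
    generalize √(G.deg i) = r at *
    rw [h3]; field_simp

end WeightedGraph


/-! ### Spectral moments, projections and random start vertices. -/

/-- Jensen's inequality for consecutive moments of a probability vector. -/
theorem moment_rpow_le {ι : Type*} [Fintype ι] {a lam : ι → ℝ} (ha : ∀ k, 0 ≤ a k)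
    (hs : ∑ k, a k = 1) (hl : ∀ k, 0 ≤ lam k) {q : ℕ} (hq : 0 < q) :
    (∑ k, a k * lam k ^ q) * (∑ k, a k * lam k ^ q) ^ (1 / (q : ℝ)) ≤
      ∑ k, a k * lam k ^ (q + 1) := by
  have hq' : (0 : ℝ) < q := Nat.cast_pos.2 hq
  have h := Real.rpow_arith_mean_le_arith_mean_rpow Finset.univ a (fun k => lam k ^ q)
    (fun k _ => ha k) hs (fun k _ => pow_nonneg (hl k) q)
    (p := 1 + 1 / (q : ℝ)) (by have : 0 < 1 / (q : ℝ) := by positivity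
                               linarith)
  have h0 : 0 ≤ ∑ k, a k * lam k ^ q :=
    Finset.sum_nonneg fun k _ => mul_nonneg (ha k) (pow_nonneg (hl k) q)
  rw [Real.rpow_add_of_nonneg h0 zero_le_one (by positivity), Real.rpow_one] at h
  refine h.trans (le_of_eq (Finset.sum_congr rfl fun k _ => ?_))
  rw [← Real.rpow_natCast, ← Real.rpow_mul (hl k), mul_add, mul_one, mul_one_div,
    div_self hq'.ne', ← Real.rpow_natCast]
  push_cast; rfl

/-- A vector of squared norm `m = ∑ d i` has, if its projection onto the span of the columns of `U`
in `H` is large, large projections of many coordinate vectors. -/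
theorem mass_le_of_projection {ι : Type*} [Fintype ι] [DecidableEq ι] {U : Matrix ι ι ℝ}
    (hU : U.transpose * U = 1) (H : Finset ι) {d x : ι → ℝ} (hx : ∀ i, x i ^ 2 = d i) {m ρ : ℝ}
    (hm : 0 < m) (hd : ∑ i, d i = m) (hρ : 0 < ρ)
    (hτ : ρ * m ≤ ∑ k ∈ H, (∑ i, U i k * x i) ^ 2) :
    ρ * m / 4 ≤
      ∑ i with d i * ρ / (4 * m) ≤ ∑ k ∈ H, U i k ^ 2, d i := by
  classical
  set c : ι → ℝ := fun k => ∑ i, U i k * x i with hc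
  set τ := ∑ k ∈ H, c k ^ 2 with hτd
  set z : ι → ℝ := fun i => ∑ k ∈ H, U i k * c k with hz
  set h : ι → ℝ := fun i => ∑ k ∈ H, U i k ^ 2 with hh
  -- Here `z` is the projection of `x`, with `⟨x, z⟩ = |z|² = τ`. Indices outside `T` account for at
  -- most half of `⟨x, z⟩`; Cauchy-Schwarz on `T` then bounds its mass from below.
  set T : Finset ι := {i | d i * ρ / (4 * m) ≤ h i} with hT
  have hτ0 : 0 < τ := lt_of_lt_of_le (by positivity) hτ
  have hd0 : ∀ i, 0 ≤ d i := fun i => by rw [← hx]; positivity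
  have hz1 : ∀ i, z i ^ 2 ≤ h i * τ := fun i => Finset.sum_mul_sq_le_sq_mul_sq H _ _
  have hxz : ∑ i, x i * z i = τ := by
    simp only [hz, Finset.mul_sum]
    rw [Finset.sum_comm, hτd]
    refine Finset.sum_congr rfl fun k _ => ?_
    rw [sq]
    nth_rewrite 2 [hc]
    rw [Finset.sum_mul]
    exact Finset.sum_congr rfl fun i _ => by ring
  have hUU : ∀ k k', ∑ i, U i k * U i k' = if k = k' then 1 else 0 := fun k k' => by
    have := congrFun₂ hU k k'
    rw [Matrix.mul_apply, Matrix.one_apply] at this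
    simpa using this
  have hzz : ∑ i, z i ^ 2 = τ := by
    have : ∀ i, z i ^ 2 = ∑ k ∈ H, ∑ k' ∈ H, c k * c k' * (U i k * U i k') := fun i => by
      rw [sq, hz, Finset.sum_mul_sum]
      exact Finset.sum_congr rfl fun k _ => Finset.sum_congr rfl fun k' _ => by ring
    rw [Finset.sum_congr rfl fun i _ => this i, Finset.sum_comm, hτd]
    refine Finset.sum_congr rfl fun k hk => ?_
    rw [Finset.sum_comm]
    simp_rw [← Finset.mul_sum, hUU]
    rw [Finset.sum_eq_single k]
    · simp [sq]
    · intro b _ hb; simp [hb.symm]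
    · intro h; exact absurd hk h
  have hbad : ∀ i ∈ Finset.univ.filter (· ∉ T), x i * z i ≤ d i * (τ / (2 * m)) := by
    intro i hi
    have hi' : h i < d i * ρ / (4 * m) := by
      simpa [hT] using hi
    refine (le_abs_self _).trans (abs_le_of_sq_le_sq ?_ (mul_nonneg (hd0 i) (by positivity)))
    have h1 : (x i * z i) ^ 2 ≤ d i * (h i * τ) := by
      rw [mul_pow, hx]; exact mul_le_mul_of_nonneg_left (hz1 i) (hd0 i)
    have h2 : d i * (h i * τ) ≤ d i * (d i * ρ / (4 * m) * τ) :=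
      mul_le_mul_of_nonneg_left (mul_le_mul_of_nonneg_right hi'.le hτ0.le) (hd0 i)
    have h3 : d i * (d i * ρ / (4 * m) * τ) = d i ^ 2 * τ * (ρ * m) / (4 * m ^ 2) := by
      field_simp
    have h4 : d i ^ 2 * τ * (ρ * m) / (4 * m ^ 2) ≤ d i ^ 2 * τ * τ / (4 * m ^ 2) := by
      gcongr
    have h5 : d i ^ 2 * τ * τ / (4 * m ^ 2) = (d i * (τ / (2 * m))) ^ 2 := by
      field_simp; norm_num
    linarith
  have hsplit : ∑ i ∈ T, x i * z i + ∑ i ∈ Finset.univ.filter (· ∉ T), x i * z i = τ := by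
    rw [← hxz, ← Finset.sum_filter_add_sum_filter_not Finset.univ (· ∈ T)]
    simp
  have hbad' : ∑ i ∈ Finset.univ.filter (· ∉ T), x i * z i ≤ τ / 2 := by
    refine (Finset.sum_le_sum hbad).trans ?_
    rw [← Finset.sum_mul]
    have : ∑ i ∈ Finset.univ.filter (· ∉ T), d i ≤ m := by
      rw [← hd]
      exact Finset.sum_le_sum_of_subset_of_nonneg (Finset.filter_subset _ _) fun i _ _ => hd0 i
    calc _ ≤ m * (τ / (2 * m)) := mul_le_mul_of_nonneg_right this (by positivity)
      _ = τ / 2 := by field_simp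
  have hgood : τ / 2 ≤ ∑ i ∈ T, x i * z i := by linarith
  have hcs : (∑ i ∈ T, x i * z i) ^ 2 ≤ (∑ i ∈ T, d i) * τ := by
    refine (Finset.sum_mul_sq_le_sq_mul_sq T _ _).trans ?_
    simp only [hx]
    refine mul_le_mul_of_nonneg_left ?_ (Finset.sum_nonneg fun i _ => hd0 i)
    rw [← hzz]
    exact Finset.sum_le_sum_of_subset_of_nonneg (Finset.subset_univ _) fun i _ _ => sq_nonneg _
  have h6 : (τ / 2) ^ 2 ≤ (∑ i ∈ T, d i) * τ :=
    (pow_le_pow_left₀ (by positivity) hgood 2).trans hcs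
  have h7 : τ / 4 * τ ≤ (∑ i ∈ T, d i) * τ := by
    linarith [h6, show (τ / 2) ^ 2 = τ / 4 * τ by ring]
  have h8 := le_of_mul_le_mul_right h7 hτ0
  linarith

namespace WeightedGraph

variable {n : ℕ} (G : WeightedGraph n)

/-- For the `±1` indicator of an optimal cut, an edge contributes `0` to the signless form if it is
cut and `4` times its weight otherwise. -/
theorem exists_signs_of_maxcut {ε : ℝ} (hn : 0 < n) (h : 1 - ε ≤ G.maxcut) :
    ∃ y : Fin n → ℝ, (∀ j, y j ^ 2 = 1) ∧ G.sumForm y ≤ 2 * ε * G.vol := by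
  classical
  obtain ⟨S, hS⟩ := exists_eq_ciSup_of_finite (f := G.cutValue)
  have hS' : 1 - ε ≤ G.cutValue S := by rw [hS]; exact h
  have hv : G.edgeWeight (fun _ _ => True) = G.vol / 2 := by
    simp [edgeWeight, vol, deg]
  have hvp := G.vol_pos hn
  refine ⟨fun j => if j ∈ S then 1 else -1, fun j => by dsimp only; split_ifs <;> norm_num, ?_⟩
  have : G.sumForm (fun j => if j ∈ S then 1 else -1) =
      2 * G.vol - 4 * G.edgeWeight (fun j k => Xor (j ∈ S) (k ∈ S)) := by
    unfold sumForm edgeWeight vol deg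
    rw [Finset.mul_sum, show ∀ a : ℝ, 4 * (a / 2) = 2 * a from fun a => by ring, Finset.mul_sum,
      ← Finset.sum_sub_distrib, Finset.sum_div]
    refine Finset.sum_congr rfl fun j _ => ?_
    rw [Finset.mul_sum, Finset.mul_sum, ← Finset.sum_sub_distrib, Finset.sum_div]
    refine Finset.sum_congr rfl fun k _ => ?_
    by_cases hj : j ∈ S <;> by_cases hk : k ∈ S <;> simp [hj, hk, Xor] <;> ring
  rw [this]
  rw [cutValue, hv, le_div_iff₀ (by positivity)] at hS'
  nlinarith

-- Both bounds say that an edge sum of squares is nonnegative, of `(x j - x k)²` and of `(x j + x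
-- k)²` after rescaling. They place the spectrum in `[0, 1]`.
open Matrix in
theorem halfLaplacian_quadratic_bounds (x : Fin n → ℝ) :
    0 ≤ x ⬝ᵥ G.halfLaplacian *ᵥ x ∧ x ⬝ᵥ G.halfLaplacian *ᵥ x ≤ x ⬝ᵥ x := by
  have h := G.dotProduct_halfLaplacian x
  have h1 := G.sumForm_nonneg fun j => x j / √(G.deg j)
  have h2 := G.sumForm_le fun j => x j / √(G.deg j)
  rw [energy_div_sqrt_deg] at h2
  have h3 : ∑ j, x j ^ 2 = x ⬝ᵥ x := by simp [dotProduct, sq]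
  constructor <;> linarith

open Matrix in
set_option maxHeartbeats 1000000 in
/-- From a random start vertex the walk distribution has, with constant probability, large energy
and a small signless Rayleigh quotient. -/
theorem exists_good_starts {ε μ η δ : ℝ} (hn : 0 < n) (hε0 : 0 ≤ ε) (hε1 : ε < 1) (hμ : 0 < μ)
    (hδ : 0 < δ) (hδ1 : δ ≤ (1 - ε) / 2) (hδ2 : δ * (1 + 1 / μ) ≤ η / 2) (hvol : 1 ≤ G.vol)
    (hcut : 1 - ε ≤ G.maxcut) :
    ∃ T : Finset (Fin n), δ ^ 2 / 4 * G.vol ≤ ∑ i ∈ T, G.deg i ∧ ∀ i ∈ T,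
      (δ ^ 2 / 4) ^ (1 + μ) * Real.exp (-(2 * (δ + -Real.log (1 - ε)))) / G.vol ^ (1 + μ) ≤
          G.energy (G.signedDensity (walkLength ε μ δ G.vol) i) ∧
        G.sumForm (G.signedDensity (walkLength ε μ δ G.vol) i) ≤
          2 * (sigma ε μ η - η / 2) *
            G.energy (G.signedDensity (walkLength ε μ δ G.vol) i) := by
  classical
  set l := walkLength ε μ δ G.vol with hl
  set m := G.vol with hm
  set e := -Real.log (1 - ε) with he
  have hm0 : 0 < m := by linarith
  have he0 : 0 ≤ e := by
    rw [he, neg_nonneg]; exact Real.log_nonpos (by linarith) (by linarith)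
  have hde : 0 < δ + e := by linarith
  obtain ⟨U, lam, hU, hU', hM⟩ := exists_orthogonal_diagonalization G.halfLaplacian_isHermitian
  have hM' : ∀ x : Fin n → ℝ, x ⬝ᵥ G.halfLaplacian *ᵥ x =
      ∑ k, lam k * (∑ i, U i k * x i) ^ 2 := fun x => by
    have h1 : G.halfLaplacian *ᵥ x = U *ᵥ (diagonal lam *ᵥ (Uᵀ *ᵥ x)) := by
      rw [hM]; simp only [mulVec_mulVec, Matrix.mul_assoc]
    rw [h1, dotProduct_mulVec, ← mulVec_transpose, dotProduct]
    refine Finset.sum_congr rfl fun k _ => ?_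
    rw [mulVec_diagonal]
    simp only [mulVec, dotProduct, transpose_apply]; ring
  have hI' : ∀ x : Fin n → ℝ, x ⬝ᵥ x = ∑ k, (∑ i, U i k * x i) ^ 2 := fun x => by
    have h1 : x = U *ᵥ (Uᵀ *ᵥ x) := by rw [mulVec_mulVec, hU', one_mulVec]
    nth_rewrite 2 [h1]
    rw [dotProduct_mulVec, ← mulVec_transpose, dotProduct]
    refine Finset.sum_congr rfl fun k _ => ?_
    simp only [mulVec, dotProduct, transpose_apply]; ring
  have hUU : ∀ k k', ∑ i, U i k * U i k' = if k = k' then 1 else 0 := fun k k' => by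
    have := congrFun₂ hU k k'
    rw [Matrix.mul_apply, Matrix.one_apply] at this
    simpa using this
  have hUr : ∀ i, ∑ k, U i k ^ 2 = 1 := fun i => by
    have := congrFun₂ hU' i i
    rw [Matrix.mul_apply, Matrix.one_apply, if_pos rfl] at this
    simpa [sq] using this
  have hlam : ∀ k, 0 ≤ lam k ∧ lam k ≤ 1 := fun k => by
    have h1 := G.halfLaplacian_quadratic_bounds fun i => U i k
    rw [hM', hI'] at h1
    simp only [hUU] at h1
    simpa using h1
  obtain ⟨y, hy, hys⟩ := G.exists_signs_of_maxcut hn hcut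
  set x : Fin n → ℝ := fun j => √(G.deg j) * y j with hx
  have hx2 : ∀ j, x j ^ 2 = G.deg j := fun j => by rw [hx, mul_pow, hy, G.sq_sqrt_deg, mul_one]
  have hxx : x ⬝ᵥ x = m := by
    rw [hm, vol]; simp only [dotProduct, ← sq, hx2]
  have hq : (1 - ε) * m ≤ x ⬝ᵥ G.halfLaplacian *ᵥ x := by
    have h := G.dotProduct_halfLaplacian x
    have : (fun j => x j / √(G.deg j)) = y := by
      ext j; rw [hx]; exact mul_div_cancel_left₀ _ (G.sqrt_deg_pos j).ne'
    rw [this, hxx] at h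
    linarith
  set lam0 := Real.exp (-(δ + e)) with hlam0
  have hlam0p : 0 < lam0 := Real.exp_pos _
  have hlam0' : lam0 = (1 - ε) * Real.exp (-δ) := by
    rw [hlam0, neg_add, Real.exp_add, he, neg_neg, Real.exp_log (by linarith), mul_comm]
  set H : Finset (Fin n) := {k | lam0 ≤ lam k} with hH
  set c : Fin n → ℝ := fun k => ∑ i, U i k * x i with hc
  -- Bounding eigenvalues in `H` by `1` and the others by `lam0` gives a projection of at least `(1
  -- - ε - lam0) m`, and `1 - ε - lam0 = (1 - ε)(1 - e^(-δ)) ≥ (1 - ε) δ / 2 ≥ δ²`.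
  have hτ : δ ^ 2 * m ≤ ∑ k ∈ H, c k ^ 2 := by
    rw [hM'] at hq
    rw [hI'] at hxx
    have h1 : ∀ k, lam k * c k ^ 2 ≤ (if lam0 ≤ lam k then c k ^ 2 else 0) * (1 - lam0) +
        lam0 * c k ^ 2 := fun k => by
      split_ifs with h
      · nlinarith [sq_nonneg (c k), (hlam k).2]
      · nlinarith [sq_nonneg (c k), not_le.1 h]
    have h2 := Finset.sum_le_sum fun k (_ : k ∈ Finset.univ) => h1 k
    rw [Finset.sum_add_distrib, ← Finset.sum_mul, ← Finset.mul_sum, ← Finset.sum_filter] at h2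
    change _ ≤ (∑ k ∈ H, c k ^ 2) * (1 - lam0) + lam0 * ∑ k, (∑ i, U i k * x i) ^ 2 at h2
    rw [hxx] at h2
    have h3 : 0 ≤ ∑ k ∈ H, c k ^ 2 := Finset.sum_nonneg fun k _ => sq_nonneg _
    have h4 : δ / 2 ≤ 1 - Real.exp (-δ) := by
      have h5 : Real.exp (-δ) ≤ 1 / (1 + δ) := by
        rw [Real.exp_neg, ← one_div]
        exact one_div_le_one_div_of_le (by linarith) (by linarith [Real.add_one_le_exp δ])
      have h6 : 1 / (1 + δ) ≤ 1 - δ / 2 := by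
        rw [div_le_iff₀ (by linarith)]; nlinarith
      linarith
    have h5 : δ ^ 2 ≤ (1 - ε) - lam0 := by
      rw [hlam0']
      nlinarith
    have h6 : ((1 - ε) - lam0) * m ≤ ∑ k ∈ H, c k ^ 2 := by nlinarith
    nlinarith
  have hmass := mass_le_of_projection hU H hx2 hm0 rfl (by positivity : 0 < δ ^ 2) hτ
  refine ⟨_, (le_of_eq (by ring)).trans hmass, fun i hi => ?_⟩
  have hi' : G.deg i * δ ^ 2 / (4 * m) ≤ ∑ k ∈ H, U i k ^ 2 := by simpa using hi
  have hdi := G.deg_pos i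
  set X := 4 * m / δ ^ 2 with hX
  have hX0 : 0 < X := by positivity
  have hX1 : 1 < X := by
    rw [hX, one_lt_div (by positivity)]; nlinarith
  have hlogX : 0 < Real.log X := Real.log_pos hX1
  have hl1 : μ * Real.log X / (2 * (δ + e)) ≤ l := Nat.le_ceil _
  have hl2 : (l : ℝ) < μ * Real.log X / (2 * (δ + e)) + 1 :=
    Nat.ceil_lt_add_one (by positivity)
  have hl0 : (0 : ℝ) < l := lt_of_lt_of_le (by positivity) hl1
  have hl0' : 0 < l := Nat.cast_pos.1 hl0
  have hpow : ∀ p, (G.halfLaplacian ^ p) i i = ∑ k, U i k ^ 2 * lam k ^ p := fun p => by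
    rw [hM, orthogonal_conj_pow hU hU', orthogonal_conj_diag]
  set P := ∑ k, U i k ^ 2 * lam k ^ (2 * l) with hP
  have hPlow : lam0 ^ (2 * l) * (G.deg i / X) ≤ P := by
    have h1 : lam0 ^ (2 * l) * (∑ k ∈ H, U i k ^ 2) ≤ P := by
      rw [Finset.mul_sum]
      refine le_trans (Finset.sum_le_sum fun k hk => ?_)
        (Finset.sum_le_sum_of_subset_of_nonneg (Finset.subset_univ H) fun k _ _ =>
          mul_nonneg (sq_nonneg _) (pow_nonneg (hlam k).1 _))
      rw [mul_comm]
      have hk' : lam0 ≤ lam k := by simpa [hH] using hk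
      exact mul_le_mul_of_nonneg_left (pow_le_pow_left₀ hlam0p.le hk' _) (sq_nonneg _)
    refine le_trans ?_ h1
    refine mul_le_mul_of_nonneg_left (le_trans (le_of_eq ?_) hi') (by positivity)
    rw [hX]; field_simp
  have hen : G.energy (G.signedDensity l i) = P / G.deg i := by
    rw [energy_signedDensity, hpow]
  have hlampow : lam0 ^ (2 * l) = Real.exp (-(2 * l * (δ + e))) := by
    rw [hlam0, ← Real.exp_nat_mul]; push_cast; ring_nf
  have hXinv : 1 / X = Real.exp (-Real.log X) := by
    rw [Real.exp_neg, Real.exp_log hX0, one_div]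
  have hP0 : 0 < P := lt_of_lt_of_le (by positivity) hPlow
  constructor
  · rw [hen, le_div_iff₀ hdi]
    refine le_trans ?_ hPlow
    have h1 : (δ ^ 2 / 4) ^ (1 + μ) / m ^ (1 + μ) = Real.exp (-((1 + μ) * Real.log X)) := by
      rw [← Real.div_rpow (by positivity) hm0.le, Real.rpow_def_of_pos (by positivity)]
      have : δ ^ 2 / 4 / m = X⁻¹ := by rw [hX]; field_simp
      rw [this, Real.log_inv]; ring_nf
    rw [mul_div_right_comm, h1, ← Real.exp_add, div_eq_mul_one_div (G.deg i), hXinv, hlampow,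
      mul_left_comm, ← Real.exp_add, mul_comm]
    refine mul_le_mul_of_nonneg_left (Real.exp_le_exp.2 ?_) hdi.le
    -- Rounding the walk length up costs at most the factor `e^(-2(δ + e))` that appears in the
    -- energy bound.
    have h2 : l * (2 * (δ + e)) ≤ μ * Real.log X + 2 * (δ + e) := by
      have := mul_le_mul_of_nonneg_right hl2.le (by positivity : 0 ≤ 2 * (δ + e))
      rwa [add_mul, div_mul_cancel₀ _ (by positivity), one_mul] at this
    linarith
  · rw [sumForm_signedDensity, hen, hpow]
    have hJ := moment_rpow_le (a := fun k => U i k ^ 2) (fun k => sq_nonneg _) (hUr i)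
      (fun k => (hlam k).1) (q := 2 * l) (by omega)
    change P * P ^ _ ≤ _ at hJ
    -- The moment `P` is at least `lam0^(2l) / X`. Its `2l`-th root loses the factor `X^(1/(2l))`,
    -- which is at most `e^((δ + e)/μ)` by the choice of `l`; hence the exponent `1 + 1/μ` in
    -- `sigma`.
    have hroot : Real.exp (-((δ + e) * (1 + 1 / μ))) ≤ P ^ (1 / ((2 * l : ℕ) : ℝ)) := by
      have h1 : Real.exp (-(2 * l * (δ + e)) + -Real.log X) ≤ P := by
        rw [Real.exp_add, ← hlampow, ← hXinv]
        refine le_trans ?_ hPlow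
        exact mul_le_mul_of_nonneg_left
          (div_le_div_of_nonneg_right (G.one_le_deg i) hX0.le) (by positivity)
      refine le_trans ?_ (Real.rpow_le_rpow (Real.exp_pos _).le h1 (by positivity))
      rw [← Real.exp_mul]
      refine Real.exp_le_exp.2 ?_
      push_cast
      have h2 : Real.log X / (2 * l) ≤ (δ + e) / μ := by
        rw [div_le_div_iff₀ (by positivity) hμ]
        have := mul_le_mul_of_nonneg_right hl1 (by positivity : 0 ≤ 2 * (δ + e))
        rw [div_mul_cancel₀ _ (by positivity)] at this
        linarith
      have h3 : (-(2 * l * (δ + e)) + -Real.log X) * (1 / (2 * l)) =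
          -(δ + e) - Real.log X / (2 * l) := by field_simp; ring
      rw [h3]
      have : (δ + e) * (1 + 1 / μ) = (δ + e) + (δ + e) / μ := by ring
      linarith
    -- The factor `e^(-δ (1 + 1/μ))` is absorbed by half of the slack `η`; the other half is kept
    -- for the rounding error.
    have hσ : 1 - (sigma ε μ η - η / 2) ≤ Real.exp (-((δ + e) * (1 + 1 / μ))) := by
      have h1 : (1 - ε) ^ (1 + 1 / μ) = Real.exp (-(e * (1 + 1 / μ))) := by
        rw [Real.rpow_def_of_pos (by linarith), he]; ring_nf
      have h2 : Real.exp (-((δ + e) * (1 + 1 / μ))) =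
          Real.exp (-(e * (1 + 1 / μ))) * Real.exp (-(δ * (1 + 1 / μ))) := by
        rw [← Real.exp_add]; ring_nf
      have h3 : 1 - δ * (1 + 1 / μ) ≤ Real.exp (-(δ * (1 + 1 / μ))) := by
        linarith [Real.add_one_le_exp (-(δ * (1 + 1 / μ)))]
      have h4 : Real.exp (-(e * (1 + 1 / μ))) ≤ 1 := by
        rw [Real.exp_le_one_iff]; rw [neg_nonpos]; positivity
      have h5 := Real.exp_pos (-(e * (1 + 1 / μ)))
      have h6 : 0 < δ * (1 + 1 / μ) := by positivity
      have h7 := mul_le_mul_of_nonneg_left h3 h5.le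
      have h8 := mul_le_mul_of_nonneg_right h4 h6.le
      rw [sigma, h1, h2]
      linarith
    have h2 : (1 - (sigma ε μ η - η / 2)) * P ≤ ∑ k, U i k ^ 2 * lam k ^ (2 * l + 1) := by
      refine le_trans ?_ hJ
      rw [mul_comm P]
      exact mul_le_mul_of_nonneg_right (hσ.trans hroot) hP0.le
    have h3 := div_le_div_of_nonneg_right h2 hdi.le
    rw [mul_div_assoc] at h3
    linarith

end WeightedGraph

/-! ### Rounding along the thresholds -/

/-- The effect of one round with threshold `t`, when every estimate is within `γ t` of the true
value `v`. -/
structure RoundStep {n : ℕ} (v : Fin n → ℝ) (γ t : ℝ) (E O E' O' : Finset (Fin n)) : Prop where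
  even_subset : E ⊆ E'
  odd_subset : O ⊆ O'
  disjoint : Disjoint E' O'
  even_le : ∀ j ∈ E', j ∉ E → (1 - γ) * t ≤ v j
  odd_le : ∀ j ∈ O', j ∉ O → (1 - γ) * t ≤ -v j
  abs_le : ∀ j, j ∉ E' → j ∉ O' → |v j| ≤ (1 + γ) * t

/-- A run of rounds with thresholds `(1 - γ) ^ r`. -/
structure Rounds {n : ℕ} (v : Fin n → ℝ) (γ : ℝ) (R : ℕ) (E O : ℕ → Finset (Fin n)) : Prop where
  even_zero : E 0 = ∅
  odd_zero : O 0 = ∅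
  step : ∀ r < R, RoundStep v γ ((1 - γ) ^ r) (E r) (O r) (E (r + 1)) (O (r + 1))

theorem sum_range_ite_le_telescope (T : ℕ → ℝ) {ρ R : ℕ} (h : ρ ≤ R) :
    ∑ r ∈ Finset.range R, (T r - T (r + 1)) * (if ρ ≤ r then 1 else 0) = T ρ - T R := by
  induction R, h using Nat.le_induction with
  | base =>
    rw [sub_self]
    refine Finset.sum_eq_zero fun r hr => ?_
    rw [if_neg (not_le.2 (Finset.mem_range.1 hr)), mul_zero]
  | succ R h ih => rw [Finset.sum_range_succ, ih, if_pos h]; ring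

namespace Rounds

variable {n : ℕ} {v : Fin n → ℝ} {γ : ℝ} {R : ℕ} {E O : ℕ → Finset (Fin n)}

theorem even_mono (h : Rounds v γ R E O) {a b : ℕ} (hab : a ≤ b) (hb : b ≤ R) : E a ⊆ E b := by
  induction b, hab using Nat.le_induction with
  | base => exact subset_rfl
  | succ b _ ih => exact (ih (by omega)).trans (h.step b (by omega)).even_subset

theorem odd_mono (h : Rounds v γ R E O) {a b : ℕ} (hab : a ≤ b) (hb : b ≤ R) : O a ⊆ O b := by
  induction b, hab using Nat.le_induction with
  | base => exact subset_rfl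
  | succ b _ ih => exact (ih (by omega)).trans (h.step b (by omega)).odd_subset

theorem union_mono (h : Rounds v γ R E O) {a b : ℕ} (hab : a ≤ b) (hb : b ≤ R) :
    E a ∪ O a ⊆ E b ∪ O b :=
  Finset.union_subset_union (h.even_mono hab hb) (h.odd_mono hab hb)

theorem disjoint (h : Rounds v γ R E O) {a : ℕ} (ha : a ≤ R) : Disjoint (E a) (O a) := by
  rcases a with _ | a
  · simp [h.even_zero]
  · exact (h.step a ha).disjoint

open Classical in
/-- The square of the rounded value of `j`. -/
def weight (γ : ℝ) (R : ℕ) (E O : ℕ → Finset (Fin n)) (j : Fin n) : ℝ :=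
  ∑ r ∈ Finset.range R, (((1 - γ) ^ r) ^ 2 - ((1 - γ) ^ (r + 1)) ^ 2) *
    (if j ∈ E (r + 1) ∪ O (r + 1) then 1 else 0)

open Classical in
/-- The value of `j` rounded to a threshold. -/
def rounded (γ : ℝ) (R : ℕ) (E O : ℕ → Finset (Fin n)) (j : Fin n) : ℝ :=
  if j ∈ E R then √(weight γ R E O j) else if j ∈ O R then -√(weight γ R E O j) else 0

theorem gap_nonneg (hγ : 0 < γ) (hγ1 : γ < 1) (r : ℕ) :
    0 ≤ ((1 - γ) ^ r) ^ 2 - ((1 - γ) ^ (r + 1)) ^ 2 := by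
  have h1 : 0 < (1 - γ) ^ r := pow_pos (by linarith) r
  have h2 : (1 - γ) ^ (r + 1) ≤ (1 - γ) ^ r := by rw [pow_succ]; nlinarith
  have h3 : 0 < (1 - γ) ^ (r + 1) := pow_pos (by linarith) _
  nlinarith

theorem weight_nonneg (hγ : 0 < γ) (hγ1 : γ < 1) (j : Fin n) : 0 ≤ weight γ R E O j :=
  Finset.sum_nonneg fun r _ => mul_nonneg (gap_nonneg hγ hγ1 r) (by split_ifs <;> norm_num)

theorem rounded_sq (h : Rounds v γ R E O) (hγ : 0 < γ) (hγ1 : γ < 1) (j : Fin n) :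
    rounded γ R E O j ^ 2 = weight γ R E O j := by
  unfold rounded
  have h0 := weight_nonneg (E := E) (O := O) (R := R) hγ hγ1 j
  split_ifs with h1 h2
  · exact Real.sq_sqrt h0
  · rw [neg_sq]; exact Real.sq_sqrt h0
  · rw [zero_pow two_ne_zero, weight]
    refine (Finset.sum_eq_zero fun r hr => ?_).symm
    have := h.union_mono (a := r + 1) (b := R) (by simpa using hr) le_rfl
    rw [if_neg, mul_zero]
    intro hj
    rcases Finset.mem_union.1 (this hj) with h3 | h3
    · exact h1 h3
    · exact h2 h3

/-- Membership persists after the first classification, so the weight telescopes from the round of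
entry to the last threshold. -/
theorem exists_entry (h : Rounds v γ R E O) {j : Fin n} (hj : j ∈ E R ∪ O R) :
    ∃ ρ < R, j ∉ E ρ ∪ O ρ ∧ j ∈ E (ρ + 1) ∪ O (ρ + 1) ∧
      weight γ R E O j = ((1 - γ) ^ ρ) ^ 2 - ((1 - γ) ^ R) ^ 2 := by
  classical
  have hex : ∃ q, j ∈ E q ∪ O q := ⟨R, hj⟩
  obtain ⟨q, hq⟩ : ∃ q, Nat.find hex = q := ⟨_, rfl⟩
  have hq1 : j ∈ E q ∪ O q := hq ▸ Nat.find_spec hex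
  have hqR : q ≤ R := hq ▸ Nat.find_min' hex hj
  rcases q with _ | ρ
  · simp [h.even_zero, h.odd_zero] at hq1
  · refine ⟨ρ, hqR, Nat.find_min hex (by omega), hq1, ?_⟩
    rw [weight, ← sum_range_ite_le_telescope (fun r => ((1 - γ) ^ r) ^ 2) (by omega : ρ ≤ R)]
    refine Finset.sum_congr rfl fun r hr => ?_
    have hr' := Finset.mem_range.1 hr
    congr 1
    refine if_congr ⟨fun hm => ?_, fun hm => ?_⟩ rfl rfl
    · by_contra hlt
      exact Nat.find_min hex (m := r + 1) (by omega) hm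
    · exact h.union_mono (by omega : ρ + 1 ≤ r + 1) (by omega) hq1

/-- A vertex classified in round `ρ` passed threshold `t_ρ` but not the previous one, so `|v j|` is
within a factor `1 + O(γ)` of `t_ρ`; for `ρ = 0` the bound `|v j| ≤ 1` replaces the previous round.
Truncation at the last threshold changes the rounded value by at most `(1 - γ) ^ R`, and an
unclassified value is itself at most `3 (1 - γ) ^ R`. -/
theorem abs_rounded_sub_le (h : Rounds v γ R E O) (hγ : 0 < γ) (hγ1 : γ ≤ 1 / 2) (hR : 0 < R)
    (hv : ∀ j, |v j| ≤ 1) (j : Fin n) :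
    |rounded γ R E O j - v j| ≤ 8 * γ * |v j| + 3 * (1 - γ) ^ R := by
  have h1 : 0 < 1 - γ := by linarith
  have htR : 0 < (1 - γ) ^ R := pow_pos h1 R
  by_cases hj : j ∈ E R ∪ O R
  · obtain ⟨ρ, hρ, hn, hm, hw⟩ := h.exists_entry hj
    have hnE : j ∉ E ρ := fun h => hn (Finset.mem_union_left _ h)
    have hnO : j ∉ O ρ := fun h => hn (Finset.mem_union_right _ h)
    set t := (1 - γ) ^ ρ with ht
    have ht0 : 0 < t := pow_pos h1 ρ
    have htt : (1 - γ) ^ R ≤ t := pow_le_pow_of_le_one h1.le (by linarith) hρ.le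
    have hup : (1 - γ) * |v j| ≤ (1 + γ) * t := by
      rcases ρ with _ | ρ
      · have : t = 1 := by simp [ht]
        nlinarith [hv j, abs_nonneg (v j)]
      · have := (h.step ρ (by omega)).abs_le j hnE hnO
        rw [ht, pow_succ]
        nlinarith
    have hsqrt : t - (1 - γ) ^ R ≤ √(weight γ R E O j) ∧ √(weight γ R E O j) ≤ t := by
      rw [hw]
      constructor
      · apply Real.le_sqrt_of_sq_le; nlinarith
      · rw [Real.sqrt_le_left ht0.le]; nlinarith
    have key : ∀ a : ℝ, (1 - γ) * t ≤ a → (1 - γ) * a ≤ (1 + γ) * t →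
        |√(weight γ R E O j) - a| ≤ 8 * γ * a + 3 * (1 - γ) ^ R := by
      intro a ha1 ha2
      have h2 : t ≤ 2 * a := by nlinarith
      have h3 : a ≤ 3 * t := by nlinarith
      rw [abs_sub_le_iff]
      constructor
      · nlinarith
      · nlinarith
    have hstep := h.step ρ hρ
    rcases Finset.mem_union.1 hm with hE | hO
    · have hER : j ∈ E R := h.even_mono (by omega : ρ + 1 ≤ R) le_rfl hE
      have h2 := hstep.even_le j hE hnE
      have h3 : |v j| = v j := abs_of_nonneg (le_trans (by positivity) h2)
      rw [rounded, if_pos hER, h3]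
      exact key _ h2 (h3 ▸ hup)
    · have hOR : j ∈ O R := h.odd_mono (by omega : ρ + 1 ≤ R) le_rfl hO
      have hER : j ∉ E R := fun hE => Finset.disjoint_left.1 (h.disjoint le_rfl) hE hOR
      have h2 := hstep.odd_le j hO hnO
      have h3 : |v j| = -v j := by
        rw [← abs_neg]; exact abs_of_nonneg (le_trans (by positivity) h2)
      rw [rounded, if_neg hER, if_pos hOR, h3]
      have := key _ h2 (h3 ▸ hup)
      rwa [← abs_neg, show -(√(weight γ R E O j) - -v j) = -√(weight γ R E O j) - v j by ring]
        at this
  · have hE : j ∉ E R := fun h => hj (Finset.mem_union_left _ h)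
    have hO : j ∉ O R := fun h => hj (Finset.mem_union_right _ h)
    rw [rounded, if_neg hE, if_neg hO, zero_sub, abs_neg]
    obtain ⟨R, rfl⟩ : ∃ R', R = R' + 1 := ⟨R - 1, by omega⟩
    have h2 := (h.step R (by omega)).abs_le j hE hO
    have h3 : 0 < (1 - γ) ^ R := pow_pos h1 R
    rw [pow_succ]
    nlinarith [abs_nonneg (v j)]

end Rounds

/-! ### The layer-cake estimate for a single edge. -/

open Classical in
/-- The contribution of one edge `{j, k}` of weight one to `cut - f * inc`. -/
def pairValue {n : ℕ} (f : ℝ) (A B : Finset (Fin n)) (j k : Fin n) : ℝ :=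
  (if (j ∈ A ∧ k ∈ B) ∨ (j ∈ B ∧ k ∈ A) then 1 else 0) +
    (if Xor (j ∈ A ∪ B) (k ∈ A ∪ B) then 1 else 0) / 2 -
      f * (if j ∈ A ∪ B ∨ k ∈ A ∪ B then 1 else 0)

theorem pairValue_comm {n : ℕ} (f : ℝ) (A B : Finset (Fin n)) (j k : Fin n) :
    pairValue f A B j k = pairValue f A B k j := by
  unfold pairValue
  congr 2
  · exact if_congr ⟨fun h => h.symm.imp And.symm And.symm, fun h => h.symm.imp And.symm And.symm⟩
      rfl rfl
  · exact congrArg (· / 2) (if_congr (iff_of_eq (xor_comm _ _)) rfl rfl)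
  · exact if_congr or_comm rfl rfl

namespace Rounds

variable {n : ℕ} {v : Fin n → ℝ} {γ : ℝ} {R : ℕ} {E O : ℕ → Finset (Fin n)}

/-- If `j` is classified no later than `k`, the edge is crossing while only `j` is present, and
afterwards good or useless for ever, since sides never change. Summing over the rounds yields
exactly the right-hand side of `EdgeBound` at the rounded values, with `x` belonging to `j`. -/
theorem le_sum_pairValue_of_imp (h : Rounds v γ R E O) (hγ : 0 < γ) (hγ1 : γ < 1) {f σ C : ℝ}
    (hC : ∀ x y : ℝ, y ^ 2 ≤ x ^ 2 → EdgeBound f σ C x y) {j k : Fin n}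
    (hjk : ∀ r < R, k ∈ E (r + 1) ∪ O (r + 1) → j ∈ E (r + 1) ∪ O (r + 1)) :
    C * (2 * σ * (rounded γ R E O j ^ 2 + rounded γ R E O k ^ 2) -
        (rounded γ R E O j + rounded γ R E O k) ^ 2) ≤
      ∑ r ∈ Finset.range R, (((1 - γ) ^ r) ^ 2 - ((1 - γ) ^ (r + 1)) ^ 2) *
        pairValue f (E (r + 1)) (O (r + 1)) j k := by
  classical
  set a : ℝ := if (j ∈ E R ∧ k ∈ O R) ∨ (j ∈ O R ∧ k ∈ E R) then 1 else 0 with ha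
  have hsum : ∑ r ∈ Finset.range R, (((1 - γ) ^ r) ^ 2 - ((1 - γ) ^ (r + 1)) ^ 2) *
        pairValue f (E (r + 1)) (O (r + 1)) j k =
      (weight γ R E O j - weight γ R E O k) / 2 - f * weight γ R E O j +
        a * weight γ R E O k := by
    unfold weight
    rw [← Finset.sum_sub_distrib, Finset.sum_div, Finset.mul_sum, Finset.mul_sum,
      ← Finset.sum_sub_distrib, ← Finset.sum_add_distrib]
    refine Finset.sum_congr rfl fun r hr => ?_
    have hr' := Finset.mem_range.1 hr
    have himp := hjk r hr'
    have hE := h.even_mono (a := r + 1) hr' le_rfl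
    have hO := h.odd_mono (a := r + 1) hr' le_rfl
    have hd := Finset.disjoint_left.1 (h.disjoint (a := R) le_rfl)
    have hval : pairValue f (E (r + 1)) (O (r + 1)) j k =
        ((if j ∈ E (r + 1) ∪ O (r + 1) then 1 else 0) -
          (if k ∈ E (r + 1) ∪ O (r + 1) then 1 else 0)) / 2 -
          f * (if j ∈ E (r + 1) ∪ O (r + 1) then 1 else 0) +
          a * (if k ∈ E (r + 1) ∪ O (r + 1) then 1 else 0) := by
      unfold pairValue
      by_cases hk : k ∈ E (r + 1) ∪ O (r + 1)
      · have hj := himp hk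
        have hiff : ((j ∈ E (r + 1) ∧ k ∈ O (r + 1)) ∨ (j ∈ O (r + 1) ∧ k ∈ E (r + 1))) ↔
            ((j ∈ E R ∧ k ∈ O R) ∨ (j ∈ O R ∧ k ∈ E R)) := by
          rw [Finset.mem_union] at hj hk
          have e1 := @hE j
          have e2 := @hE k
          have e3 := @hO j
          have e4 := @hO k
          have e5 := @hd j
          have e6 := @hd k
          tauto
        rw [ha]
        simp only [hj, hk, hiff, xor_self, if_true, true_or]
        simp only [if_false]
        ring_nf
      · have h1 : ¬ ((j ∈ E (r + 1) ∧ k ∈ O (r + 1)) ∨ (j ∈ O (r + 1) ∧ k ∈ E (r + 1))) := by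
          rw [Finset.mem_union] at hk; tauto
        by_cases hj : j ∈ E (r + 1) ∪ O (r + 1)
        · simp [h1, hj, hk, Xor]
        · simp [h1, hj, hk, Xor]
    rw [hval]; ring_nf
  have hle : weight γ R E O k ≤ weight γ R E O j := by
    refine Finset.sum_le_sum fun r hr => mul_le_mul_of_nonneg_left ?_ (gap_nonneg hγ hγ1 r)
    have := hjk r (Finset.mem_range.1 hr)
    by_cases hk : k ∈ E (r + 1) ∪ O (r + 1)
    · rw [if_pos hk, if_pos (this hk)]
    · rw [if_neg hk]; split_ifs <;> norm_num
  rw [hsum, ← h.rounded_sq hγ hγ1, ← h.rounded_sq hγ hγ1]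
  rw [← h.rounded_sq hγ hγ1, ← h.rounded_sq hγ hγ1] at hle
  obtain ⟨hb1, hb2⟩ := hC _ _ hle
  have hd := Finset.disjoint_left.1 (h.disjoint (a := R) le_rfl)
  by_cases hopp : (j ∈ E R ∧ k ∈ O R) ∨ (j ∈ O R ∧ k ∈ E R)
  · rw [ha, if_pos hopp, one_mul]
    apply hb1
    unfold rounded
    rcases hopp with ⟨hj, hk⟩ | ⟨hj, hk⟩
    · rw [if_pos hj, if_neg fun hk' => hd hk' hk, if_pos hk, mul_neg, neg_nonpos]
      positivity
    · rw [if_pos hk, if_neg fun hj' => hd hj' hj, if_pos hj, neg_mul, neg_nonpos]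
      positivity
  · rw [ha, if_neg hopp, zero_mul, add_zero]
    apply hb2
    unfold rounded
    by_cases hj : j ∈ E R
    · by_cases hk : k ∈ E R
      · rw [if_pos hj, if_pos hk]; positivity
      · rw [if_neg hk, if_neg fun hk' => hopp (Or.inl ⟨hj, hk'⟩), mul_zero]
    · by_cases hj' : j ∈ O R
      · rw [if_neg hj, if_pos hj', if_neg fun hk => hopp (Or.inr ⟨hj', hk⟩)]
        split_ifs
        · rw [neg_mul_neg]; positivity
        · rw [mul_zero]
      · rw [if_neg hj, if_neg hj', zero_mul]

/-- The classified sets are nested, so one of the two end points always enters no later than the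
other, and the edge value is symmetric. -/
theorem le_sum_pairValue (h : Rounds v γ R E O) (hγ : 0 < γ) (hγ1 : γ < 1) {f σ C : ℝ}
    (hC : ∀ x y : ℝ, y ^ 2 ≤ x ^ 2 → EdgeBound f σ C x y) (j k : Fin n) :
    C * (2 * σ * (rounded γ R E O j ^ 2 + rounded γ R E O k ^ 2) -
        (rounded γ R E O j + rounded γ R E O k) ^ 2) ≤
      ∑ r ∈ Finset.range R, (((1 - γ) ^ r) ^ 2 - ((1 - γ) ^ (r + 1)) ^ 2) *
        pairValue f (E (r + 1)) (O (r + 1)) j k := by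
  by_cases hjk : ∀ r < R, k ∈ E (r + 1) ∪ O (r + 1) → j ∈ E (r + 1) ∪ O (r + 1)
  · exact h.le_sum_pairValue_of_imp hγ hγ1 hC hjk
  · have hkj : ∀ r < R, j ∈ E (r + 1) ∪ O (r + 1) → k ∈ E (r + 1) ∪ O (r + 1) := by
      push Not at hjk
      obtain ⟨q, hq, hk, hj⟩ := hjk
      intro r hr hj'
      rcases le_total r q with hrq | hrq
      · exact absurd (h.union_mono (by omega : r + 1 ≤ q + 1) (by omega) hj') hj
      · exact h.union_mono (by omega : q + 1 ≤ r + 1) (by omega) hk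
    have := h.le_sum_pairValue_of_imp hγ hγ1 hC hkj
    simp_rw [pairValue_comm f _ _ j k]
    rwa [add_comm (rounded γ R E O j ^ 2), add_comm (rounded γ R E O j)]

end Rounds

/-! ### From the edge estimate to a round that passes the test. -/

namespace WeightedGraph

variable {n : ℕ} (G : WeightedGraph n)

theorem cut_sub_eq_sum_pairValue (f : ℝ) (A B : Finset (Fin n)) :
    G.cut A B - f * G.inc A B = (∑ j, ∑ k, G.w j k * pairValue f A B j k) / 2 := by
  classical
  unfold cut good cross inc edgeWeight pairValue
  have : ∀ a b c : ℝ, a / 2 + b / 2 / 2 - f * (c / 2) = (a + b / 2 - f * c) / 2 := fun a b c => by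
    ring
  rw [this]
  congr 1
  rw [Finset.sum_div, Finset.mul_sum, ← Finset.sum_add_distrib, ← Finset.sum_sub_distrib]
  refine Finset.sum_congr rfl fun j _ => ?_
  rw [Finset.sum_div, Finset.mul_sum, ← Finset.sum_add_distrib, ← Finset.sum_sub_distrib]
  refine Finset.sum_congr rfl fun k _ => ?_
  have e : ∀ p : Prop, (if p then G.w j k else 0) = G.w j k * (if p then 1 else 0) := fun p => by
    split_ifs <;> simp
  rw [e, e, e]; ring_nf

theorem inc_le {Δ : ℝ} (hΔ : DegreeBound G Δ) (A B : Finset (Fin n)) :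
    G.inc A B ≤ Δ * ((A.card + B.card : ℕ) : ℝ) := by
  classical
  have h0 : G.inc A B = (∑ j, ∑ k, if j ∈ A ∪ B ∨ k ∈ A ∪ B then G.w j k else 0) / 2 := by
    unfold inc edgeWeight
    congr 1
    exact Finset.sum_congr rfl fun j _ => Finset.sum_congr rfl fun k _ => by
      dsimp only; split_ifs <;> rfl
  have h1 : ∑ j, ∑ k, (if j ∈ A ∪ B ∨ k ∈ A ∪ B then G.w j k else 0) ≤
      ∑ j, ∑ k, (if j ∈ A ∪ B then G.w j k else 0) +
        ∑ j, ∑ k, (if k ∈ A ∪ B then G.w j k else 0) := by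
    rw [← Finset.sum_add_distrib]
    refine Finset.sum_le_sum fun j _ => ?_
    rw [← Finset.sum_add_distrib]
    refine Finset.sum_le_sum fun k _ => ?_
    have := G.w_nonneg j k
    split_ifs <;> first | tauto | linarith
  have h2 : ∑ j, ∑ k, (if j ∈ A ∪ B then G.w j k else 0) = ∑ j ∈ A ∪ B, G.deg j := by
    have : ∀ j, ∑ k, (if j ∈ A ∪ B then G.w j k else 0) = if j ∈ A ∪ B then G.deg j else 0 :=
      fun j => by split_ifs <;> simp [deg]
    simp_rw [this]
    rw [Finset.sum_ite_mem, Finset.univ_inter]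
  have h3 : ∑ j, ∑ k, (if k ∈ A ∪ B then G.w j k else 0) = ∑ j ∈ A ∪ B, G.deg j := by
    rw [← h2, Finset.sum_comm]
    exact Finset.sum_congr rfl fun j _ => Finset.sum_congr rfl fun k _ => by rw [G.symm]
  have h4 : ∑ j ∈ A ∪ B, G.deg j ≤ Δ * ((A.card + B.card : ℕ) : ℝ) := by
    rcases (A ∪ B).eq_empty_or_nonempty with h | ⟨j, hj⟩
    · have := Finset.union_eq_empty.1 h
      simp [this]
    have hΔ0 : 0 ≤ Δ := (G.deg_pos j).le.trans (hΔ j)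
    refine (Finset.sum_le_card_nsmul _ _ Δ fun j _ => hΔ j).trans ?_
    rw [nsmul_eq_mul, mul_comm]
    exact mul_le_mul_of_nonneg_left (Nat.cast_le.2 (Finset.card_union_le A B)) hΔ0
  linarith

theorem cut_le_inc (A B : Finset (Fin n)) : G.cut A B ≤ G.inc A B := by
  classical
  have h := G.cut_sub_eq_sum_pairValue 1 A B
  have h2 : (∑ j, ∑ k, G.w j k * pairValue 1 A B j k) / 2 ≤ 0 := by
    refine div_nonpos_of_nonpos_of_nonneg (Finset.sum_nonpos fun j _ => Finset.sum_nonpos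
      fun k _ => mul_nonpos_of_nonneg_of_nonpos (G.w_nonneg j k) ?_) zero_le_two
    unfold pairValue
    by_cases hg : (j ∈ A ∧ k ∈ B) ∨ (j ∈ B ∧ k ∈ A)
    · have hj : j ∈ A ∪ B := Finset.mem_union.2 (hg.imp And.left And.left)
      have hk : k ∈ A ∪ B := Finset.mem_union.2 (hg.symm.imp And.right And.right)
      rw [if_pos hg, if_neg (by simp [Xor, hj, hk]), if_pos (Or.inl hj)]; norm_num
    · rw [if_neg hg]
      by_cases ho : j ∈ A ∪ B ∨ k ∈ A ∪ B
      · rw [if_pos ho]; split_ifs <;> norm_num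
      · rw [if_neg ho, if_neg fun h => ho (h.imp And.left And.left)]; norm_num
  linarith

/-- A small perturbation of a vector with small signless Rayleigh quotient. -/
theorem le_of_energy_sub_le {u v : Fin n → ℝ} {σ η g : ℝ} (hσ : σ ≤ 1 / 3) (hη : 0 < η)
    (hση : 0 ≤ σ - η / 2) (hg : 0 < g) (hg1 : g ≤ η / 16)
    (hQ : G.sumForm v ≤ 2 * (σ - η / 2) * G.energy v)
    (he : G.energy (fun j => u j - v j) ≤ g ^ 2 * G.energy v) :
    η / 2 * G.energy v ≤ 2 * σ * G.energy u - G.sumForm u := by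
  set N := G.energy v
  set e : Fin n → ℝ := fun j => u j - v j
  have hN : 0 ≤ N := G.energy_nonneg v
  -- Squares of sums are split with weight `g`, so that an error of energy `g² N` costs only `O(g)
  -- N`.
  have h1 : (1 - g) * N - 1 / g * G.energy e ≤ G.energy u := by
    simp only [N, energy, Finset.mul_sum]
    rw [← Finset.sum_sub_distrib]
    refine Finset.sum_le_sum fun j _ => ?_
    have h2 : (1 - g) * v j ^ 2 - 1 / g * e j ^ 2 ≤ u j ^ 2 := by
      have : u j ^ 2 - ((1 - g) * v j ^ 2 - 1 / g * e j ^ 2) =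
          (g * v j + e j) ^ 2 / g + e j ^ 2 := by
        simp only [e]; field_simp; ring
      have : 0 ≤ (g * v j + e j) ^ 2 / g + e j ^ 2 := by positivity
      linarith
    nlinarith [mul_le_mul_of_nonneg_left h2 (G.deg_pos j).le]
  have h2 : G.sumForm u ≤ (1 + g) * G.sumForm v + (1 + 1 / g) * G.sumForm e := by
    unfold sumForm
    rw [mul_div_assoc', mul_div_assoc', ← add_div]
    refine div_le_div_of_nonneg_right ?_ zero_le_two
    simp only [Finset.mul_sum]
    rw [← Finset.sum_add_distrib]
    refine Finset.sum_le_sum fun j _ => ?_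
    rw [← Finset.sum_add_distrib]
    refine Finset.sum_le_sum fun k _ => ?_
    have h3 : (u j + u k) ^ 2 ≤ (1 + g) * (v j + v k) ^ 2 + (1 + 1 / g) * (e j + e k) ^ 2 := by
      have : (1 + g) * (v j + v k) ^ 2 + (1 + 1 / g) * (e j + e k) ^ 2 - (u j + u k) ^ 2 =
          (g * (v j + v k) - (e j + e k)) ^ 2 / g := by
        simp only [e]; field_simp; ring
      have : 0 ≤ (g * (v j + v k) - (e j + e k)) ^ 2 / g := by positivity
      linarith
    nlinarith [mul_le_mul_of_nonneg_left h3 (G.w_nonneg j k)]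
  have h3 := G.sumForm_le e
  have h4 : 1 / g * G.energy e ≤ g * N := by
    rw [one_div, inv_mul_le_iff₀ hg]; linarith [show g * (g * N) = g ^ 2 * N by ring]
  have h5 : (1 + 1 / g) * G.sumForm e ≤ 2 * g ^ 2 * N + 2 * g * N := by
    have : (1 + 1 / g) * G.sumForm e ≤ (1 + 1 / g) * (2 * G.energy e) :=
      mul_le_mul_of_nonneg_left h3 (by positivity)
    linarith
  have h6 : (1 + g) * G.sumForm v ≤ (1 + g) * (2 * (σ - η / 2) * N) :=
    mul_le_mul_of_nonneg_left hQ (by linarith)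
  have hσ0 : 0 < σ := by linarith
  have h7 : 2 * σ * ((1 - g) * N - g * N) ≤ 2 * σ * G.energy u :=
    mul_le_mul_of_nonneg_left (by linarith) (by linarith)
  have h8 : 0 ≤ (η / 2 - g * (4 * σ + 2 * (σ - η / 2) + 2 * g + 2)) * N := by
    refine mul_nonneg ?_ hN
    have : g ≤ 1 := by linarith
    nlinarith
  nlinarith

/-- If the estimates are good in all rounds, then the test is passed in some round. -/
theorem exists_accepting_round {v : Fin n → ℝ} {γ : ℝ} {R : ℕ} {E O : ℕ → Finset (Fin n)}
    (h : Rounds v γ R E O) (hn : 0 < n) (hγ : 0 < γ) (hγ1 : γ ≤ 1 / 2) (hR : 0 < R)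
    (hv : ∀ j, |v j| ≤ 1)
    {σ η μ B C c Δ L : ℝ} (hσ : σ ≤ 1 / 3) (hη : 0 < η)
    (hση : 0 ≤ σ - η / 2) (hQ : G.sumForm v ≤ 2 * (σ - η / 2) * G.energy v)
    (hB : 0 < B) (hN : B / G.vol ^ (1 + μ) ≤ G.energy v)
    (hC0 : 0 < C) (hC : ∀ x y : ℝ, y ^ 2 ≤ x ^ 2 → EdgeBound (soto σ) σ C x y)
    (htR : (1 - γ) ^ R ≤ γ / G.vol ^ (1 + μ / 2))
    (hγB : γ * √(128 + 18 / B) ≤ η / 16) (hL : 0 < L) (hc : 0 < c)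
    (hcR : 2 * γ * c * R < C * (η / 2) * B * L) (hΔ : DegreeBound G Δ) :
    ∃ r < R, soto σ * G.inc (E (r + 1)) (O (r + 1)) ≤ G.cut (E (r + 1)) (O (r + 1)) ∧
      c / (Δ * ((1 - γ) ^ r) ^ 2 * G.vol ^ (1 + μ) * L) ≤
        (((E (r + 1)).card + (O (r + 1)).card : ℕ) : ℝ) := by
  have hm := G.vol_pos hn
  have hΔ0 : 0 < Δ := (G.deg_pos ⟨0, hn⟩).trans_le (hΔ _)
  have hγ1' : γ < 1 := by linarith
  set u := Rounds.rounded γ R E O with hu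
  set N := G.energy v with hNd
  set M := G.vol ^ (1 + μ) with hMd
  have hM : 0 < M := Real.rpow_pos_of_pos hm _
  have hN0 : 0 < N := lt_of_lt_of_le (by positivity) hN
  have htR0 : 0 < (1 - γ) ^ R := pow_pos (by linarith) R
  have herr : G.energy (fun j => u j - v j) ≤ (γ * √(128 + 18 / B)) ^ 2 * N := by
    have h1 : ∀ j, (u j - v j) ^ 2 ≤ 128 * γ ^ 2 * v j ^ 2 + 18 * ((1 - γ) ^ R) ^ 2 := fun j => by
      have h2 := h.abs_rounded_sub_le hγ hγ1 hR hv j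
      have h3 : (u j - v j) ^ 2 ≤ (8 * γ * |v j| + 3 * (1 - γ) ^ R) ^ 2 := by
        rw [← sq_abs (u j - v j)]
        exact pow_le_pow_left₀ (abs_nonneg _) h2 2
      rw [← sq_abs (v j)]
      nlinarith [sq_nonneg (8 * γ * |v j| - 3 * (1 - γ) ^ R)]
    have h2 : G.energy (fun j => u j - v j) ≤
        128 * γ ^ 2 * N + 18 * ((1 - γ) ^ R) ^ 2 * G.vol := by
      simp only [hNd, energy, vol, Finset.mul_sum]
      rw [← Finset.sum_add_distrib]
      refine Finset.sum_le_sum fun j _ => ?_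
      nlinarith [mul_le_mul_of_nonneg_left (h1 j) (G.deg_pos j).le]
    -- The last threshold is chosen for this: truncating every vertex there costs energy of order
    -- `γ² / m^(1+μ)`, a small fraction of the guaranteed `B / m^(1+μ)`.
    have h3 : ((1 - γ) ^ R) ^ 2 * G.vol ≤ γ ^ 2 * N / B := by
      have h4 : ((1 - γ) ^ R) ^ 2 ≤ (γ / G.vol ^ (1 + μ / 2)) ^ 2 :=
        pow_le_pow_left₀ htR0.le htR 2
      have h5 : (γ / G.vol ^ (1 + μ / 2)) ^ 2 * G.vol = γ ^ 2 / M := by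
        have : (G.vol ^ (1 + μ / 2)) ^ 2 = M * G.vol := by
          rw [hMd, ← Real.rpow_natCast, ← Real.rpow_mul hm.le, ← Real.rpow_add_one hm.ne']
          congr 1; push_cast; ring
        rw [div_pow, this]; field_simp
      have h6 : γ ^ 2 / M ≤ γ ^ 2 * N / B := by
        rw [div_le_div_iff₀ hM hB]
        rw [div_le_iff₀ hM] at hN
        nlinarith [sq_nonneg γ]
      calc _ ≤ (γ / G.vol ^ (1 + μ / 2)) ^ 2 * G.vol := mul_le_mul_of_nonneg_right h4 hm.le
        _ ≤ _ := h5.le.trans h6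
    rw [mul_pow, Real.sq_sqrt (by positivity)]
    calc _ ≤ _ := h2
      _ ≤ 128 * γ ^ 2 * N + 18 * (γ ^ 2 * N / B) := by linarith
      _ = _ := by field_simp
  have hmain := G.le_of_energy_sub_le hσ hη hση (by positivity) hγB hQ herr
  by_contra! hno
  set gap : ℕ → ℝ := fun r => ((1 - γ) ^ r) ^ 2 - ((1 - γ) ^ (r + 1)) ^ 2 with hgap
  have hlow : C * (2 * σ * G.energy u - G.sumForm u) ≤
      ∑ r ∈ Finset.range R, gap r *
        (G.cut (E (r + 1)) (O (r + 1)) - soto σ * G.inc (E (r + 1)) (O (r + 1))) := by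
    have h1 : ∑ r ∈ Finset.range R, gap r *
        (G.cut (E (r + 1)) (O (r + 1)) - soto σ * G.inc (E (r + 1)) (O (r + 1))) =
        (∑ j, ∑ k, G.w j k * ∑ r ∈ Finset.range R, gap r *
          pairValue (soto σ) (E (r + 1)) (O (r + 1)) j k) / 2 := by
      simp_rw [cut_sub_eq_sum_pairValue, mul_div_assoc', ← Finset.sum_div, Finset.mul_sum]
      rw [Finset.sum_comm]
      congr 1
      refine Finset.sum_congr rfl fun j _ => ?_
      rw [Finset.sum_comm]
      exact Finset.sum_congr rfl fun k _ => Finset.sum_congr rfl fun r _ => by ring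
    have h2 : C * (2 * σ * G.energy u - G.sumForm u) =
        (∑ j, ∑ k, G.w j k * (C * (2 * σ * (u j ^ 2 + u k ^ 2) - (u j + u k) ^ 2))) / 2 := by
      have h3 : 2 * σ * G.energy u - G.sumForm u =
          (2 * σ * (∑ j, ∑ k, G.w j k * u j ^ 2 + ∑ j, ∑ k, G.w j k * u k ^ 2) -
            ∑ j, ∑ k, G.w j k * (u j + u k) ^ 2) / 2 := by
        rw [sum_w_mul_sq, sum_w_mul_sq', sumForm]; ring
      rw [h3, mul_div_assoc', ← Finset.sum_add_distrib, Finset.mul_sum, ← Finset.sum_sub_distrib,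
        Finset.mul_sum]
      congr 1
      refine Finset.sum_congr rfl fun j _ => ?_
      rw [← Finset.sum_add_distrib, Finset.mul_sum, ← Finset.sum_sub_distrib, Finset.mul_sum]
      exact Finset.sum_congr rfl fun k _ => by ring
    rw [h1, h2]
    refine div_le_div_of_nonneg_right (Finset.sum_le_sum fun j _ => Finset.sum_le_sum fun k _ =>
      mul_le_mul_of_nonneg_left ?_ (G.w_nonneg j k)) zero_le_two
    exact h.le_sum_pairValue hγ hγ1' hC j k
  have hup : ∀ r ∈ Finset.range R, gap r *
      (G.cut (E (r + 1)) (O (r + 1)) - soto σ * G.inc (E (r + 1)) (O (r + 1))) ≤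
        2 * γ * c / (M * L) := by
    intro r hr
    have hr' := Finset.mem_range.1 hr
    have hg0 : 0 ≤ gap r := Rounds.gap_nonneg hγ hγ1' r
    have hrhs : 0 ≤ 2 * γ * c / (M * L) := by positivity
    rcases lt_or_ge (G.cut (E (r + 1)) (O (r + 1)))
      (soto σ * G.inc (E (r + 1)) (O (r + 1))) with h1 | h1
    · exact (mul_nonpos_of_nonneg_of_nonpos hg0 (by linarith)).trans hrhs
    · have h2 := hno r hr' h1
      have hinc0 : 0 ≤ G.inc (E (r + 1)) (O (r + 1)) :=
        div_nonneg (Finset.sum_nonneg fun j _ => Finset.sum_nonneg fun k _ => by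
          split_ifs
          · exact G.w_nonneg j k
          · exact le_rfl) zero_le_two
      have h3 := G.cut_le_inc (E (r + 1)) (O (r + 1))
      have h4 := G.inc_le hΔ (E (r + 1)) (O (r + 1))
      have h5 := mul_nonneg (soto_nonneg hσ) hinc0
      have ht : 0 < (1 - γ) ^ r := pow_pos (by linarith) r
      set t := (1 - γ) ^ r with ht'
      -- The factor `t²` cancels the `t²` in the size test, so all rounds get the same bound; the
      -- factor `1 - (1 - γ)²` is at most `2γ`.
      have h6 : gap r ≤ 2 * γ * t ^ 2 := by
        simp only [hgap, pow_succ _ r, ← ht']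
        nlinarith [sq_nonneg (γ * t)]
      have h7 : G.cut (E (r + 1)) (O (r + 1)) - soto σ * G.inc (E (r + 1)) (O (r + 1)) ≤
          c / (t ^ 2 * M * L) := by
        have h8 := mul_le_mul_of_nonneg_left h2.le hΔ0.le
        have h9 : Δ * (c / (Δ * t ^ 2 * M * L)) = c / (t ^ 2 * M * L) := by field_simp
        linarith
      calc _ ≤ gap r * (c / (t ^ 2 * M * L)) := mul_le_mul_of_nonneg_left h7 hg0
        _ ≤ 2 * γ * t ^ 2 * (c / (t ^ 2 * M * L)) :=
          mul_le_mul_of_nonneg_right h6 (by positivity)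
        _ = _ := by field_simp
  have hup' := (Finset.sum_le_card_nsmul _ _ _ hup)
  rw [Finset.card_range, nsmul_eq_mul] at hup'
  have h1 : C * (η / 2 * N) ≤ R * (2 * γ * c / (M * L)) :=
    (mul_le_mul_of_nonneg_left hmain hC0.le).trans (hlow.trans hup')
  have h2 : C * (η / 2 * (B / M)) ≤ C * (η / 2 * N) := by gcongr
  have h3 := h2.trans h1
  have e1 : C * (η / 2 * (B / M)) = C * (η / 2) * B * L / (M * L) := by field_simp
  have e2 : R * (2 * γ * c / (M * L)) = 2 * γ * c * R / (M * L) := by ring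
  rw [e1, e2, div_le_div_iff_of_pos_right (by positivity)] at h3
  linarith

end WeightedGraph

/-! ### Reasoning about programs -/

open scoped ENNReal

section ProgramLogic

variable {n : ℕ} {α β : Type}

/-- Every possible outcome of `x`, started in `s`, satisfies `Q`. -/
def Post (x : Prog n α) (s : Memory n) (Q : α → Memory n → Prop) : Prop :=
  ∀ o ∈ (x.run s).support, Q o.1 o.2

/-- The expectation of `F` after running `x`, started in `s`. -/
def expect (x : Prog n α) (s : Memory n) (F : α → Memory n → ℝ≥0∞) : ℝ≥0∞ :=
  ∑' o, x.run s o * F o.1 o.2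

theorem run_bind_eq (x : Prog n α) (f : α → Prog n β) (s : Memory n) :
    (x >>= f).run s = (x.run s).bind fun o => (f o.1).run o.2 := rfl

theorem run_pure_eq (a : α) (s : Memory n) : (pure a : Prog n α).run s = PMF.pure (a, s) := rfl

theorem run_modify_eq (f : Memory n → Memory n) (s : Memory n) :
    (modify f : Prog n Unit).run s = PMF.pure ((), f s) := rfl

theorem run_get_eq (s : Memory n) : (get : Prog n (Memory n)).run s = PMF.pure (s, s) := rfl

theorem run_lift_eq (p : PMF α) (s : Memory n) :
    (StateT.lift p : Prog n α).run s = p.bind fun a => PMF.pure (a, s) := rfl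

@[simp]
theorem post_pure (a : α) (s : Memory n) (Q : α → Memory n → Prop) :
    Post (pure a) s Q ↔ Q a s := by
  simp only [Post, run_pure_eq, PMF.mem_support_pure_iff, forall_eq]

@[simp]
theorem post_bind (x : Prog n α) (f : α → Prog n β) (s : Memory n) (Q : β → Memory n → Prop) :
    Post (x >>= f) s Q ↔ Post x s fun a s' => Post (f a) s' Q := by
  simp only [Post, run_bind_eq, PMF.mem_support_bind_iff]
  exact ⟨fun h o ho o' ho' => h o' ⟨o, ho, ho'⟩, fun h o' ⟨o, ho, ho'⟩ => h o ho o' ho'⟩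

@[simp]
theorem post_modify (f : Memory n → Memory n) (s : Memory n) (Q : Unit → Memory n → Prop) :
    Post (modify f) s Q ↔ Q () (f s) := by
  simp only [Post, run_modify_eq, PMF.mem_support_pure_iff, forall_eq]

@[simp]
theorem post_tick (k : ℕ) (s : Memory n) (Q : Unit → Memory n → Prop) :
    Post (tick k) s Q ↔ Q () { s with steps := s.steps + k } :=
  post_modify _ s Q

@[simp]
theorem post_get (s : Memory n) (Q : Memory n → Memory n → Prop) :
    Post get s Q ↔ Q s s := by
  simp only [Post, run_get_eq, PMF.mem_support_pure_iff, forall_eq]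

theorem post_lift (p : PMF α) (s : Memory n) (Q : α → Memory n → Prop) (h : ∀ a, Q a s) :
    Post (StateT.lift p) s Q := by
  rintro ⟨a, s'⟩ ho
  simp only [run_lift_eq, PMF.mem_support_bind_iff, PMF.mem_support_pure_iff] at ho
  obtain ⟨b, _, hb⟩ := ho
  cases hb
  exact h a

theorem Post.mono {x : Prog n α} {s : Memory n} {Q Q' : α → Memory n → Prop} (h : Post x s Q)
    (hQ : ∀ a s', Q a s' → Q' a s') : Post x s Q' :=
  fun o ho => hQ _ _ (h o ho)

/-- The invariant is indexed by the list of elements still to be processed, so progress can be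
expressed in it. -/
theorem post_forM {ι : Type} (f : ι → Prog n Unit) (I : List ι → Memory n → Prop)
    (h : ∀ a l s, I (a :: l) s → Post (f a) s fun _ s' => I l s') :
    ∀ (l : List ι) (s : Memory n), I l s → Post (l.forM f) s fun _ s' => I [] s'
  | [], s, hs => by
    rw [List.forM_eq_forM, List.forM_nil, post_pure]; exact hs
  | a :: l, s, hs => by
    rw [List.forM_eq_forM, List.forM_cons, post_bind]
    exact (h a l s hs).mono fun _ s' hs' => by
      have := post_forM f I h l s' hs'
      rwa [List.forM_eq_forM] at this

@[simp]
theorem expect_pure (a : α) (s : Memory n) (F : α → Memory n → ℝ≥0∞) :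
    expect (pure a) s F = F a s := by
  classical
  rw [expect, run_pure_eq, tsum_eq_single (a, s)]
  · simp
  · intro o ho; simp [PMF.pure_apply, ho]

@[simp]
theorem expect_modify (f : Memory n → Memory n) (s : Memory n) (F : Unit → Memory n → ℝ≥0∞) :
    expect (modify f) s F = F () (f s) := by
  classical
  rw [expect, run_modify_eq, tsum_eq_single ((), f s)]
  · simp
  · intro o ho; simp [PMF.pure_apply, ho]

@[simp]
theorem expect_tick (k : ℕ) (s : Memory n) (F : Unit → Memory n → ℝ≥0∞) :
    expect (tick k) s F = F () { s with steps := s.steps + k } :=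
  expect_modify _ s F

@[simp]
theorem expect_get (s : Memory n) (F : Memory n → Memory n → ℝ≥0∞) :
    expect get s F = F s s := by
  classical
  rw [expect, run_get_eq, tsum_eq_single (s, s)]
  · simp
  · intro o ho; simp [PMF.pure_apply, ho]

theorem tsum_bind_mul {γ δ : Type*} (p : PMF γ) (f : γ → PMF δ) (F : δ → ℝ≥0∞) :
    ∑' b, p.bind f b * F b = ∑' a, p a * ∑' b, f a b * F b := by
  simp only [PMF.bind_apply, ← ENNReal.tsum_mul_right, ← ENNReal.tsum_mul_left]
  rw [ENNReal.tsum_comm]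
  simp only [mul_assoc]

@[simp]
theorem expect_bind (x : Prog n α) (f : α → Prog n β) (s : Memory n) (F : β → Memory n → ℝ≥0∞) :
    expect (x >>= f) s F = expect x s fun a s' => expect (f a) s' F := by
  simp only [expect, run_bind_eq]
  exact tsum_bind_mul _ _ _

theorem expect_lift (p : PMF α) (s : Memory n) (F : α → Memory n → ℝ≥0∞) :
    expect (StateT.lift p) s F = ∑' a, p a * F a s := by
  rw [expect, run_lift_eq, tsum_bind_mul]
  congr 1; ext a
  congr 1
  exact expect_pure a s F

theorem expect_mono {x : Prog n α} {s : Memory n} {Q : α → Memory n → Prop}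
    {F F' : α → Memory n → ℝ≥0∞} (h : Post x s Q) (hF : ∀ a s', Q a s' → F a s' ≤ F' a s') :
    expect x s F ≤ expect x s F' := by
  refine ENNReal.tsum_le_tsum fun o => ?_
  by_cases ho : o ∈ (x.run s).support
  · exact mul_le_mul_right (hF _ _ (h o ho)) _
  · rw [PMF.apply_eq_zero_iff _ _ |>.2 ho, zero_mul, zero_mul]

theorem expect_mono' {x : Prog n α} {s : Memory n} {F F' : α → Memory n → ℝ≥0∞}
    (hF : ∀ a s', F a s' ≤ F' a s') : expect x s F ≤ expect x s F' :=
  ENNReal.tsum_le_tsum fun _ => mul_le_mul_right (hF _ _) _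

theorem expect_const (x : Prog n α) (s : Memory n) (c : ℝ≥0∞) :
    expect x s (fun _ _ => c) = c := by
  rw [expect, ENNReal.tsum_mul_right, PMF.tsum_coe, one_mul]

theorem expect_mul_const (x : Prog n α) (s : Memory n) (F : α → Memory n → ℝ≥0∞) (c : ℝ≥0∞) :
    expect x s (fun a s' => F a s' * c) = expect x s F * c := by
  simp only [expect, ← mul_assoc]
  rw [ENNReal.tsum_mul_right]

theorem expect_add (x : Prog n α) (s : Memory n) (F F' : α → Memory n → ℝ≥0∞) :
    expect x s (fun a s' => F a s' + F' a s') = expect x s F + expect x s F' := by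
  simp only [expect, mul_add]
  rw [ENNReal.tsum_add]

theorem expect_sum {ι : Type*} (t : Finset ι) (x : Prog n α) (s : Memory n)
    (F : ι → α → Memory n → ℝ≥0∞) :
    expect x s (fun a s' => ∑ j ∈ t, F j a s') = ∑ j ∈ t, expect x s (F j) := by
  simp only [expect, Finset.mul_sum]
  rw [Summable.tsum_finsetSum fun _ _ => ENNReal.summable]

end ProgramLogic

/-! ### Random walks -/

section Walks

variable {n : ℕ} (G : WeightedGraph n)

/-- Only the step counter changes, by at most `k`. -/
def OnlySteps (k : ℕ) (s s' : Memory n) : Prop :=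
  s' = { s with steps := s'.steps } ∧ s'.steps ≤ s.steps + k

theorem walk_post (l : ℕ) : ∀ (v : Fin n) (b : Bool) (s : Memory n),
    Post (walk G l v b) s fun _ s' => OnlySteps (4 * l) s s' := by
  induction l with
  | zero => intro v b s; rw [walk, post_pure]; exact ⟨rfl, le_rfl⟩
  | succ l ih =>
    intro v b s
    rw [walk]
    simp only [post_bind, post_tick, coin]
    refine post_lift _ _ _ fun move => ?_
    cases move
    · simp only [Bool.false_eq_true, if_false]
      refine (ih v b _).mono fun _ s' h => ?_
      obtain ⟨h1, h2⟩ := h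
      dsimp only at h2
      exact ⟨h1, by omega⟩
    · simp only [if_true, post_bind, hop, post_tick]
      refine post_lift _ _ _ fun u => ?_
      refine (ih u (!b) _).mono fun _ s' h => ?_
      obtain ⟨h1, h2⟩ := h
      dsimp only at h2
      exact ⟨h1, by omega⟩

theorem walkProb_succ (l : ℕ) (v j : Fin n) : G.walkProb (l + 1) v j =
    G.walkProb l v j / 2 + (∑ u, G.w v u / G.deg v * G.walkProb l u j) / 2 := by
  unfold WeightedGraph.walkProb
  rw [pow_succ', Matrix.mul_apply]
  simp only [WeightedGraph.lazyWalk, Matrix.of_apply, add_mul, Finset.sum_add_distrib]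
  congr 1
  · simp; ring
  · rw [Finset.sum_div]
    exact Finset.sum_congr rfl fun u _ => by ring

theorem signedProb_succ (l : ℕ) (v j : Fin n) : G.signedProb (l + 1) v j =
    G.signedProb l v j / 2 - (∑ u, G.w v u / G.deg v * G.signedProb l u j) / 2 := by
  unfold WeightedGraph.signedProb
  rw [pow_succ', Matrix.mul_apply]
  simp only [WeightedGraph.signedWalk, Matrix.of_apply, sub_mul, Finset.sum_sub_distrib]
  congr 1
  · simp; ring
  · rw [Finset.sum_div]
    exact Finset.sum_congr rfl fun u _ => by ring

theorem step_nonneg (v u : Fin n) : 0 ≤ G.w v u / G.deg v :=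
  div_nonneg (G.w_nonneg v u) (G.deg_pos v).le

theorem sum_step (v : Fin n) : ∑ u, G.w v u / G.deg v = 1 := by
  rw [← Finset.sum_div]; exact div_self (G.deg_pos v).ne'

/-- A signed sum over walks is dominated by the unsigned sum; by induction on the first step. -/
theorem abs_signedProb_le (l : ℕ) : ∀ v j, |G.signedProb l v j| ≤ G.walkProb l v j := by
  induction l with
  | zero =>
    intro v j
    simp only [WeightedGraph.signedProb, WeightedGraph.walkProb, pow_zero, Matrix.one_apply]
    split_ifs <;> simp
  | succ l ih =>
    intro v j
    rw [walkProb_succ, signedProb_succ]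
    refine (abs_sub _ _).trans (add_le_add ?_ ?_)
    · rw [abs_div, abs_two]
      exact div_le_div_of_nonneg_right (ih v j) zero_le_two
    · rw [abs_div, abs_two]
      refine div_le_div_of_nonneg_right ((Finset.abs_sum_le_sum_abs _ _).trans
        (Finset.sum_le_sum fun u _ => ?_)) zero_le_two
      rw [abs_mul, abs_of_nonneg (step_nonneg G v u)]
      exact mul_le_mul_of_nonneg_left (ih u j) (step_nonneg G v u)

theorem walkProb_nonneg (l : ℕ) (v j : Fin n) : 0 ≤ G.walkProb l v j :=
  (abs_nonneg _).trans (abs_signedProb_le G l v j)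

theorem sum_walkProb (l : ℕ) : ∀ v, ∑ j, G.walkProb l v j = 1 := by
  induction l with
  | zero => intro v; simp [WeightedGraph.walkProb, Matrix.one_apply]
  | succ l ih =>
    intro v
    simp_rw [walkProb_succ]
    rw [Finset.sum_add_distrib, ← Finset.sum_div, ← Finset.sum_div, ih, Finset.sum_comm]
    simp_rw [← Finset.mul_sum, ih, mul_one, sum_step]
    norm_num

theorem walkProb_le_one (l : ℕ) (v j : Fin n) : G.walkProb l v j ≤ 1 := by
  rw [← sum_walkProb G l v]
  exact Finset.single_le_sum (f := fun j => G.walkProb l v j)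
    (fun j _ => walkProb_nonneg G l v j) (Finset.mem_univ j)

theorem sum_randomNeighbor (v : Fin n) {g : Fin n → ℝ} (hg : ∀ u, 0 ≤ g u) :
    ∑ u, G.randomNeighbor v u * ENNReal.ofReal (g u) =
      ENNReal.ofReal (∑ u, G.w v u / G.deg v * g u) := by
  rw [ENNReal.ofReal_sum_of_nonneg fun u _ => mul_nonneg (step_nonneg G v u) (hg u)]
  refine Finset.sum_congr rfl fun u _ => ?_
  rw [ENNReal.ofReal_mul (step_nonneg G v u)]
  rfl

/-- The moment generating function of the contribution of one walk to the counter of `j`. -/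
theorem expect_walk (l : ℕ) (j : Fin n) {x y : ℝ} (hx : -1 ≤ x) (hy : -1 ≤ y) :
    ∀ (v : Fin n) (b : Bool) (s : Memory n),
    expect (walk G l v b) s (fun e _ => ENNReal.ofReal
      (1 + if e.1 = j then (if e.2 = b then x else y) else 0)) =
    ENNReal.ofReal (1 + (G.walkProb l v j + G.signedProb l v j) / 2 * x +
      (G.walkProb l v j - G.signedProb l v j) / 2 * y) := by
  induction l generalizing x y with
  | zero =>
    intro v b s
    rw [walk, expect_pure]
    simp only [WeightedGraph.signedProb, WeightedGraph.walkProb, pow_zero, Matrix.one_apply]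
    split_ifs <;> simp
  | succ l ih =>
    intro v b s
    have hpos : ∀ u {x y : ℝ}, -1 ≤ x → -1 ≤ y →
        0 ≤ 1 + (G.walkProb l u j + G.signedProb l u j) / 2 * x +
        (G.walkProb l u j - G.signedProb l u j) / 2 * y := fun u x y hx hy => by
      have h1 := abs_le.1 (abs_signedProb_le G l u j)
      have h2 := walkProb_le_one G l u j
      nlinarith
    rw [walk]
    simp only [expect_bind, expect_tick, coin, expect_lift, tsum_fintype, Fintype.sum_bool,
      PMF.uniformOfFintype_apply, Fintype.card_bool, if_true, hop, Bool.false_eq_true, if_false]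
    -- A hop flips the parity, so the induction hypothesis is applied with `x` and `y` exchanged;
    -- this is why both are generalized.
    have h1 : ∀ u (s : Memory n), expect (walk G l u (!b)) s (fun e _ => ENNReal.ofReal
        (1 + if e.1 = j then (if e.2 = b then x else y) else 0)) =
        ENNReal.ofReal (1 + (G.walkProb l u j + G.signedProb l u j) / 2 * y +
        (G.walkProb l u j - G.signedProb l u j) / 2 * x) := fun u s => by
      rw [← ih hy hx u (!b) s]
      congr 1
      ext e s'
      congr 2
      refine if_congr Iff.rfl ?_ rfl
      cases b <;> cases e.2 <;> simp
    simp only [h1, ih hx hy v b]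
    rw [sum_randomNeighbor G v fun u => hpos u hy hx]
    have h2 : ((2 : ℕ) : ℝ≥0∞)⁻¹ = ENNReal.ofReal (1 / 2) := by
      rw [one_div, ENNReal.ofReal_inv_of_pos two_pos]; norm_num
    rw [h2, ← ENNReal.ofReal_mul (by norm_num), ← ENNReal.ofReal_mul (by norm_num),
      ← ENNReal.ofReal_add]
    · congr 1
      have h3 : ∑ u, G.w v u / G.deg v * (1 + (G.walkProb l u j + G.signedProb l u j) / 2 * y +
          (G.walkProb l u j - G.signedProb l u j) / 2 * x) =
          ∑ u, G.w v u / G.deg v +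
          (∑ u, G.w v u / G.deg v * G.walkProb l u j) * ((x + y) / 2) +
          (∑ u, G.w v u / G.deg v * G.signedProb l u j) * ((y - x) / 2) := by
        rw [Finset.sum_mul, Finset.sum_mul, ← Finset.sum_add_distrib,
          ← Finset.sum_add_distrib]
        exact Finset.sum_congr rfl fun u _ => by ring
      rw [h3, sum_step, walkProb_succ, signedProb_succ]; ring
    · exact mul_nonneg (by norm_num) (Finset.sum_nonneg fun u _ =>
        mul_nonneg (step_nonneg G v u) (hpos u hy hx))
    · exact mul_nonneg (by norm_num) (hpos v hx hy)

theorem exp_sub_one_le {θ : ℝ} (h : |θ| ≤ 1) : Real.exp θ - 1 ≤ θ + θ ^ 2 := by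
  have := Real.abs_exp_sub_one_sub_id_le h
  linarith [le_abs_self (Real.exp θ - 1 - θ)]

/-- The walks are independent, so the moment generating function multiplies. For one walk, `e^θ ≤ 1
+ θ + θ²` makes the mean contribute `θ` times the signed probability and the variance at most `θ²`
times the unsigned one. -/
theorem expect_performWalks (i j : Fin n) (l : ℕ) {θ : ℝ} (hθ : |θ| ≤ 1) (k : ℕ) :
    ∀ s : Memory n, expect (performWalks G i l k) s
      (fun _ s' => ENNReal.ofReal (Real.exp (θ * s'.count j))) ≤
    ENNReal.ofReal (Real.exp (θ * s.count j +
      k * (θ * G.signedProb l i j + θ ^ 2 * G.walkProb l i j))) := by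
  induction k with
  | zero => intro s; rw [performWalks, expect_pure]; simp
  | succ k ih =>
    intro s
    rw [performWalks]
    simp only [expect_bind, expect_tick]
    set c := k * (θ * G.signedProb l i j + θ ^ 2 * G.walkProb l i j) with hc
    set s0 : Memory n := { s with steps := s.steps + 1 } with hs0
    have h1 : ∀ (e : Fin n × Bool) (s' : Memory n), OnlySteps (4 * l) s0 s' →
        expect (record e.1 e.2) s' (fun _ s'' => expect (performWalks G i l k) s''
          (fun _ s' => ENNReal.ofReal (Real.exp (θ * s'.count j)))) ≤
        ENNReal.ofReal (1 + if e.1 = j then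
          (if e.2 = true then Real.exp θ - 1 else Real.exp (-θ) - 1) else 0) *
          ENNReal.ofReal (Real.exp (θ * s.count j + c)) := by
      intro e s' hs'
      simp only [record, expect_bind, expect_tick, expect_modify]
      refine (ih _).trans ?_
      rw [← ENNReal.ofReal_mul]
      · refine ENNReal.ofReal_le_ofReal (le_of_eq ?_)
        rw [hs'.1]
        dsimp only
        rcases eq_or_ne e.1 j with h | h
        · rw [if_pos h, h, Function.update_self]
          split_ifs
          · rw [add_sub_cancel, ← Real.exp_add]; push_cast; congr 1; simp only [hs0]; ring
          · rw [add_sub_cancel, ← Real.exp_add]; push_cast; congr 1; simp only [hs0]; ring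
        · rw [if_neg h, Function.update_of_ne h.symm, add_zero, one_mul]
      · split_ifs <;> simp [Real.exp_nonneg]
    refine (expect_mono (walk_post G l i true s0) h1).trans ?_
    rw [expect_mul_const, expect_walk G l j (by linarith [Real.exp_pos θ])
      (by linarith [Real.exp_pos (-θ)]), ← ENNReal.ofReal_mul']
    · refine ENNReal.ofReal_le_ofReal ?_
      have h2 := exp_sub_one_le hθ
      have h3 := exp_sub_one_le (θ := -θ) (by rwa [abs_neg])
      have h4 := abs_le.1 (abs_signedProb_le G l i j)
      set p := G.walkProb l i j
      set q := G.signedProb l i j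
      have h5 : 1 + (p + q) / 2 * (Real.exp θ - 1) + (p - q) / 2 * (Real.exp (-θ) - 1) ≤
          Real.exp (θ * q + θ ^ 2 * p) := by
        have h6 := Real.add_one_le_exp (θ * q + θ ^ 2 * p)
        nlinarith
      calc _ ≤ Real.exp (θ * q + θ ^ 2 * p) * Real.exp (θ * s.count j + c) :=
            mul_le_mul_of_nonneg_right h5 (Real.exp_nonneg _)
        _ = _ := by
            rw [← Real.exp_add]; congr 1; rw [hc]; push_cast; ring
    · exact Real.exp_nonneg _

/-- The estimate of `v_j` computed from the counters after `w` walks. -/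
def estimate (w : ℕ) (s : Memory n) (j : Fin n) : ℝ := (s.count j : ℝ) / (G.deg j * w)

/-- All estimates are within `a` of the signed density. -/
def GoodEstimates (l : ℕ) (i : Fin n) (w : ℕ) (a : ℝ) (s : Memory n) : Prop :=
  ∀ j, |estimate G w s j - G.signedDensity l i j| ≤ a

-- A Chernoff bound with both tails, followed by a union bound over the vertices. The variance proxy
-- of vertex `j` is at most `max α t` times `d_j`, which is why the number of walks contains that
-- maximum.
open Classical in
theorem expect_not_goodEstimates {l : ℕ} {i : Fin n} {P : Params} {t : ℝ}
    (hα : ProbBound G l i P.α) (hγ : 0 < P.γ) (hγ1 : P.γ ≤ 1) (hκ : 0 < P.κ) (ht : 0 < t)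
    (hn : 2 ≤ n) {s : Memory n} (hs : ∀ j, s.count j = 0) :
    expect (performWalks G i l (numWalks n P t)) s (fun _ s' =>
      if GoodEstimates G l i (numWalks n P t) (P.γ * t) s' then 0 else 1) ≤
    ENNReal.ofReal (2 * (n : ℝ) ^ (1 - P.κ * P.γ ^ 2 / 4)) := by
  set w := numWalks n P t with hw
  set M := max P.α t with hM
  have hM0 : 0 < M := lt_of_lt_of_le ht (le_max_right _ _)
  have hn1 : (1 : ℝ) < n := by exact_mod_cast hn
  have hlog : 0 < Real.log n := Real.log_pos hn1
  have hwle : P.κ * Real.log n * M / t ^ 2 ≤ w := Nat.le_ceil _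
  have hw0 : (0 : ℝ) < w := lt_of_lt_of_le (by positivity) hwle
  -- This minimizes `θ² M - γ t θ`, with value `-γ² t² / (4M)`. The maximum in `M` also guarantees
  -- `θ ≤ 1`.
  set θ := P.γ * t / (2 * M) with hθ
  have hθ0 : 0 < θ := by positivity
  have hθ1 : |θ| ≤ 1 := by
    rw [abs_of_pos hθ0, hθ, div_le_one (by positivity)]
    have : t ≤ M := le_max_right _ _
    nlinarith
  set F : Fin n → ℝ → Memory n → ℝ≥0∞ := fun j τ s' =>
    ENNReal.ofReal (Real.exp (τ * s'.count j)) *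
      ENNReal.ofReal (Real.exp (-(w * τ * G.signedProb l i j) -
        P.γ * t * θ * (G.deg j * w))) with hF
  have hbound : ∀ s' : Memory n, (if GoodEstimates G l i w (P.γ * t) s' then 0 else 1 : ℝ≥0∞) ≤
      ∑ j, (F j θ s' + F j (-θ) s') := by
    intro s'
    split_ifs with h
    · exact zero_le
    · simp only [GoodEstimates, not_forall, not_le] at h
      obtain ⟨j, hj⟩ := h
      refine le_trans ?_ (Finset.single_le_sum (f := fun j => F j θ s' + F j (-θ) s')
        (fun _ _ => zero_le) (Finset.mem_univ j))
      have hd := G.deg_pos j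
      have hdw : 0 < G.deg j * w := by positivity
      have e1 : estimate G w s' j - G.signedDensity l i j =
          (s'.count j - w * G.signedProb l i j) / (G.deg j * w) := by
        rw [estimate, WeightedGraph.signedDensity]; field_simp
      rw [e1, abs_div, abs_of_pos hdw, lt_div_iff₀ hdw] at hj
      rcases lt_abs.1 hj with h1 | h1
      · refine le_trans ?_ (le_self_add : F j θ s' ≤ _)
        rw [hF]
        dsimp only
        rw [← ENNReal.ofReal_mul (Real.exp_nonneg _), ← Real.exp_add, ENNReal.one_le_ofReal,
          Real.one_le_exp_iff]
        nlinarith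
      · refine le_trans ?_ (le_add_self : F j (-θ) s' ≤ _)
        rw [hF]
        dsimp only
        rw [← ENNReal.ofReal_mul (Real.exp_nonneg _), ← Real.exp_add, ENNReal.one_le_ofReal,
          Real.one_le_exp_iff]
        nlinarith
  have hone : ∀ j τ, τ ^ 2 = θ ^ 2 → |τ| ≤ 1 →
      expect (performWalks G i l w) s (fun _ s' => F j τ s') ≤
        ENNReal.ofReal ((n : ℝ) ^ (-(P.κ * P.γ ^ 2 / 4))) := by
    intro j τ hτ hτ1
    rw [hF]
    rw [expect_mul_const]
    refine (mul_le_mul_left (expect_performWalks G i j l hτ1 w s) _).trans ?_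
    rw [← ENNReal.ofReal_mul (Real.exp_nonneg _), ← Real.exp_add,
      Real.rpow_def_of_pos (by linarith)]
    refine ENNReal.ofReal_le_ofReal (Real.exp_le_exp.2 ?_)
    rw [hs j, hτ]
    have hd := G.one_le_deg j
    have hp : G.walkProb l i j ≤ M * G.deg j := by
      have := hα j
      rw [div_le_iff₀ (G.deg_pos j)] at this
      exact this.trans (mul_le_mul_of_nonneg_right (le_max_left _ _) (G.deg_pos j).le)
    have h1 : w * (θ ^ 2 * G.walkProb l i j) ≤ w * (θ ^ 2 * (M * G.deg j)) := by gcongr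
    have h2 : w * (θ ^ 2 * (M * G.deg j)) - P.γ * t * θ * (G.deg j * w) =
        -(w * (P.γ ^ 2 * t ^ 2 / (4 * M)) * G.deg j) := by
      rw [hθ]; field_simp; ring
    have h3 : P.κ * Real.log n * (P.γ ^ 2 / 4) ≤ w * (P.γ ^ 2 * t ^ 2 / (4 * M)) := by
      calc P.κ * Real.log n * (P.γ ^ 2 / 4) =
          P.κ * Real.log n * M / t ^ 2 * (P.γ ^ 2 * t ^ 2 / (4 * M)) := by field_simp
        _ ≤ _ := mul_le_mul_of_nonneg_right hwle (by positivity)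
    have h4 : w * (P.γ ^ 2 * t ^ 2 / (4 * M)) ≤ w * (P.γ ^ 2 * t ^ 2 / (4 * M)) * G.deg j :=
      le_mul_of_one_le_right (by positivity) hd
    push_cast
    nlinarith
  refine (expect_mono' fun _ s' => hbound s').trans ?_
  rw [expect_sum]
  have h1 : ∀ j ∈ Finset.univ, expect (performWalks G i l w) s
      (fun _ s' => F j θ s' + F j (-θ) s') ≤
      ENNReal.ofReal (2 * (n : ℝ) ^ (-(P.κ * P.γ ^ 2 / 4))) := by
    intro j _
    rw [expect_add, two_mul, ENNReal.ofReal_add (by positivity) (by positivity)]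
    exact add_le_add (hone j θ rfl hθ1) (hone j (-θ) (neg_sq θ) (by rwa [abs_neg]))
  refine (Finset.sum_le_card_nsmul _ _ _ h1).trans (le_of_eq ?_)
  rw [Finset.card_univ, Fintype.card_fin, nsmul_eq_mul, ← ENNReal.ofReal_natCast,
    ← ENNReal.ofReal_mul (by positivity)]
  congr 1
  rw [sub_eq_add_neg, Real.rpow_add (by linarith), Real.rpow_one]; ring

end Walks


/-! ### Incremental maintenance of the edge weights -/

/-- Inserting `v` affects only row and column `v` of the edge matrix, and by symmetry they have
equal sums. -/
theorem sum_sum_eq_of_cross {n : ℕ} {D : Fin n → Fin n → ℝ} (v : Fin n)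
    (hs : ∀ j k, D j k = D k j) (hoff : ∀ j k, j ≠ v → k ≠ v → D j k = 0) (hv : D v v = 0) :
    ∑ j, ∑ k, D j k = 2 * ∑ k, D v k := by
  have h1 : ∀ j ∈ Finset.univ.erase v, ∑ k, D j k = D v j := fun j hj => by
    have hj' := Finset.ne_of_mem_erase hj
    rw [Finset.sum_eq_single v (fun k _ hk => hoff j k hj' hk) (by simp), hs]
  have h2 : ∑ k ∈ Finset.univ.erase v, D v k = ∑ k, D v k := by
    rw [← Finset.add_sum_erase _ _ (Finset.mem_univ v), hv, zero_add]
  rw [← Finset.add_sum_erase _ _ (Finset.mem_univ v), Finset.sum_congr rfl h1, h2, two_mul]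

namespace WeightedGraph

variable {n : ℕ} (G : WeightedGraph n)

open Classical in
theorem edgeWeight_eq_add {P P' : Fin n → Fin n → Prop} (v : Fin n)
    (hP : ∀ j k, P j k ↔ P k j) (hP' : ∀ j k, P' j k ↔ P' k j)
    (hoff : ∀ j k, j ≠ v → k ≠ v → (P' j k ↔ P j k)) (g : Fin n → ℝ)
    (hg : ∀ u, u ≠ v → g u = (if P' v u then G.w v u else 0) - (if P v u then G.w v u else 0))
    (hgv : g v = 0) :
    G.edgeWeight P' = G.edgeWeight P + ∑ u, g u := by
  have h := sum_sum_eq_of_cross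
    (D := fun j k => (if P' j k then G.w j k else 0) - (if P j k then G.w j k else 0)) v
    (fun j k => by simp only [G.symm j k, hP j k, hP' j k])
    (fun j k hj hk => by simp only [hoff j k hj hk, sub_self])
    (by simp [G.loopless])
  have h2 : ∑ u, g u =
      ∑ k, ((if P' v k then G.w v k else 0) - (if P v k then G.w v k else 0)) := by
    refine Finset.sum_congr rfl fun u _ => ?_
    rcases eq_or_ne u v with rfl | hu
    · simp [hgv, G.loopless]
    · exact hg u hu
  simp only [Finset.sum_sub_distrib] at h h2
  unfold edgeWeight
  linarith

theorem good_insert {A B : Finset (Fin n)} {v : Fin n} (hA : v ∉ A) (hB : v ∉ B) :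
    G.good (insert v A) B = G.good A B + ∑ u, if u ∈ B then G.w v u else 0 := by
  refine G.edgeWeight_eq_add v (fun j k => by tauto) (fun j k => by tauto) (fun j k hj hk => ?_)
    _ (fun u hu => ?_) (by simp [hB])
  · simp [hj, hk]
  · simp [hA, hB, hu]

theorem cross_insert {A B : Finset (Fin n)} {v : Fin n} (hA : v ∉ A) (hB : v ∉ B) :
    G.cross (insert v A) B = G.cross A B +
      ∑ u, if u ∈ B then -G.w v u else if u ∈ A then -G.w v u else G.w v u := by
  refine G.edgeWeight_eq_add v (fun j k => by rw [xor_comm]) (fun j k => by rw [xor_comm])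
    (fun j k hj hk => ?_) _ (fun u hu => ?_) (by simp [hB, hA, G.loopless])
  · simp [hj, hk]
  · by_cases h1 : u ∈ A <;> by_cases h2 : u ∈ B <;> simp [hA, hB, hu, h1, h2, Xor]

theorem inc_insert {A B : Finset (Fin n)} {v : Fin n} (hA : v ∉ A) (hB : v ∉ B) :
    G.inc (insert v A) B = G.inc A B +
      ∑ u, if u ∈ B then 0 else if u ∈ A then 0 else G.w v u := by
  refine G.edgeWeight_eq_add v (fun j k => or_comm) (fun j k => or_comm)
    (fun j k hj hk => ?_) _ (fun u hu => ?_) (by simp [hB, hA, G.loopless])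
  · simp [hj, hk]
  · by_cases h1 : u ∈ A <;> by_cases h2 : u ∈ B <;> simp [hA, hB, hu, h1, h2]

theorem good_comm (A B : Finset (Fin n)) : G.good A B = G.good B A := by
  unfold good
  congr 1
  ext j k
  tauto

theorem cross_comm (A B : Finset (Fin n)) : G.cross A B = G.cross B A := by
  unfold cross
  rw [Finset.union_comm]

theorem inc_comm (A B : Finset (Fin n)) : G.inc A B = G.inc B A := by
  unfold inc
  rw [Finset.union_comm]

theorem sum_neighbors (v : Fin n) {g : Fin n → ℝ} (hg : ∀ u, G.w v u = 0 → g u = 0) :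
    ((G.neighbors v).map g).sum = ∑ u, g u := by
  classical
  rw [Fin.sum_univ_def, neighbors]
  induction List.finRange n with
  | nil => rfl
  | cons a l ih =>
    by_cases h : G.w v a = 0
    · simpa [h, hg a h] using ih
    · simpa [h] using ih

/-- This is where the normalization of the edge weights enters the running time: scanning an
adjacency list costs at most the degree. -/
theorem length_neighbors_le (v : Fin n) : ((G.neighbors v).length : ℝ) ≤ G.deg v := by
  have h : ∀ l : List (Fin n), (∀ u ∈ l, 1 ≤ G.w v u) →
      (l.length : ℝ) ≤ (l.map fun u => G.w v u).sum := by
    intro l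
    induction l with
    | nil => simp
    | cons a l ih =>
      intro hl
      have h1 := hl a (by simp)
      have h2 := ih fun u hu => hl u (by simp [hu])
      simp only [List.length_cons, List.map_cons, List.sum_cons]
      push_cast
      linarith
  rw [deg, ← G.sum_neighbors v fun u hu => hu]
  refine h _ fun u hu => G.one_le_of_ne_zero v u ?_
  simpa [neighbors] using hu

end WeightedGraph

/-! ### The deterministic part of a round -/

section Rounds

variable {n : ℕ} (G : WeightedGraph n)

/-- The running values of the memory are correct. -/
structure Memory.Running (s : Memory n) : Prop where
  good_eq : s.good = G.good s.even s.odd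
  cross_eq : s.cross = G.cross s.even s.odd
  inc_eq : s.inc = G.inc s.even s.odd

/-- The loop invariant equates the current value plus the outstanding edge updates with the initial
value plus all edge updates. At the end the full updates match the insertion formulas, with the
roles of the two sets exchanged for an odd vertex. -/
theorem classify_post {v : Fin n} {s : Memory n} (hs : s.Running G) (hE : v ∉ s.even)
    (hO : v ∉ s.odd) (b : Bool) :
    Post (classify G b v) s fun _ s' => s'.Running G ∧ s'.count = s.count ∧
      s'.touched = s.touched ∧ s'.even = (if b then insert v s.even else s.even) ∧
      s'.odd = (if b then s.odd else insert v s.odd) ∧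
      s'.steps = s.steps + 8 * (G.neighbors v).length + 1 := by
  set A := if b then s.even else s.odd with hA
  set B := if b then s.odd else s.even with hB
  set g₁ : Fin n → ℝ := fun u => if u ∈ B then G.w v u else 0 with hg₁
  set g₂ : Fin n → ℝ := fun u =>
    if u ∈ B then -G.w v u else if u ∈ A then -G.w v u else G.w v u with hg₂
  set g₃ : Fin n → ℝ := fun u => if u ∈ B then 0 else if u ∈ A then 0 else G.w v u with hg₃
  have hvA : v ∉ A := by cases b <;> simp [hA, hE, hO]
  have hvB : v ∉ B := by cases b <;> simp [hB, hE, hO]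
  rw [classify]
  simp only [post_bind, post_tick, post_modify]
  have hloop := post_forM (updateEdge G b v) (fun l s' => s'.even = s.even ∧ s'.odd = s.odd ∧
    s'.count = s.count ∧ s'.touched = s.touched ∧
    s'.steps + 8 * l.length = s.steps + 8 * (G.neighbors v).length ∧
    s'.good + (l.map g₁).sum = s.good + ((G.neighbors v).map g₁).sum ∧
    s'.cross + (l.map g₂).sum = s.cross + ((G.neighbors v).map g₂).sum ∧
    s'.inc + (l.map g₃).sum = s.inc + ((G.neighbors v).map g₃).sum)
    (by
      rintro u l s' ⟨h1, h2, h3, h4, h5, h6, h7, h8⟩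
      simp only [List.map_cons, List.sum_cons, List.length_cons] at h5 h6 h7 h8
      rw [updateEdge]
      have hA' : (if b then s'.even else s'.odd) = A := by rw [h1, h2]
      have hB' : (if b then s'.odd else s'.even) = B := by rw [h1, h2]
      simp only [post_bind, post_tick, post_modify, hA', hB']
      by_cases hu1 : u ∈ B
      · simp only [hg₁, hg₂, hg₃, hu1, if_true] at h6 h7 h8 ⊢
        exact ⟨h1, h2, h3, h4, by omega, by linarith, by linarith, by linarith⟩
      · by_cases hu2 : u ∈ A
        · simp only [hg₁, hg₂, hg₃, hu1, hu2, if_true, if_false] at h6 h7 h8 ⊢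
          exact ⟨h1, h2, h3, h4, by omega, by linarith, by linarith, by linarith⟩
        · simp only [hg₁, hg₂, hg₃, hu1, hu2, if_false] at h6 h7 h8 ⊢
          exact ⟨h1, h2, h3, h4, by omega, by linarith, by linarith, by linarith⟩)
    (G.neighbors v) s ⟨rfl, rfl, rfl, rfl, rfl, rfl, rfl, rfl⟩
  refine hloop.mono ?_
  rintro _ s' ⟨h1, h2, h3, h4, h5, h6, h7, h8⟩
  simp only [List.map_nil, List.sum_nil, add_zero, List.length_nil, mul_zero] at h5 h6 h7 h8
  rw [G.sum_neighbors v fun u hu => by simp [hg₁, hu]] at h6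
  rw [G.sum_neighbors v fun u hu => by simp [hg₂, hu]] at h7
  rw [G.sum_neighbors v fun u hu => by simp [hg₃, hu]] at h8
  have e1 := G.good_insert hvA hvB
  have e2 := G.cross_insert hvA hvB
  have e3 := G.inc_insert hvA hvB
  cases b
  · simp only [Bool.false_eq_true, if_false] at hA hB ⊢
    rw [hA, hB] at e1 e2 e3
    simp only [hA, hB, hg₁, hg₂, hg₃, hs.good_eq, hs.cross_eq, hs.inc_eq] at h6 h7 h8
    refine ⟨⟨?_, ?_, ?_⟩, h3, h4, h1, by rw [h2], by omega⟩
    · dsimp only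
      rw [h1, h2, G.good_comm, e1, h6, G.good_comm]
    · dsimp only
      rw [h1, h2, G.cross_comm, e2, h7, G.cross_comm]
    · dsimp only
      rw [h1, h2, G.inc_comm, e3, h8, G.inc_comm]
  · simp only [if_true] at hA hB ⊢
    rw [hA, hB] at e1 e2 e3
    simp only [hA, hB, hg₁, hg₂, hg₃, hs.good_eq, hs.cross_eq, hs.inc_eq] at h6 h7 h8
    refine ⟨⟨?_, ?_, ?_⟩, h3, h4, by rw [h1], h2, by omega⟩
    · dsimp only
      rw [h1, h2, e1, h6]
    · dsimp only
      rw [h1, h2, e2, h7]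
    · dsimp only
      rw [h1, h2, e3, h8]

/-- The invariant of the loop that examines the vertices in `l`, started in `s₀`. -/
structure ExamineInv (Δ : ℝ) (w : ℕ) (t : ℝ) (s₀ : Memory n) (l : List (Fin n))
    (s : Memory n) : Prop where
  running : s.Running G
  count_eq : s.count = s₀.count
  touched_eq : s.touched = s₀.touched
  disjoint : Disjoint s.even s.odd
  even_subset : s₀.even ⊆ s.even
  odd_subset : s₀.odd ⊆ s.odd
  even_le : ∀ j ∈ s.even, j ∉ s₀.even → t ≤ estimate G w s₀ j
  odd_le : ∀ j ∈ s.odd, j ∉ s₀.odd → t ≤ -estimate G w s₀ j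
  todo : ∀ j ∈ s₀.touched, j ∈ l ∨ j ∈ s.even ∨ j ∈ s.odd ∨ |estimate G w s₀ j| ≤ t
  steps_le : (s.steps : ℝ) + 10 * l.length ≤ s₀.steps + 10 * s₀.touched.length +
    (8 * Δ + 1) * ((s.even.card + s.odd.card : ℝ) - (s₀.even.card + s₀.odd.card))

/-- A classification costs at most `8 Δ + 1` steps, charged to the growth of the classified sets.
The list may repeat a vertex: one already classified is skipped, and the others are judged by
unchanged counters. -/
theorem examine_post {Δ : ℝ} (hΔ : DegreeBound G Δ) {w : ℕ} {t : ℝ} {s₀ : Memory n} (v : Fin n)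
    (l : List (Fin n)) (s : Memory n) (h : ExamineInv G Δ w t s₀ (v :: l) s) :
    Post (examine G w t v) s fun _ s' => ExamineInv G Δ w t s₀ l s' := by
  have hsteps := h.steps_le
  have hest : (s.count v : ℝ) / (G.deg v * w) = estimate G w s₀ v := by
    rw [h.count_eq]; rfl
  rw [List.length_cons] at hsteps
  push_cast at hsteps
  have hcost : (8 * (G.neighbors v).length + 1 : ℝ) ≤ 8 * Δ + 1 := by
    linarith [G.length_neighbors_le v, hΔ v]
  have hrun : Memory.Running G { s with steps := s.steps + 10 } := ⟨h.1.1, h.1.2, h.1.3⟩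
  rw [examine]
  simp only [post_bind, post_tick, post_get]
  rw [hest]
  split_ifs with h1 h2 h3
  · rw [post_pure]
    refine ⟨hrun, h.2, h.3, h.4, h.5, h.6, h.7, h.8, fun j hj => ?_, by push_cast; linarith⟩
    rcases h.todo j hj with h4 | h4
    · rcases List.mem_cons.1 h4 with rfl | h5
      · exact Or.inr (h1.imp id Or.inl)
      · exact Or.inl h5
    · exact Or.inr h4
  · push Not at h1
    refine (classify_post G hrun h1.1 h1.2 true).mono ?_
    rintro _ s' ⟨a1, a2, a3, a4, a5, a6⟩
    simp only [if_true] at a4 a5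
    refine ⟨a1, a2.trans h.2, a3.trans h.3, ?_, ?_, ?_, ?_, ?_, ?_, ?_⟩
    · rw [a4, a5, Finset.disjoint_insert_left]; exact ⟨h1.2, h.disjoint⟩
    · rw [a4]; exact h.even_subset.trans (Finset.subset_insert _ _)
    · rw [a5]; exact h.odd_subset
    · intro j hj hj0
      rw [a4] at hj
      rcases Finset.mem_insert.1 hj with rfl | hj
      · exact h2.le
      · exact h.even_le j hj hj0
    · intro j hj hj0
      rw [a5] at hj
      exact h.odd_le j hj hj0
    · intro j hj
      rw [a4, a5]
      rcases h.todo j hj with h4 | h4 | h4 | h4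
      · rcases List.mem_cons.1 h4 with rfl | h5
        · exact Or.inr (Or.inl (Finset.mem_insert_self _ _))
        · exact Or.inl h5
      · exact Or.inr (Or.inl (Finset.mem_insert_of_mem h4))
      · exact Or.inr (Or.inr (Or.inl h4))
      · exact Or.inr (Or.inr (Or.inr h4))
    · rw [a4, a5, a6, Finset.card_insert_of_notMem h1.1]
      push_cast
      linarith
  · push Not at h1
    refine (classify_post G hrun h1.1 h1.2 false).mono ?_
    rintro _ s' ⟨a1, a2, a3, a4, a5, a6⟩
    simp only [Bool.false_eq_true, if_false] at a4 a5
    refine ⟨a1, a2.trans h.2, a3.trans h.3, ?_, ?_, ?_, ?_, ?_, ?_, ?_⟩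
    · rw [a4, a5, Finset.disjoint_insert_right]; exact ⟨h1.1, h.disjoint⟩
    · rw [a4]; exact h.even_subset
    · rw [a5]; exact h.odd_subset.trans (Finset.subset_insert _ _)
    · intro j hj hj0
      rw [a4] at hj
      exact h.even_le j hj hj0
    · intro j hj hj0
      rw [a5] at hj
      rcases Finset.mem_insert.1 hj with rfl | hj
      · linarith
      · exact h.odd_le j hj hj0
    · intro j hj
      rw [a4, a5]
      rcases h.todo j hj with h4 | h4 | h4 | h4
      · rcases List.mem_cons.1 h4 with rfl | h5
        · exact Or.inr (Or.inr (Or.inl (Finset.mem_insert_self _ _)))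
        · exact Or.inl h5
      · exact Or.inr (Or.inl h4)
      · exact Or.inr (Or.inr (Or.inl (Finset.mem_insert_of_mem h4)))
      · exact Or.inr (Or.inr (Or.inr h4))
    · rw [a4, a5, a6, Finset.card_insert_of_notMem h1.2]
      push_cast
      linarith
  · rw [post_pure]
    refine ⟨hrun, h.2, h.3, h.4, h.5, h.6, h.7, h.8, fun j hj => ?_, by push_cast; linarith⟩
    rcases h.todo j hj with h4 | h4
    · rcases List.mem_cons.1 h4 with rfl | h5
      · exact Or.inr (Or.inr (Or.inr (abs_le.2 ⟨by linarith, by linarith⟩)))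
      · exact Or.inl h5
    · exact Or.inr h4

/-- The part of a round after the random walks. -/
def afterWalks (w : ℕ) (t : ℝ) : Prog n Unit := do
  let s ← get
  s.touched.forM (examine G w t)
  clearCounts

theorem threshold_eq (P : Params) (i : Fin n) (t : ℝ) :
    threshold G P i t = (tick 6 >>= fun _ =>
      performWalks G i (walkLength P.ε P.μ P.δ G.vol) (numWalks n P t) >>= fun _ =>
        afterWalks G (numWalks n P t) t) := rfl

theorem clearCounts_post {s : Memory n} (hs : ∀ j, s.count j ≠ 0 → j ∈ s.touched) :
    Post clearCounts s fun _ s' => s'.even = s.even ∧ s'.odd = s.odd ∧ s'.good = s.good ∧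
      s'.cross = s.cross ∧ s'.inc = s.inc ∧ (∀ j, s'.count j = 0) ∧ s'.touched = [] ∧
      s'.steps = s.steps + 2 * s.touched.length + 1 := by
  rw [clearCounts]
  simp only [post_bind, post_get, post_tick, post_modify]
  refine (post_forM _ (fun l s' => s'.even = s.even ∧ s'.odd = s.odd ∧ s'.good = s.good ∧
      s'.cross = s.cross ∧ s'.inc = s.inc ∧ (∀ j, s'.count j ≠ 0 → j ∈ l) ∧
      s'.steps + 2 * l.length = s.steps + 2 * s.touched.length) ?_ s.touched s
      ⟨rfl, rfl, rfl, rfl, rfl, hs, rfl⟩).mono ?_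
  · rintro v l s' ⟨h1, h2, h3, h4, h5, h6, h7⟩
    simp only [post_bind, post_tick, post_modify]
    rw [List.length_cons] at h7
    refine ⟨h1, h2, h3, h4, h5, fun j hj => ?_, by omega⟩
    rcases eq_or_ne j v with rfl | hjv
    · simp at hj
    · rw [Function.update_of_ne hjv] at hj
      exact (List.mem_cons.1 (h6 j hj)).resolve_left hjv
  · rintro _ s' ⟨h1, h2, h3, h4, h5, h6, h7⟩
    refine ⟨h1, h2, h3, h4, h5, fun j => ?_, trivial, ?_⟩
    · by_contra h
      exact absurd (h6 j h) (by simp)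
    · simp only [List.length_nil] at h7
      omega

theorem performWalks_post (i : Fin n) (l k : ℕ) :
    ∀ s : Memory n, (∀ j, s.count j ≠ 0 → j ∈ s.touched) →
    Post (performWalks G i l k) s fun _ s' => s'.even = s.even ∧ s'.odd = s.odd ∧
      s'.good = s.good ∧ s'.cross = s.cross ∧ s'.inc = s.inc ∧
      (∀ j, s'.count j ≠ 0 → j ∈ s'.touched) ∧
      s'.touched.length = s.touched.length + k ∧ s'.steps ≤ s.steps + k * (4 * l + 5) := by
  induction k with
  | zero =>
    intro s hs
    rw [performWalks, post_pure]
    exact ⟨rfl, rfl, rfl, rfl, rfl, hs, rfl, by omega⟩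
  | succ k ih =>
    intro s hs
    rw [performWalks]
    simp only [post_bind, post_tick]
    refine (walk_post G l i true _).mono ?_
    rintro e s' ⟨h1, h2⟩
    simp only [record, post_bind, post_tick, post_modify]
    refine (ih _ ?_).mono ?_
    · intro j hj
      rw [h1] at hj ⊢
      dsimp only at hj ⊢
      rcases eq_or_ne j e.1 with rfl | hje
      · exact List.mem_cons_self
      · rw [Function.update_of_ne hje] at hj
        exact List.mem_cons_of_mem _ (hs j hj)
    · rintro _ s'' ⟨b1, b2, b3, b4, b5, b6, b7, b8⟩
      dsimp only at h2 b8
      rw [h1] at b1 b2 b3 b4 b5 b7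
      refine ⟨b1, b2, b3, b4, b5, b6, ?_, ?_⟩
      · rw [b7, List.length_cons]; ring
      · have : (k + 1) * (4 * l + 5) = k * (4 * l + 5) + (4 * l + 5) := by ring
        omega

/-- The invariant between rounds. -/
structure LoopInv (Δ base : ℝ) (s : Memory n) : Prop where
  running : s.Running G
  disjoint : Disjoint s.even s.odd
  count_eq : ∀ j, s.count j = 0
  touched_eq : s.touched = []
  steps_le : (s.steps : ℝ) ≤ base + (8 * Δ + 1) * (s.even.card + s.odd.card)

/-- What is known after the walks of a round that began in `s`. -/
structure WalksInv (w l : ℕ) (s s' : Memory n) : Prop where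
  even_eq : s'.even = s.even
  odd_eq : s'.odd = s.odd
  running : s'.Running G
  count_ne : ∀ j, s'.count j ≠ 0 → j ∈ s'.touched
  length_eq : s'.touched.length = w
  steps_le : s'.steps ≤ s.steps + 8 + w * (4 * l + 5)

theorem walksInv_post {Δ base : ℝ} {s : Memory n} (h : LoopInv G Δ base s) (i : Fin n)
    (l w : ℕ) :
    Post (performWalks G i l w) { s with steps := s.steps + 2 + 6 }
      fun _ s' => WalksInv G w l s s' := by
  refine (performWalks_post G i l w _ ?_).mono ?_
  · intro j hj
    exact absurd (h.count_eq j) hj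
  · rintro _ s' ⟨b1, b2, b3, b4, b5, b6, b7, b8⟩
    dsimp only at b1 b2 b3 b4 b5 b7 b8
    refine ⟨b1, b2, ⟨?_, ?_, ?_⟩, b6, ?_, by omega⟩
    · rw [b1, b2, b3]; exact h.running.good_eq
    · rw [b1, b2, b4]; exact h.running.cross_eq
    · rw [b1, b2, b5]; exact h.running.inc_eq
    · rw [b7, h.touched_eq]; simp

/-- With respect to the estimates themselves the round is exact, hence tolerance `0`; a vertex that
no walk hit has estimate `0`. Each walk accounts for `4l + 5` steps when performed, `10` when
examined and `2` when cleared. -/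
theorem afterWalks_post {Δ base : ℝ} (hΔ : DegreeBound G Δ) {w l : ℕ} {t : ℝ} (ht : 0 ≤ t)
    {s s₁ : Memory n} (h : LoopInv G Δ base s) (h₁ : WalksInv G w l s s₁) :
    Post (afterWalks G w t) s₁ fun _ s' =>
      LoopInv G Δ (base + w * (4 * l + 17) + 9) s' ∧
      RoundStep (estimate G w s₁) 0 t s.even s.odd s'.even s'.odd := by
  rw [afterWalks]
  simp only [post_bind, post_get]
  refine (post_forM _ (ExamineInv G Δ w t s₁) (examine_post G hΔ) s₁.touched s₁ ?_).mono ?_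
  · refine ⟨h₁.running, rfl, rfl, ?_, subset_rfl, subset_rfl, fun j h h' => absurd h h',
      fun j h h' => absurd h h', fun j hj => Or.inl hj, by linarith⟩
    rw [h₁.even_eq, h₁.odd_eq]; exact h.disjoint
  · intro _ s₂ h₂
    refine (clearCounts_post (s := s₂) ?_).mono ?_
    · rw [h₂.count_eq, h₂.touched_eq]; exact h₁.count_ne
    · rintro _ s' ⟨c1, c2, c3, c4, c5, c6, c7, c8⟩
      refine ⟨⟨⟨?_, ?_, ?_⟩, ?_, c6, c7, ?_⟩, ⟨?_, ?_, ?_, ?_, ?_, ?_⟩⟩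
      · rw [c1, c2, c3]; exact h₂.running.good_eq
      · rw [c1, c2, c4]; exact h₂.running.cross_eq
      · rw [c1, c2, c5]; exact h₂.running.inc_eq
      · rw [c1, c2]; exact h₂.disjoint
      · have e1 := h₂.steps_le
        have e2 : (s₁.steps : ℝ) ≤ s.steps + 8 + w * (4 * l + 5) := by exact_mod_cast h₁.steps_le
        have e3 := h.steps_le
        rw [h₁.even_eq, h₁.odd_eq, h₁.length_eq] at e1
        rw [c8, c1, c2, h₂.touched_eq, h₁.length_eq]
        simp only [List.length_nil] at e1
        push_cast at e1 ⊢
        linarith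
      · rw [c1, ← h₁.even_eq]; exact h₂.even_subset
      · rw [c2, ← h₁.odd_eq]; exact h₂.odd_subset
      · rw [c1, c2]; exact h₂.disjoint
      · rw [c1, ← h₁.even_eq, sub_zero, one_mul]; exact h₂.even_le
      · rw [c2, ← h₁.odd_eq, sub_zero, one_mul]; exact h₂.odd_le
      · intro j hjE hjO
        rw [c1] at hjE
        rw [c2] at hjO
        rw [add_zero, one_mul]
        by_cases hj : s₁.count j = 0
        · rw [estimate, hj]; simpa using ht
        · rcases h₂.todo j (h₁.count_ne j hj) with h4 | h4 | h4 | h4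
          · simp at h4
          · exact absurd h4 hjE
          · exact absurd h4 hjO
          · exact h4

/-- Separates randomness from determinism: the exact round for the estimates becomes an approximate
round for the true values as soon as the estimates are accurate. -/
theorem RoundStep.of_estimate {e v : Fin n → ℝ} {γ t : ℝ} {E O E' O' : Finset (Fin n)}
    (h : RoundStep e 0 t E O E' O') (he : ∀ j, |e j - v j| ≤ γ * t) :
    RoundStep v γ t E O E' O' where
  even_subset := h.even_subset
  odd_subset := h.odd_subset
  disjoint := h.disjoint
  even_le j hj hj' := by
    have := h.even_le j hj hj'
    have := (_root_.abs_le.1 (he j)).2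
    linarith
  odd_le j hj hj' := by
    have := h.odd_le j hj hj'
    have := (_root_.abs_le.1 (he j)).1
    linarith
  abs_le j hj hj' := by
    have h1 := _root_.abs_le.1 (h.abs_le j hj hj')
    have h2 := _root_.abs_le.1 (he j)
    exact _root_.abs_le.2 ⟨by linarith, by linarith⟩

end Rounds

/-! ### The main loop -/

section Loop

variable {n : ℕ} (G : WeightedGraph n)

theorem LoopInv.add_steps {Δ base : ℝ} {s : Memory n} (h : LoopInv G Δ base s) (k : ℕ) :
    LoopInv G Δ (base + k) { s with steps := s.steps + k } :=
  ⟨⟨h.1.1, h.1.2, h.1.3⟩, h.2, h.3, h.4, by have := h.5; push_cast; linarith⟩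

theorem loopInv_init (Δ : ℝ) : LoopInv G Δ 0 (Memory.init n) := by
  refine ⟨⟨?_, ?_, ?_⟩, ?_, fun _ => rfl, rfl, ?_⟩ <;>
    simp [Memory.init, WeightedGraph.good, WeightedGraph.cross, WeightedGraph.inc,
      WeightedGraph.edgeWeight]

theorem card_le_real (A : Finset (Fin n)) : (A.card : ℝ) ≤ n := by
  exact_mod_cast (Finset.card_le_univ A).trans (by simp)

/-- The term in `LoopInv` proportional to the classified sets amortizes classification over all
rounds. The remaining cost per round is `4l + 17` per walk and `27` for bookkeeping; the second unit
beyond `8 Δ` per vertex pays for the output. -/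
theorem findLoop_post {P : Params} (hΔ : DegreeBound G P.Δ) (hΔ0 : 0 ≤ P.Δ) (hγ : P.γ ≤ 1)
    (i : Fin n) {W : ℝ} (k : ℕ) : ∀ (t base : ℝ) (s : Memory n), 0 ≤ t →
    LoopInv G P.Δ base s → (∀ q < k, (numWalks n P (t * (1 - P.γ) ^ q) : ℝ) ≤ W) →
    Post (findLoop G P i k t) s fun _ s' => (s'.steps : ℝ) ≤
      base + k * (W * (4 * walkLength P.ε P.μ P.δ G.vol + 17) + 27) +
        (8 * P.Δ + 2) * (2 * n) + 2 := by
  set l := walkLength P.ε P.μ P.δ G.vol with hl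
  have hcard : ∀ s : Memory n, (s.even.card + s.odd.card : ℝ) ≤ 2 * n := fun s => by
    linarith [card_le_real s.even, card_le_real s.odd]
  induction k with
  | zero =>
    intro t base s ht h hW
    rw [findLoop]
    simp only [post_bind, post_tick, post_pure]
    have h1 := h.steps_le
    have h2 := mul_le_mul_of_nonneg_left (hcard s) (by linarith : 0 ≤ 8 * P.Δ + 1)
    have : (0 : ℝ) ≤ n := Nat.cast_nonneg n
    push_cast
    linarith
  | succ k ih =>
    intro t base s ht h hW
    have hw : (numWalks n P t : ℝ) ≤ W := by simpa using hW 0 (by omega)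
    have hW0 : 0 ≤ W := (Nat.cast_nonneg _).trans hw
    rw [findLoop]
    simp only [post_bind, post_tick, threshold_eq]
    refine (walksInv_post G h i l _).mono fun _ s₁ h₁ => ?_
    refine (afterWalks_post G hΔ ht h h₁).mono ?_
    rintro _ s₂ ⟨h₂, -⟩
    have h₃ := h₂.add_steps G 16
    have hcost : (numWalks n P t : ℝ) * (4 * l + 17) ≤ W * (4 * l + 17) :=
      mul_le_mul_of_nonneg_right hw (by positivity)
    simp only [post_get]
    split_ifs with hacc
    · simp only [post_bind, post_tick, post_pure]
      have h4 := h₃.steps_le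
      have h5 := mul_le_mul_of_nonneg_left (hcard s₂) (by linarith : 0 ≤ 8 * P.Δ + 2)
      have h6 : 0 ≤ (k : ℝ) * (W * (4 * l + 17) + 27) := by positivity
      push_cast at h4 ⊢
      linarith
    · simp only [post_bind, post_tick]
      refine (ih (t * (1 - P.γ)) _ _ (mul_nonneg ht (by linarith)) (h₃.add_steps G 2)
        fun q hq => ?_).mono ?_
      · have := hW (q + 1) (by omega)
        rwa [pow_succ', ← mul_assoc] at this
      · intro _ s' hs'
        push_cast at hs' ⊢
        linarith

/-- The test of the even and odd sets, in terms of the graph. -/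
def Passes (P : Params) (t : ℝ) (A B : Finset (Fin n)) : Prop :=
  soto (sigma P.ε P.μ P.η) * G.inc A B ≤ G.cut A B ∧
    P.c / (P.Δ * t ^ 2 * G.vol ^ (1 + P.μ) * Real.log n) ≤ ((A.card + B.card : ℕ) : ℝ)

theorem accepts_iff {P : Params} {t : ℝ} {s : Memory n} (hs : s.Running G) :
    Accepts G P t s ↔ Passes G P t s.even s.odd := by
  rw [Accepts, Passes, WeightedGraph.cut, hs.good_eq, hs.cross_eq, hs.inc_eq]

/-- The number of steps paid for the round with threshold `t`, apart from classifications. -/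
def roundCost (P : Params) (t : ℝ) : ℝ :=
  numWalks n P t * (4 * walkLength P.ε P.μ P.δ G.vol + 17) + 27

/-- The search succeeded in round `r < R`, with a controlled number of steps. -/
def GoodOutcome (P : Params) (v : Fin n → ℝ) (R : ℕ)
    (o : Option (Finset (Fin n) × Finset (Fin n))) (steps : ℕ) : Prop :=
  ∃ r < R, ∃ A B : Finset (Fin n), o = some (A, B) ∧ Disjoint A B ∧
    Passes G P ((1 - P.γ) ^ r) A B ∧ (∀ j ∈ A ∪ B, (1 - P.γ) * (1 - P.γ) ^ r ≤ |v j|) ∧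
    (steps : ℝ) ≤ ∑ q ∈ Finset.range (r + 1), roundCost G P ((1 - P.γ) ^ q) +
      (8 * P.Δ + 2) * (A.card + B.card)

theorem Rounds.congr {v : Fin n → ℝ} {γ : ℝ} {r : ℕ} {E O E' O' : ℕ → Finset (Fin n)}
    (h : Rounds v γ r E O) (hE : ∀ q ≤ r, E' q = E q) (hO : ∀ q ≤ r, O' q = O q) :
    Rounds v γ r E' O' where
  even_zero := by rw [hE 0 (by omega), h.even_zero]
  odd_zero := by rw [hO 0 (by omega), h.odd_zero]
  step q hq := by
    rw [hE q (by omega), hO q (by omega), hE (q + 1) (by omega), hO (q + 1) (by omega)]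
    exact h.step q hq

theorem Rounds.le_abs {v : Fin n → ℝ} {γ : ℝ} {R : ℕ} {E O : ℕ → Finset (Fin n)}
    (h : Rounds v γ (R + 1) E O) (hγ0 : 0 ≤ γ) (hγ : γ ≤ 1) {j : Fin n}
    (hj : j ∈ E (R + 1) ∪ O (R + 1)) : (1 - γ) * (1 - γ) ^ R ≤ |v j| := by
  obtain ⟨ρ, hρ, hn, hm, -⟩ := h.exists_entry hj
  have hnE : j ∉ E ρ := fun h => hn (Finset.mem_union_left _ h)
  have hnO : j ∉ O ρ := fun h => hn (Finset.mem_union_right _ h)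
  have h1 : (1 - γ) ^ R ≤ (1 - γ) ^ ρ :=
    pow_le_pow_of_le_one (by linarith) (by linarith) (by omega)
  have h2 := mul_le_mul_of_nonneg_left h1 (by linarith : 0 ≤ 1 - γ)
  rcases Finset.mem_union.1 hm with hE | hO
  · exact h2.trans (((h.step ρ hρ).even_le j hE hnE).trans (le_abs_self _))
  · exact h2.trans (((h.step ρ hρ).odd_le j hO hnO).trans (neg_le_abs _))

open scoped ENNReal

theorem expect_le_one {α : Type} (x : Prog n α) (s : Memory n) {F : α → Memory n → ℝ≥0∞}
    (hF : ∀ a s', F a s' ≤ 1) : expect x s F ≤ 1 :=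
  (expect_mono' hF).trans (expect_const x s 1).le

-- Induction on the number of remaining rounds, keeping the history `E`, `O` of the classified sets.
-- Each round adds the probability that its estimates are bad. If all rounds have good estimates,
-- running out of rounds contradicts `hfin`, so no failure remains at the end.
open Classical in
theorem expect_findLoop {P : Params} (hn : 2 ≤ n) (hΔ : DegreeBound G P.Δ) (hγ0 : 0 < P.γ)
    (hγ : P.γ < 1) (hκ : 0 < P.κ) {i : Fin n}
    (hα : ProbBound G (walkLength P.ε P.μ P.δ G.vol) i P.α) {R : ℕ} {v : Fin n → ℝ}
    (hv : v = G.signedDensity (walkLength P.ε P.μ P.δ G.vol) i)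
    (hfin : ∀ E O : ℕ → Finset (Fin n), Rounds v P.γ R E O →
      ∃ r < R, Passes G P ((1 - P.γ) ^ r) (E (r + 1)) (O (r + 1))) (k : ℕ) :
    ∀ (r : ℕ) (s : Memory n) (E O : ℕ → Finset (Fin n)), r + k = R →
    LoopInv G P.Δ (∑ q ∈ Finset.range r, roundCost G P ((1 - P.γ) ^ q)) s →
    Rounds v P.γ r E O → E r = s.even → O r = s.odd →
    (∀ q < r, ¬ Passes G P ((1 - P.γ) ^ q) (E (q + 1)) (O (q + 1))) →
    expect (findLoop G P i k ((1 - P.γ) ^ r)) s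
      (fun o s' => if GoodOutcome G P v R o s'.steps then 0 else 1) ≤
      k * ENNReal.ofReal (2 * (n : ℝ) ^ (1 - P.κ * P.γ ^ 2 / 4)) := by
  set β := ENNReal.ofReal (2 * (n : ℝ) ^ (1 - P.κ * P.γ ^ 2 / 4)) with hβ
  induction k with
  | zero =>
    intro r s E O hr h hrd hE hO hno
    rw [add_zero] at hr
    subst hr
    obtain ⟨q, hq, hq'⟩ := hfin E O hrd
    exact absurd hq' (hno q hq)
  | succ k ih =>
    intro r s E O hr h hrd hE hO hno
    set t := (1 - P.γ) ^ r with ht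
    have ht0 : 0 < t := pow_pos (by linarith) r
    rw [findLoop]
    simp only [expect_bind, expect_tick, threshold_eq]
    set l := walkLength P.ε P.μ P.δ G.vol with hl
    set w := numWalks n P t with hw
    have hinner : ∀ (a : Unit) (s₁ : Memory n), WalksInv G w l s s₁ →
        expect (afterWalks G w t) s₁ (fun _ s' =>
          expect get { s' with steps := s'.steps + 16 } fun a s' =>
            expect (if Accepts G P t a then do
                tick (a.even.card + a.odd.card)
                pure (some (a.even, a.odd))
              else do
                tick 2
                findLoop G P i k (t * (1 - P.γ))) s'
            (fun o s' => if GoodOutcome G P v R o s'.steps then 0 else 1)) ≤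
        (if GoodEstimates G l i w (P.γ * t) s₁ then 0 else 1) + k * β := by
      intro _ s₁ h₁
      split_ifs with hgood
      · rw [zero_add]
        refine (expect_mono (afterWalks_post G hΔ ht0.le h h₁) (F' := fun _ _ => k * β) ?_).trans
          (expect_const _ _ _).le
        rintro _ s₂ ⟨h₂, hstep⟩
        have hstep' : RoundStep v P.γ t s.even s.odd s₂.even s₂.odd :=
          hstep.of_estimate (hv ▸ hgood)
        -- The sets after round `r` have index `r + 1`; earlier history is unchanged.
        set E' := Function.update E (r + 1) s₂.even with hE'
        set O' := Function.update O (r + 1) s₂.odd with hO'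
        have hEq : ∀ q ≤ r, E' q = E q := fun q hq => Function.update_of_ne (by omega) _ _
        have hOq : ∀ q ≤ r, O' q = O q := fun q hq => Function.update_of_ne (by omega) _ _
        have hE1 : E' (r + 1) = s₂.even := Function.update_self _ _ _
        have hO1 : O' (r + 1) = s₂.odd := Function.update_self _ _ _
        have hrd0 := hrd.congr hEq hOq
        have hrd' : Rounds v P.γ (r + 1) E' O' := by
          refine ⟨hrd0.even_zero, hrd0.odd_zero, fun q hq => ?_⟩
          rcases Nat.lt_succ_iff_lt_or_eq.1 hq with hq | rfl
          · exact hrd0.step q hq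
          · rw [hEq q le_rfl, hOq q le_rfl, hE, hO, hE1, hO1]; exact hstep'
        have h₃ := h₂.add_steps G 16
        simp only [expect_get]
        split_ifs with hacc
        · rw [accepts_iff G h₃.running] at hacc
          simp only [expect_bind, expect_tick, expect_pure]
          rw [if_pos]
          · exact zero_le
          · refine ⟨r, by omega, s₂.even, s₂.odd, rfl, h₂.disjoint, hacc, fun j hj => ?_, ?_⟩
            · exact hrd'.le_abs hγ0.le hγ.le (by rw [hE1, hO1]; exact hj)
            · have h4 := h₃.steps_le
              rw [Finset.sum_range_succ, ← ht, roundCost]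
              push_cast at h4 ⊢
              linarith
        · rw [accepts_iff G h₃.running] at hacc
          simp only [expect_bind, expect_tick]
          rw [ht, ← pow_succ]
          have h₄ := h₃.add_steps G 2
          refine ih (r + 1) _ E' O' (by omega) ?_ hrd' hE1 hO1 fun q hq => ?_
          · refine ⟨h₄.1, h₄.2, h₄.3, h₄.4, ?_⟩
            have h5 := h₄.steps_le
            rw [Finset.sum_range_succ, ← ht, roundCost]
            push_cast at h5 ⊢
            linarith
          · rcases Nat.lt_succ_iff_lt_or_eq.1 hq with hq | rfl
            · rw [hEq (q + 1) (by omega), hOq (q + 1) (by omega)]; exact hno q hq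
            · rw [hE1, hO1]; exact hacc
      · refine le_trans (expect_le_one _ _ fun _ _ => expect_le_one _ _ fun _ _ =>
          expect_le_one _ _ fun _ _ => ?_) le_self_add
        split_ifs
        · exact zero_le
        · exact le_rfl
    refine (expect_mono (walksInv_post G h i l w) hinner).trans ?_
    rw [expect_add, expect_const]
    have h1 := expect_not_goodEstimates G (t := t) hα hγ0 hγ.le hκ ht0 hn
      (s := { s with steps := s.steps + 2 + 6 }) h.count_eq
    push_cast
    rw [add_mul, one_mul, add_comm]
    exact add_le_add le_rfl h1

end Loop


/-! ### Numerical bounds -/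

section Numerics

variable {n : ℕ} (G : WeightedGraph n)

theorem WeightedGraph.two_le (G : WeightedGraph n) (hn : 0 < n) : 2 ≤ n := by
  obtain ⟨k, hk⟩ := G.no_isolated ⟨0, hn⟩
  by_contra! h
  have : k = ⟨0, hn⟩ := Fin.ext (by have := k.2; simp only; omega)
  exact hk (this ▸ G.loopless _)

theorem WeightedGraph.card_le_vol : (n : ℝ) ≤ G.vol := by
  have := Finset.sum_le_sum fun j (_ : j ∈ Finset.univ) => G.one_le_deg j
  simpa [WeightedGraph.vol] using this

theorem half_le_log {x : ℝ} (hx : 2 ≤ x) : 1 / 2 ≤ Real.log x := by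
  have := Real.log_two_gt_d9
  have := Real.log_le_log two_pos hx
  linarith

/-- The end probabilities sum to `1` and each is at most `α d_j`. It makes `α` positive and lets `α
m` absorb lower-order terms. -/
theorem one_le_mul_vol {l : ℕ} {i : Fin n} {α : ℝ} (hα : ProbBound G l i α) :
    1 ≤ α * G.vol := by
  rw [← sum_walkProb G l i, WeightedGraph.vol, Finset.mul_sum]
  refine Finset.sum_le_sum fun j _ => ?_
  have := hα j
  rwa [div_le_iff₀ (G.deg_pos j)] at this

theorem abs_signedDensity_le (l : ℕ) (i j : Fin n) :
    |G.signedDensity l i j| ≤ G.walkProb l i j / G.deg j := by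
  rw [WeightedGraph.signedDensity, abs_div, abs_of_pos (G.deg_pos j)]
  exact div_le_div_of_nonneg_right (abs_signedProb_le G l i j) (G.deg_pos j).le

theorem abs_signedDensity_le_one (l : ℕ) (i j : Fin n) : |G.signedDensity l i j| ≤ 1 := by
  refine (abs_signedDensity_le G l i j).trans ?_
  rw [div_le_one (G.deg_pos j)]
  exact (walkProb_le_one G l i j).trans (G.one_le_deg j)

theorem walkLength_le {ε μ δ m : ℝ} (hε0 : 0 ≤ ε) (hε1 : ε < 1) (hμ : 0 < μ) (hδ : 0 < δ)
    (hm : 2 ≤ m) : (walkLength ε μ δ m : ℝ) ≤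
      (μ * (1 + 2 * |Real.log (4 / δ ^ 2)|) / (2 * δ) + 2) * Real.log m := by
  have hL := half_le_log hm
  set L := Real.log m
  set a := Real.log (4 / δ ^ 2)
  have he : 0 ≤ -Real.log (1 - ε) := by
    rw [neg_nonneg]; exact Real.log_nonpos (by linarith) (by linarith)
  have h1 : μ * Real.log (4 * m / δ ^ 2) / (2 * (δ + -Real.log (1 - ε))) ≤
      μ * (L + |a|) / (2 * δ) := by
    have h2 : Real.log (4 * m / δ ^ 2) = L + a := by
      rw [mul_comm, mul_div_assoc, Real.log_mul (by positivity) (by positivity)]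
    have h3 : 0 ≤ L + |a| := by positivity
    rw [h2]
    exact div_le_div₀ (by positivity) (mul_le_mul_of_nonneg_left
      (by linarith [le_abs_self a]) hμ.le) (by positivity) (by linarith)
  have h4 : (walkLength ε μ δ m : ℝ) < μ * (L + |a|) / (2 * δ) + 1 :=
    lt_of_le_of_lt (Nat.cast_le.2 (Nat.ceil_mono h1)) (Nat.ceil_lt_add_one (by positivity))
  have h5 : μ * (L + |a|) / (2 * δ) ≤ μ * (1 + 2 * |a|) / (2 * δ) * L := by
    rw [div_mul_eq_mul_div, mul_assoc]
    refine div_le_div_of_nonneg_right (mul_le_mul_of_nonneg_left ?_ hμ.le) (by positivity)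
    nlinarith [abs_nonneg a]
  linarith

theorem numRounds_spec {m : ℝ} {P : Params} (hγ0 : 0 < P.γ) (hγ1 : P.γ < 1) (hm : 2 ≤ m) :
    (1 - P.γ) ^ numRounds m P < P.γ / m ^ (1 + P.μ / 2) := by
  have hne : {r : ℕ | (1 - P.γ) ^ r < P.γ / m ^ (1 + P.μ / 2)}.Nonempty :=
    exists_pow_lt_of_lt_one (div_pos hγ0 (Real.rpow_pos_of_pos (by linarith) _)) (by linarith)
  exact Nat.sInf_mem hne

theorem le_pow_of_lt_numRounds {m : ℝ} {P : Params} {q : ℕ} (hq : q < numRounds m P) :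
    P.γ / m ^ (1 + P.μ / 2) ≤ (1 - P.γ) ^ q :=
  not_lt.1 (Nat.notMem_of_lt_sInf hq)

theorem numRounds_pos {m : ℝ} {P : Params} (hγ0 : 0 < P.γ) (hγ1 : P.γ < 1) (hμ : 0 < P.μ)
    (hm : 2 ≤ m) : 0 < numRounds m P := by
  by_contra! h
  have h1 := numRounds_spec hγ0 hγ1 hm
  rw [Nat.le_zero.1 h, pow_zero, lt_div_iff₀ (Real.rpow_pos_of_pos (by linarith) _)] at h1
  have := Real.one_le_rpow (by linarith : 1 ≤ m) (by linarith : 0 ≤ 1 + P.μ / 2)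
  linarith

/-- The last used threshold is still at least `γ / m^(1+μ/2)`, while `(1 - γ)^r ≤ e^(-γ r)`.
Constants are absorbed using `1/2 ≤ log m`. -/
theorem numRounds_le {m : ℝ} {P : Params} (hγ0 : 0 < P.γ) (hγ1 : P.γ < 1) (hμ : 0 < P.μ)
    (hm : 2 ≤ m) : (numRounds m P : ℝ) ≤
      (2 + (1 + P.μ / 2 + 2 * -Real.log P.γ) / P.γ) * Real.log m := by
  have hL := half_le_log hm
  have hpos := numRounds_pos hγ0 hγ1 hμ hm
  have hlogγ : 0 ≤ -Real.log P.γ := by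
    rw [neg_nonneg]; exact Real.log_nonpos hγ0.le hγ1.le
  obtain ⟨R, hR⟩ : ∃ R, numRounds m P = R + 1 := ⟨numRounds m P - 1, by omega⟩
  have h1 := le_pow_of_lt_numRounds (m := m) (P := P) (q := R) (by omega)
  have hmp : 0 < m ^ (1 + P.μ / 2) := Real.rpow_pos_of_pos (by linarith) _
  have h2 : (1 - P.γ) ^ R ≤ Real.exp (-(P.γ * R)) := by
    have : 1 - P.γ ≤ Real.exp (-P.γ) := by linarith [Real.add_one_le_exp (-P.γ)]
    refine (pow_le_pow_left₀ (by linarith) this R).trans (le_of_eq ?_)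
    rw [← Real.exp_nat_mul]; ring_nf
  have h3 := Real.log_le_log (by positivity) (h1.trans h2)
  rw [Real.log_exp, Real.log_div hγ0.ne' hmp.ne', Real.log_rpow (by linarith)] at h3
  have h4 : (R : ℝ) ≤ ((1 + P.μ / 2) * Real.log m + -Real.log P.γ) / P.γ := by
    rw [le_div_iff₀ hγ0]; linarith
  have h5 : ((1 + P.μ / 2) * Real.log m + -Real.log P.γ) / P.γ ≤
      (1 + P.μ / 2 + 2 * -Real.log P.γ) / P.γ * Real.log m := by
    rw [div_mul_eq_mul_div]
    refine div_le_div_of_nonneg_right ?_ hγ0.le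
    nlinarith
  rw [hR]
  push_cast
  linarith

theorem numWalks_le {P : Params} (hκ : 0 < P.κ) (hn : 2 ≤ n) (hα : 0 < P.α) {t u : ℝ}
    (ht : 0 < t) (htu : t ≤ u) :
    (numWalks n P u : ℝ) ≤ P.κ * Real.log n * (P.α / t ^ 2 + 1 / t) + 1 := by
  have hlog : 0 < Real.log n := Real.log_pos (by exact_mod_cast hn)
  have hu : 0 < u := ht.trans_le htu
  have h1 : (numWalks n P u : ℝ) < P.κ * Real.log n * max P.α u / u ^ 2 + 1 :=
    Nat.ceil_lt_add_one (by positivity)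
  have h2 : max P.α u / u ^ 2 ≤ P.α / t ^ 2 + 1 / t := by
    have h3 : max P.α u ≤ P.α + u := max_le (by linarith) (by linarith)
    have h4 : (P.α + u) / u ^ 2 = P.α / u ^ 2 + 1 / u := by field_simp
    calc _ ≤ (P.α + u) / u ^ 2 := div_le_div_of_nonneg_right h3 (by positivity)
      _ = P.α / u ^ 2 + 1 / u := h4
      _ ≤ _ := by gcongr
  have h5 := mul_le_mul_of_nonneg_left h2 (by positivity : 0 ≤ P.κ * Real.log n)
  rw [← mul_div_assoc] at h5
  linarith

/-- The constant in the bound for the number of rounds. -/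
def roundsConst (γ μ : ℝ) : ℝ := 2 + (1 + μ / 2 + 2 * -Real.log γ) / γ

/-- The constant in the bound for the walk length. -/
def lengthConst (μ δ : ℝ) : ℝ := μ * (1 + 2 * |Real.log (4 / δ ^ 2)|) / (2 * δ) + 2

theorem roundsConst_pos {γ μ : ℝ} (hγ0 : 0 < γ) (hγ1 : γ < 1) (hμ : 0 < μ) :
    0 < roundsConst γ μ := by
  have hlogγ : 0 ≤ -Real.log γ := by
    rw [neg_nonneg]; exact Real.log_nonpos hγ0.le hγ1.le
  unfold roundsConst; positivity

theorem lengthConst_pos {μ δ : ℝ} (hμ : 0 < μ) (hδ : 0 < δ) : 0 < lengthConst μ δ := by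
  unfold lengthConst; positivity

-- At the smallest threshold `α / t²` is of order `α m^(2+μ)`; the term `1 / t`, of order
-- `m^(1+μ/2)`, and the trivial costs are smaller because `α m ≥ 1`.
set_option maxHeartbeats 1000000 in
theorem find_steps_le {ε μ η δ γ κ c : ℝ} (hε0 : 0 ≤ ε) (hε1 : ε < 1) (hμ : 0 < μ)
    (hδ : 0 < δ) (hγ0 : 0 < γ) (hγ1 : γ < 1) (hκ : 0 < κ) {Δ : ℝ} {i : Fin n} {α : ℝ}
    (hΔ : DegreeBound G Δ) (hα : ProbBound G (walkLength ε μ δ G.vol) i α)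
    {o : Option (Finset (Fin n) × Finset (Fin n)) × ℕ}
    (ho : o ∈ (find G
      { ε := ε, μ := μ, η := η, δ := δ, γ := γ, κ := κ, c := c, Δ := Δ, α := α } i).support) :
    (o.2 : ℝ) ≤ (roundsConst γ μ * ((κ * (1 / γ ^ 2 + 1 / γ) + 2) *
      (4 * lengthConst μ δ + 34) + 108) + 176) * Real.log G.vol ^ 3 *
        (α * Δ * G.vol ^ (2 + μ)) := by
  set P : Params := { ε := ε, μ := μ, η := η, δ := δ, γ := γ, κ := κ, c := c, Δ := Δ, α := α }
  have hn0 : 0 < n := i.pos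
  have hn := G.two_le hn0
  have hnm := G.card_le_vol
  have hn2 : (2 : ℝ) ≤ n := by exact_mod_cast hn
  set m := G.vol with hm
  have hm2 : 2 ≤ m := by linarith
  have hm0 : 0 < m := by linarith
  have hΔ1 : 1 ≤ Δ := (G.one_le_deg i).trans (hΔ i)
  have hαm : 1 ≤ α * m := one_le_mul_vol G hα
  have hα0 : 0 < α := pos_of_mul_pos_left (by linarith) hm0.le
  set L := Real.log m with hL
  have hL2 : 1 / 2 ≤ L := half_le_log hm2
  set R := numRounds m P with hR
  set l := walkLength ε μ δ m with hl
  have hRle : (R : ℝ) ≤ roundsConst γ μ * L := numRounds_le (P := P) hγ0 hγ1 hμ hm2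
  have hlle : (l : ℝ) ≤ lengthConst μ δ * L := walkLength_le hε0 hε1 hμ hδ hm2
  set t := γ / m ^ (1 + μ / 2) with ht
  have hmp : 0 < m ^ (1 + μ / 2) := Real.rpow_pos_of_pos hm0 _
  have ht0 : 0 < t := by positivity
  set Z := α * m ^ (2 + μ) with hZ
  have hZm : m ≤ Z := by
    have h1 : m ^ (2 + μ) = m * m ^ (1 + μ) := by
      rw [← Real.rpow_one_add' hm0.le (by linarith)]; ring_nf
    have h2 : m ≤ m ^ (1 + μ) := by
      nth_rewrite 1 [← Real.rpow_one m]
      exact Real.rpow_le_rpow_of_exponent_le (by linarith) (by linarith)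
    calc m ≤ m ^ (1 + μ) := h2
      _ ≤ (α * m) * m ^ (1 + μ) := le_mul_of_one_le_left (by positivity) hαm
      _ = Z := by rw [hZ, h1]; ring
  have hZ1 : 1 ≤ Z := by linarith
  have hwz : α / t ^ 2 + 1 / t ≤ (1 / γ ^ 2 + 1 / γ) * Z := by
    have h1 : (m ^ (1 + μ / 2)) ^ 2 = m ^ (2 + μ) := by
      rw [← Real.rpow_natCast, ← Real.rpow_mul hm0.le]; congr 1; push_cast; ring
    have h2 : α / t ^ 2 = 1 / γ ^ 2 * Z := by
      rw [ht, div_pow, h1]; field_simp; rw [hZ]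
    have h3 : m ^ (1 + μ / 2) ≤ Z := by
      have h4 : m ^ (2 + μ) = m * m ^ (1 + μ) := by
        rw [← Real.rpow_one_add' hm0.le (by linarith)]; ring_nf
      have h5 : m ^ (1 + μ / 2) ≤ m ^ (1 + μ) :=
        Real.rpow_le_rpow_of_exponent_le (by linarith) (by linarith)
      calc _ ≤ m ^ (1 + μ) := h5
        _ ≤ (α * m) * m ^ (1 + μ) := le_mul_of_one_le_left (by positivity) hαm
        _ = Z := by rw [hZ, h4]; ring
    have h4 : 1 / t = 1 / γ * m ^ (1 + μ / 2) := by rw [ht]; field_simp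
    rw [h2, h4, add_mul]
    gcongr
  have hlogn : 0 < Real.log n := Real.log_pos (by linarith)
  have hlognL : Real.log n ≤ L := Real.log_le_log (by linarith) hnm
  set g := 1 / γ ^ 2 + 1 / γ with hg
  have hg0 : 0 < g := by positivity
  set W := (κ * g + 2) * (L * Z) with hW
  have hLZ : 1 ≤ 2 * (L * Z) := by nlinarith
  have hWle : ∀ q < R, (numWalks n P (1 * (1 - P.γ) ^ q) : ℝ) ≤ W := fun q hq => by
    rw [one_mul]
    refine (numWalks_le (P := P) hκ hn hα0 ht0 (le_pow_of_lt_numRounds hq)).trans ?_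
    have h1 : κ * Real.log n * (α / t ^ 2 + 1 / t) ≤ κ * L * (g * Z) := by gcongr
    change κ * Real.log n * (α / t ^ 2 + 1 / t) + 1 ≤ W
    calc _ ≤ κ * L * (g * Z) + 2 * (L * Z) := add_le_add h1 hLZ
      _ = W := by rw [hW]; ring
  obtain ⟨x, hx, rfl⟩ := (PMF.mem_support_map_iff _ _ _).1 ho
  have hsteps := findLoop_post G (P := P) hΔ (by linarith : (0 : ℝ) ≤ Δ) hγ1.le i R 1 0
    (Memory.init n) zero_le_one (loopInv_init G Δ) hWle x hx
  change (x.2.steps : ℝ) ≤ 0 + R * (W * (4 * l + 17) + 27) + (8 * Δ + 2) * (2 * n) + 2 at hsteps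
  refine hsteps.trans ?_
  have hl17 : (4 * l + 17 : ℝ) ≤ (4 * lengthConst μ δ + 34) * L := by linarith
  have hlc := lengthConst_pos hμ hδ
  have hrc := roundsConst_pos hγ0 hγ1 hμ
  have hL4 : 1 ≤ 4 * L ^ 2 := by nlinarith
  have hL8 : 1 ≤ 8 * L ^ 3 := by
    have := one_le_mul_of_one_le_of_one_le hL4 (by linarith : 1 ≤ 2 * L)
    linarith [show 4 * L ^ 2 * (2 * L) = 8 * L ^ 3 by ring]
  have h27 : (27 : ℝ) ≤ 108 * (L ^ 2 * Z) := by
    have : 1 * 1 ≤ 4 * L ^ 2 * Z := mul_le_mul hL4 hZ1 zero_le_one (by positivity)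
    linarith
  have h1 : R * (W * (4 * l + 17) + 27) ≤ roundsConst γ μ * L *
      ((κ * g + 2) * (L * Z) * ((4 * lengthConst μ δ + 34) * L) + 108 * (L ^ 2 * Z)) := by
    gcongr
  have h2 : (8 * Δ + 2) * (2 * n) + 2 ≤ 22 * (Δ * Z) := by
    have h5 : Δ * n ≤ Δ * Z := by gcongr; linarith
    have h6 : (n : ℝ) ≤ Δ * n := le_mul_of_one_le_left (by linarith) hΔ1
    linarith
  have h3 : 22 * (Δ * Z) ≤ 176 * L ^ 3 * (Δ * Z) := by
    have := mul_le_mul_of_nonneg_right hL8 (by positivity : 0 ≤ 22 * (Δ * Z))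
    linarith
  have h4 : roundsConst γ μ * L *
      ((κ * g + 2) * (L * Z) * ((4 * lengthConst μ δ + 34) * L) + 108 * (L ^ 2 * Z)) ≤
      roundsConst γ μ * ((κ * g + 2) * (4 * lengthConst μ δ + 34) + 108) * L ^ 3 * (Δ * Z) := by
    have h5 : Z ≤ Δ * Z := le_mul_of_one_le_left (by linarith) hΔ1
    calc _ = roundsConst γ μ * ((κ * g + 2) * (4 * lengthConst μ δ + 34) + 108) * L ^ 3 * Z := by
          ring
      _ ≤ _ := by gcongr
  have h5 : α * Δ * m ^ (2 + μ) = Δ * Z := by rw [hZ]; ring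
  rw [h5]
  linarith

-- Every round up to the accepting one costs at most about `α / t²` with the final threshold `t`,
-- and the size test bounds `1 / t²` by a multiple of `Δ m^(1+μ) ln n` times the output size. The
-- bound therefore holds without the summand `1 / α`, which is added only at the end.
set_option maxHeartbeats 1000000 in
theorem GoodOutcome.ratio_le {ε μ η δ γ κ c : ℝ} (hε0 : 0 ≤ ε) (hε1 : ε < 1) (hμ : 0 < μ)
    (hδ : 0 < δ) (hγ0 : 0 < γ) (hγ1 : γ ≤ 1 / 2) (hκ : 0 < κ) (hc : 0 < c) {Δ : ℝ} {i : Fin n}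
    {α : ℝ} (hΔ : DegreeBound G Δ) (hα : ProbBound G (walkLength ε μ δ G.vol) i α)
    {P : Params} (hP : P =
      { ε := ε, μ := μ, η := η, δ := δ, γ := γ, κ := κ, c := c, Δ := Δ, α := α })
    {o : Option (Finset (Fin n) × Finset (Fin n))} {steps : ℕ}
    (h : GoodOutcome G P (G.signedDensity (walkLength ε μ δ G.vol) i)
      (numRounds G.vol P) o steps) :
    ∃ A B : Finset (Fin n), o = some (A, B) ∧ Disjoint A B ∧ (A ∪ B).Nonempty ∧
      soto (sigma ε μ η) * G.inc A B ≤ G.cut A B ∧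
      (steps : ℝ) / ((A ∪ B).card : ℝ) ≤
        (roundsConst γ μ * ((4 * lengthConst μ δ + 34) * (3 * κ) / c +
          4 * (4 * lengthConst μ δ + 88)) + 160) * Real.log G.vol ^ 4 *
          (α * Δ * G.vol ^ (1 + μ) + 1 / α) := by
  have hn0 : 0 < n := i.pos
  have hn := G.two_le hn0
  have hnm := G.card_le_vol
  have hn2 : (2 : ℝ) ≤ n := by exact_mod_cast hn
  set m := G.vol with hm
  have hm2 : 2 ≤ m := by linarith
  have hm0 : 0 < m := by linarith
  have hΔ1 : 1 ≤ Δ := (G.one_le_deg i).trans (hΔ i)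
  have hαm : 1 ≤ α * m := one_le_mul_vol G hα
  have hα0 : 0 < α := pos_of_mul_pos_left (by linarith) hm0.le
  set L := Real.log m with hL
  have hL2 : 1 / 2 ≤ L := half_le_log hm2
  set R := numRounds m P with hR
  set l := walkLength ε μ δ m with hl
  have hRle : (R : ℝ) ≤ roundsConst γ μ * L := by
    have := numRounds_le (m := m) (P := P) (by rw [hP]; exact hγ0) (by rw [hP]; dsimp only; linarith)
      (by rw [hP]; exact hμ) hm2
    rw [hP] at this
    rw [hR, hP]
    exact this
  have hlle : (l : ℝ) ≤ lengthConst μ δ * L := walkLength_le hε0 hε1 hμ hδ hm2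
  have hlogn : 0 < Real.log n := Real.log_pos (by linarith)
  have hlognL : Real.log n ≤ L := Real.log_le_log (by linarith) hnm
  have hlc := lengthConst_pos hμ hδ
  have hrc := roundsConst_pos hγ0 (by linarith) hμ
  obtain ⟨r, hr, A, B, ho, hd, ⟨hcut, hsize⟩, hval, hst⟩ := h
  rw [hP] at hcut hsize hval hst
  dsimp only at hcut hsize hval hst
  set t := (1 - γ) ^ r with ht
  have ht0 : 0 < t := pow_pos (by linarith) r
  set M := m ^ (1 + μ) with hM
  have hM0 : 0 < M := Real.rpow_pos_of_pos hm0 _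
  have hSpos : (0 : ℝ) < ((A.card + B.card : ℕ) : ℝ) := lt_of_lt_of_le (by positivity) hsize
  have hcard : (A ∪ B).card = A.card + B.card := Finset.card_union_of_disjoint hd
  have hne : (A ∪ B).Nonempty := by
    rw [← Finset.card_pos, hcard]; exact_mod_cast hSpos
  refine ⟨A, B, ho, hd, hne, hcut, ?_⟩
  rw [hcard]
  have hScast : (A.card + B.card : ℝ) = ((A.card + B.card : ℕ) : ℝ) := by push_cast; rfl
  rw [hScast] at hst
  have hS1 : (1 : ℝ) ≤ ((A.card + B.card : ℕ) : ℝ) := by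
    exact_mod_cast (Nat.cast_pos.1 hSpos : 0 < A.card + B.card)
  set S : ℝ := ((A.card + B.card : ℕ) : ℝ) with hS
  -- A nonempty output contains a vertex with `(1 - γ) t ≤ |v j| ≤ α`, so the maximum of `α` and `t`
  -- is comparable to `α`.
  have htα : t ≤ 2 * α := by
    obtain ⟨j, hj⟩ := hne
    have h1 := hval j hj
    have h2 := (abs_signedDensity_le G l i j).trans (hα j)
    nlinarith
  set Y := α * Δ * M with hY
  have hMm : m ≤ M := by
    nth_rewrite 1 [← Real.rpow_one m]
    exact Real.rpow_le_rpow_of_exponent_le (by linarith) (by linarith)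
  have hYΔ : Δ ≤ Y := by
    have h1 : 1 ≤ α * M := hαm.trans (mul_le_mul_of_nonneg_left hMm hα0.le)
    calc Δ ≤ Δ * (α * M) := le_mul_of_one_le_right (by linarith) h1
      _ = Y := by rw [hY]; ring
  have hY1 : 1 ≤ Y := hΔ1.trans hYΔ
  have hcost : ∀ q ∈ Finset.range (r + 1), roundCost G P ((1 - γ) ^ q) ≤
      (κ * L * (3 * α / t ^ 2) + 1) * (4 * l + 17) + 27 := by
    intro q hq
    have htq : t ≤ (1 - γ) ^ q :=
      pow_le_pow_of_le_one (by linarith) (by linarith) (by simpa using Finset.mem_range.1 hq)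
    have h1 := numWalks_le (P := P) (by rw [hP]; exact hκ) hn (by rw [hP]; exact hα0) ht0 htq
    rw [roundCost]
    rw [hP] at h1 ⊢
    dsimp only at h1 ⊢
    have h2 : α / t ^ 2 + 1 / t ≤ 3 * α / t ^ 2 := by
      have h3 : 1 / t = t / t ^ 2 := by field_simp
      rw [h3, ← add_div]
      exact div_le_div_of_nonneg_right (by linarith) (by positivity)
    have h4 : κ * Real.log n * (α / t ^ 2 + 1 / t) ≤ κ * L * (3 * α / t ^ 2) := by gcongr
    rw [← hm, ← hl]
    gcongr
    linarith
  have hsum := Finset.sum_le_card_nsmul _ _ _ hcost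
  rw [Finset.card_range, nsmul_eq_mul] at hsum
  have hrR : ((r + 1 : ℕ) : ℝ) ≤ roundsConst γ μ * L := (Nat.cast_le.2 hr).trans hRle
  have hinv : 1 / t ^ 2 ≤ S * (Δ * M * L) / c := by
    rw [div_le_div_iff₀ (by positivity) hc]
    rw [div_le_iff₀ (by positivity)] at hsize
    have : S * (Δ * t ^ 2 * M * Real.log n) ≤ S * (Δ * t ^ 2 * M * L) := by gcongr
    linarith
  have hl17 : (4 * l + 17 : ℝ) ≤ (4 * lengthConst μ δ + 34) * L := by linarith
  have hl44 : (4 * l + 44 : ℝ) ≤ (4 * lengthConst μ δ + 88) * L := by linarith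
  have hL4 : 1 ≤ 4 * L ^ 2 := by nlinarith
  have hcostS : (κ * L * (3 * α / t ^ 2) + 1) * (4 * l + 17) + 27 ≤
      ((4 * lengthConst μ δ + 34) * (3 * κ) / c + 4 * (4 * lengthConst μ δ + 88)) *
        L ^ 3 * Y * S := by
    have e1 : κ * L * (3 * α / t ^ 2) ≤ 3 * κ / c * L ^ 2 * Y * S := by
      calc κ * L * (3 * α / t ^ 2) = 3 * κ * L * α * (1 / t ^ 2) := by ring
        _ ≤ 3 * κ * L * α * (S * (Δ * M * L) / c) := by gcongr
        _ = _ := by rw [hY]; ring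
    have e2 : (4 * l + 44 : ℝ) ≤ (4 * lengthConst μ δ + 88) * L * (4 * L ^ 2 * (Y * S)) := by
      refine hl44.trans (le_mul_of_one_le_right (by positivity) ?_)
      have : 1 ≤ Y * S := one_le_mul_of_one_le_of_one_le hY1 hS1
      exact one_le_mul_of_one_le_of_one_le hL4 this
    have e3 : κ * L * (3 * α / t ^ 2) * (4 * l + 17) ≤
        3 * κ / c * L ^ 2 * Y * S * ((4 * lengthConst μ δ + 34) * L) := by gcongr
    calc _ = κ * L * (3 * α / t ^ 2) * (4 * l + 17) + (4 * l + 44) := by ring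
      _ ≤ _ := add_le_add e3 e2
      _ = _ := by ring
  have htotal : (steps : ℝ) ≤ roundsConst γ μ * L *
      (((4 * lengthConst μ δ + 34) * (3 * κ) / c + 4 * (4 * lengthConst μ δ + 88)) *
        L ^ 3 * Y * S) + 160 * L ^ 4 * Y * S := by
    have e1 : ∑ q ∈ Finset.range (r + 1), roundCost G P ((1 - γ) ^ q) ≤
        roundsConst γ μ * L *
        (((4 * lengthConst μ δ + 34) * (3 * κ) / c + 4 * (4 * lengthConst μ δ + 88)) *
        L ^ 3 * Y * S) := by
      refine hsum.trans (mul_le_mul hrR hcostS (by positivity) (by positivity))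
    have e2 : (8 * Δ + 2) * S ≤ 160 * L ^ 4 * Y * S := by
      refine mul_le_mul_of_nonneg_right ?_ hSpos.le
      have e3 : 1 ≤ 16 * L ^ 4 := by
        have := one_le_mul_of_one_le_of_one_le hL4 hL4
        linarith [show 4 * L ^ 2 * (4 * L ^ 2) = 16 * L ^ 4 by ring]
      have e4 := mul_le_mul_of_nonneg_right e3 (by positivity : 0 ≤ 10 * Y)
      linarith
    rw [hP] at e1
    linarith
  rw [div_le_iff₀ hSpos]
  refine htotal.trans ?_
  set K := roundsConst γ μ * ((4 * lengthConst μ δ + 34) * (3 * κ) / c +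
          4 * (4 * lengthConst μ δ + 88)) + 160 with hK
  have hK0 : 0 < K := by positivity
  have e5 : K * L ^ 4 * Y ≤ K * L ^ 4 * (Y + 1 / α) :=
    mul_le_mul_of_nonneg_left (by have : 0 < 1 / α := by positivity
                                  linarith) (by positivity)
  calc _ = K * L ^ 4 * Y * S := by rw [hK]; ring
    _ ≤ _ := mul_le_mul_of_nonneg_right e5 hSpos.le

/-- The exponent is at most `-1 - X`: the factor `n^(-1)` beats the logarithm in the number of
rounds, and `n^(-X) ≤ 1 / (1 + X/2)` beats the constant. -/
theorem failure_le {κ γ Kr A : ℝ} (hn : 2 ≤ n) (hKr : 0 ≤ Kr) (hA : 0 ≤ A) (hγ : 0 < γ)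
    (hκ : 4 * (2 + 8 * Kr * A) / γ ^ 2 ≤ κ) {R : ℝ}
    (hR : R ≤ Kr * (A * Real.log n)) :
    R * (2 * (n : ℝ) ^ (1 - κ * γ ^ 2 / 4)) ≤ 1 / 2 := by
  have hn2 : (2 : ℝ) ≤ n := by exact_mod_cast hn
  have hL := half_le_log hn2
  have hLn : Real.log n ≤ n := (Real.log_le_sub_one_of_pos (by linarith)).trans (by linarith)
  rw [div_le_iff₀ (by positivity)] at hκ
  set X := 8 * Kr * A with hX
  have hX0 : 0 ≤ X := by positivity
  have h1 : (n : ℝ) ^ (1 - κ * γ ^ 2 / 4) ≤ (n : ℝ) ^ (-1 + -X) :=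
    Real.rpow_le_rpow_of_exponent_le (by linarith) (by linarith)
  have h2 : (n : ℝ) ^ (-1 + -X) = (n : ℝ)⁻¹ * (n : ℝ) ^ (-X) := by
    rw [Real.rpow_add (by linarith), Real.rpow_neg_one]
  have h3 : (n : ℝ) ^ (-X) ≤ 1 / (1 + X / 2) := by
    rw [Real.rpow_def_of_pos (by linarith), mul_neg, Real.exp_neg, ← one_div]
    refine one_div_le_one_div_of_le (by positivity) ?_
    have := Real.add_one_le_exp (Real.log n * X)
    nlinarith
  have h4 : R ≤ Kr * A * n := by
    refine hR.trans ?_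
    rw [mul_assoc]
    gcongr
  calc R * (2 * (n : ℝ) ^ (1 - κ * γ ^ 2 / 4))
      ≤ Kr * A * n * (2 * ((n : ℝ)⁻¹ * (1 / (1 + X / 2)))) := by
        rw [h2] at h1
        gcongr
        exact h1.trans (by gcongr)
    _ = 2 * Kr * A / (1 + X / 2) := by field_simp
    _ ≤ 1 / 2 := by
        rw [div_le_div_iff₀ (by positivity) two_pos]
        linarith

end Numerics


/-! ### From the expected failure to the success probability. -/

open scoped ENNReal

open Classical in
theorem half_le_toOuterMeasure {n : ℕ} {α : Type} {x : Prog n α} {s : Memory n}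
    {Q : α → Memory n → Prop} (h : expect x s (fun a s' => if Q a s' then 0 else 1) ≤ 1 / 2)
    {S : Set (α × Memory n)} (hS : ∀ o, Q o.1 o.2 → o ∈ S) :
    1 / 2 ≤ (x.run s).toOuterMeasure S := by
  have h1 : 1 ≤ (x.run s).toOuterMeasure S +
      expect x s (fun a s' => if Q a s' then 0 else 1) := by
    rw [PMF.toOuterMeasure_apply, expect, ← ENNReal.tsum_add]
    refine (x.run s).tsum_coe.symm.trans_le ?_
    refine ENNReal.tsum_le_tsum fun o => ?_
    by_cases ho : Q o.1 o.2
    · rw [Set.indicator_of_mem (hS o ho)]; exact le_self_add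
    · rw [if_neg ho, mul_one]; exact le_add_self
  have h2 : (1 : ℝ≥0∞) ≤ (x.run s).toOuterMeasure S + 1 / 2 := h1.trans (by gcongr)
  have h3 := tsub_le_iff_right.2 h2
  rwa [one_div, ENNReal.one_sub_inv_two, ← one_div] at h3

/-- Good start vertices have probability at least `2 p`, and from each of them the search succeeds
with probability at least `1/2`. -/
theorem findFromRandomVertex_ge {n : ℕ} (G : WeightedGraph n) (hn : 0 < n) (P : Fin n → Params)
    {S : Set (Fin n × Option (Finset (Fin n) × Finset (Fin n)) × ℕ)} {T : Finset (Fin n)} {p : ℝ}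
    (hT : 2 * p * G.vol ≤ ∑ i ∈ T, G.deg i)
    (hS : ∀ i ∈ T, 1 / 2 ≤ (find G (P i) i).toOuterMeasure {o | (i, o) ∈ S}) :
    ENNReal.ofReal p ≤ (findFromRandomVertex G hn P).toOuterMeasure S := by
  have hm := G.vol_pos hn
  rw [findFromRandomVertex, PMF.toOuterMeasure_bind_apply, tsum_fintype]
  have h1 : ∀ i ∈ T, ENNReal.ofReal (G.deg i / G.vol * (1 / 2)) ≤ G.startVertex hn i *
      ((find G (P i) i).map fun o => (i, o)).toOuterMeasure S := by
    intro i hi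
    rw [PMF.toOuterMeasure_map_apply, ENNReal.ofReal_mul (div_nonneg (G.deg_pos i).le hm.le)]
    refine mul_le_mul' le_rfl (le_trans (le_of_eq ?_) (hS i hi))
    rw [one_div, ENNReal.ofReal_inv_of_pos two_pos]; norm_num
  refine le_trans ?_ ((Finset.sum_le_sum h1).trans
    (Finset.sum_le_sum_of_subset_of_nonneg (Finset.subset_univ T) fun _ _ _ => zero_le))
  rw [← ENNReal.ofReal_sum_of_nonneg fun i _ =>
    mul_nonneg (div_nonneg (G.deg_pos i).le hm.le) (by norm_num), ← Finset.sum_mul,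
    ← Finset.sum_div]
  refine ENNReal.ofReal_le_ofReal ?_
  rw [div_mul_eq_mul_div, le_div_iff₀ hm]
  linarith

end FindCut
end

theorem mainTheorem5 (ε μ η : ℝ) (hε0 : 0 ≤ ε) (hε1 : ε < 1) (hμ : 0 < μ) (hη : 0 < η) :
    -- success with constant probability, and the work-to-output ratio
    (FindCut.sigma ε μ η ≤ 1 / 3 →
      ∃ δ₀ > (0 : ℝ), ∀ δ : ℝ, 0 < δ → δ ≤ δ₀ →
      ∃ p > (0 : ℝ), ∃ γ₀ > (0 : ℝ), γ₀ < 1 ∧ ∀ γ : ℝ, 0 < γ → γ ≤ γ₀ →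
      ∀ A : ℕ, ∃ κ₀ > (0 : ℝ), ∃ c₀ > (0 : ℝ),
      ∀ κ : ℝ, κ₀ ≤ κ → ∀ c : ℝ, 0 < c → c ≤ c₀ →
      ∃ (K : ℝ) (C : ℕ), ∀ (n : ℕ) (hn : 0 < n) (G : FindCut.WeightedGraph n) (Δ : ℝ)
        (α : Fin n → ℝ),
        G.vol ≤ (n : ℝ) ^ A →
        FindCut.DegreeBound G Δ →
        (∀ i, FindCut.ProbBound G (FindCut.walkLength ε μ δ G.vol) i (α i)) →
        1 - ε ≤ G.maxcut →
        ENNReal.ofReal p ≤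
          (FindCut.findFromRandomVertex G hn (fun i =>
            { ε := ε, μ := μ, η := η, δ := δ, γ := γ, κ := κ, c := c, Δ := Δ,
              α := α i })).toOuterMeasure
            {x | ∃ Even Odd : Finset (Fin n), x.2.1 = some (Even, Odd) ∧
              Disjoint Even Odd ∧ (Even ∪ Odd).Nonempty ∧
              FindCut.soto (FindCut.sigma ε μ η) * G.inc Even Odd ≤ G.cut Even Odd ∧
              (x.2.2 : ℝ) / ((Even ∪ Odd).card : ℝ) ≤
                K * Real.log G.vol ^ C * (α x.1 * Δ * G.vol ^ (1 + μ) + 1 / α x.1)}) ∧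
    -- the worst-case running time
    (∀ δ γ κ c : ℝ, 0 < δ → 0 < γ → γ < 1 → 0 < κ → 0 < c →
      ∃ (K : ℝ) (C : ℕ), ∀ (n : ℕ) (G : FindCut.WeightedGraph n) (Δ : ℝ) (i : Fin n) (α : ℝ),
        FindCut.DegreeBound G Δ →
        FindCut.ProbBound G (FindCut.walkLength ε μ δ G.vol) i α →
        ∀ o ∈ (FindCut.find G
            { ε := ε, μ := μ, η := η, δ := δ, γ := γ, κ := κ, c := c, Δ := Δ,
              α := α } i).support,
          (o.2 : ℝ) ≤ K * Real.log G.vol ^ C * (α * Δ * G.vol ^ (2 + μ))) := by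
  constructor
  · intro hσ
    have hpow : (1 - ε) ^ (1 + 1 / μ) ≤ 1 :=
      Real.rpow_le_one (by linarith) (by linarith) (by positivity)
    have hση : 0 ≤ FindCut.sigma ε μ η - η / 2 := by unfold FindCut.sigma; linarith
    obtain ⟨Ce, hCe0, hCe⟩ := FindCut.exists_edgeBound_soto
      (by linarith : 0 < FindCut.sigma ε μ η) hσ
    -- The first bound gives the projection `δ² m` above the eigenvalue threshold; the second keeps
    -- the loss from `δ` within half of `η`.
    refine ⟨min ((1 - ε) / 2) (η / 2 / (1 + 1 / μ)),
      lt_min (by linarith) (by positivity), fun δ hδ hδ₀ => ?_⟩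
    have hδ1 : δ ≤ (1 - ε) / 2 := hδ₀.trans (min_le_left _ _)
    have hδ2 : δ * (1 + 1 / μ) ≤ η / 2 :=
      (le_div_iff₀ (by positivity)).1 (hδ₀.trans (min_le_right _ _))
    set B := (δ ^ 2 / 4) ^ (1 + μ) * Real.exp (-(2 * (δ + -Real.log (1 - ε)))) with hB
    have hB0 : 0 < B := by positivity
    have hsq : 0 < √(128 + 18 / B) := Real.sqrt_pos.2 (by positivity)
    -- Start vertices of degree mass `δ²/4` are good, and half of that survives sampling. The bound
    -- on `γ` makes the relative rounding error at most `η / 16`.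
    refine ⟨δ ^ 2 / 8, by positivity, min (1 / 2) (η / 16 / √(128 + 18 / B)),
      lt_min (by norm_num) (by positivity), (min_le_left _ _).trans_lt (by norm_num),
      fun γ hγ hγ₀ A => ?_⟩
    have hγ1 : γ ≤ 1 / 2 := hγ₀.trans (min_le_left _ _)
    have hγB : γ * √(128 + 18 / B) ≤ η / 16 :=
      (le_div_iff₀ hsq).1 (hγ₀.trans (min_le_right _ _))
    have hKr := FindCut.roundsConst_pos hγ (by linarith) hμ
    set Kr := FindCut.roundsConst γ μ with hKrd
    -- The lower bound on `κ` is the one of `failure_le`. The bound on `c` makes the total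
    -- contribution of rejected rounds too small, since there are at most `Kr A ln n` rounds; the `+
    -- 1` gives a strict inequality and covers `A = 0`.
    refine ⟨4 * (2 + 8 * Kr * A) / γ ^ 2, by positivity,
      Ce * (η / 2) * B / (2 * γ * (Kr * A + 1)), by positivity, fun κ hκ₀ c hc hc₀ => ?_⟩
    have hκ : 0 < κ := lt_of_lt_of_le (by positivity) hκ₀
    refine ⟨FindCut.roundsConst γ μ * ((4 * FindCut.lengthConst μ δ + 34) * (3 * κ) / c +
          4 * (4 * FindCut.lengthConst μ δ + 88)) + 160, 4, fun n hn G Δ α hA hΔ hα hcut => ?_⟩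
    have hn2 := G.two_le hn
    have hn2' : (2 : ℝ) ≤ n := by exact_mod_cast hn2
    have hm2 : 2 ≤ G.vol := hn2'.trans G.card_le_vol
    have hlogn := FindCut.half_le_log hn2'
    obtain ⟨T, hT, hgood⟩ := G.exists_good_starts (η := η) hn hε0 hε1 hμ hδ hδ1 hδ2
      (by linarith) hcut
    refine FindCut.findFromRandomVertex_ge G hn _ (T := T) (by linarith) fun i hi => ?_
    obtain ⟨hen, hQ⟩ := hgood i hi
    set P : FindCut.Params :=
      { ε := ε, μ := μ, η := η, δ := δ, γ := γ, κ := κ, c := c, Δ := Δ, α := α i } with hP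
    set R := FindCut.numRounds G.vol P with hR
    have hlogm : Real.log G.vol ≤ A * Real.log n := by
      rw [← Real.log_pow]; exact Real.log_le_log (by linarith) hA
    have hRle : (R : ℝ) ≤ Kr * (A * Real.log n) :=
      (FindCut.numRounds_le (P := P) hγ (by change γ < 1; linarith) hμ hm2).trans
        (mul_le_mul_of_nonneg_left hlogm hKr.le)
    have hfail := FindCut.expect_findLoop G (P := P) hn2 hΔ hγ (by change γ < 1; linarith) hκ
      (hα i) (R := R) rfl (fun E O hEO => by
        refine G.exists_accepting_round hEO hn hγ hγ1
          (FindCut.numRounds_pos (P := P) hγ (by change γ < 1; linarith) hμ hm2)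
          (FindCut.abs_signedDensity_le_one G _ i) hσ hη hση hQ hB0 hen hCe0 hCe
          (FindCut.numRounds_spec (P := P) hγ (by change γ < 1; linarith) hm2).le hγB
          (by linarith : 0 < Real.log n) hc ?_ hΔ
        have h1 : 2 * γ * c * R ≤ 2 * γ * c * (Kr * (A * Real.log n)) := by gcongr
        rw [le_div_iff₀ (by positivity)] at hc₀
        have h2 : 0 < 2 * γ * c * Real.log n := by positivity
        have h3 := mul_le_mul_of_nonneg_right hc₀ (by linarith : 0 ≤ Real.log n)
        linarith) R 0 (FindCut.Memory.init n) (fun _ => ∅) (fun _ => ∅) (by simp)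
      (by simpa using FindCut.loopInv_init G Δ) ⟨rfl, rfl, fun r hr => absurd hr (by simp)⟩
      rfl rfl (fun q hq => absurd hq (by simp))
    have hhalf : (R : ENNReal) * ENNReal.ofReal (2 * (n : ℝ) ^ (1 - κ * γ ^ 2 / 4)) ≤ 1 / 2 := by
      rw [← ENNReal.ofReal_natCast, ← ENNReal.ofReal_mul (by positivity)]
      refine (ENNReal.ofReal_le_ofReal (FindCut.failure_le hn2 hKr.le (Nat.cast_nonneg A) hγ hκ₀
        hRle)).trans (le_of_eq ?_)
      rw [one_div, ENNReal.ofReal_inv_of_pos two_pos]; norm_num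
    rw [FindCut.find, PMF.toOuterMeasure_map_apply]
    rw [pow_zero] at hfail
    refine FindCut.half_le_toOuterMeasure (hfail.trans hhalf) fun o ho => ?_
    exact ho.ratio_le G hε0 hε1 hμ hδ hγ hγ1 hκ hc hΔ (hα i) hP
  · intro δ γ κ c hδ hγ0 hγ1 hκ _
    exact ⟨_, 3, fun n G Δ i α hΔ hα o ho =>
      FindCut.find_steps_le G hε0 hε1 hμ hδ hγ0 hγ1 hκ hΔ hα ho⟩
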